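/- **FedAMD with partial client participation, sequential probabilities.** There are $M$ clients with local data $\mathcal D_1,\dots,\mathcal D_M$ of common size $n\in\mathbb N\cup\{\infty\}$ (a finite data set, or a probability distribution when $n=\infty$). Let $f_m(x,\xi)$ be a per-sample loss, differentiable in $x\in\mathbb R^d$ and integrable in $\xi$; let $f_m(x,\mathcal B)=\frac1{|\mathcal B|}\sum_{\xi\in\mathcal B}f_m(x,\xi)$, $F_m(x)=\mathbb E_{\xi\sim\mathcal D_m}f_m(x,\xi)$, $F=\frac1M\sum_m F_m$, and assume that $F_*=\inf F$ is finite. Batches are drawn uniformly without replacement if $n<\infty$, and i.i.d. if $n=\infty$. Assume that there are $L>0$, $\sigma\ge0$, $L_\sigma\ge 0$ such that for all $m$, all $v,\bar v\in\mathbb R^d$ and all batch sizes $1\le|\mathcal B|\le n$: 1. $F_m$ is differentiable and $\|\nabla F_m(v)-\nabla F_m(\bar v)\|\le L\|v-\bar v\|$; 2. $\mathbb E_{\mathcal B}\|\nabla f_m(v,\mathcal B)-\nabla F_m(v)\|^2\le \sigma^2/|\mathcal B|$; 3. $\mathbb E_{\mathcal B}\|(\nabla f_m(v,\mathcal B)-\nabla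 f_m(\bar v,\mathcal B))-(\nabla F_m(v)-\nabla F_m(\bar v))\|^2\le \frac{L_\sigma^2}{|\mathcal B|}\|v-\bar v\|^2$. *Algorithm.* Start from $x_0\in\mathbb R^d$ and $v_0^{(m)}=\nabla f_m(x_0,\mathcal B_{m})$ with $|\mathcal B_{m}|=b$. In round $t=0,1,2,\dots$ a set $\mathcal A$ of $A$ clients ($1\le A\le M$) is drawn uniformly, and $g_t=\frac1M\sum_m v_t^{(m)}$. Each client of $\mathcal A$ is independently an anchor with probability $p_t$ and otherwise a miner, where $p_t=1$ if $\tau\mid t$ and $p_t=0$ otherwise, for an integer $\tau\ge2$. An anchor $i$ sets $v_{t+1}^{(i)}=\nabla f_i(x_t,\mathcal B)$ with a new batch of size $b$; for all other clients $v_{t+1}^{(i)}=v_t^{(i)}$. A miner $i$ sets $x^{(i)}_{-1}=x^{(i)}_0=x_t$, $g^{(i)}_0=g_t$ and, for $k=0,\dots,K-1$, with a new batch $\mathcal B_k$ of size $b'$, $$g^{(i)}_{k+1}=g^{(i)}_k-\nabla f_i(x^{(i)}_{k-1},\mathcal B_k)+\nabla f_i(x^{(i)}_k,\mathcal B_k),\qquad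 x^{(i)}_{k+1}=x^{(i)}_k-\eta_l\, g^{(i)}_{k+1}.$$ Then $x_{t+1}=x_t-\eta_s\cdot(\text{average over the miners } i \text{ of } x_t-x^{(i)}_K)$, and $x_{t+1}=x_t$ if there is no miner. All random choices are independent. *Claim.* Let $K\ge1$, $\varepsilon>0$, $b=\min\left(\left\lceil\frac{\sigma^2}{M\varepsilon}\right\rceil,n\right)$, $1\le b'<b$, and let $\eta_s,\eta_l>0$ satisfy $$\eta_s\eta_l=\frac1{KL}\Big(1+\frac{2M\tau}{A}\Big)^{-1},\qquad \eta_l\le\min\Big(\frac1{2\sqrt6\,KL},\ \frac{\sqrt{b'/K}}{4\sqrt3\,L_\sigma}\Big)$$ (the second term being $+\infty$ if $L_\sigma=0$). Then, for a constant $C$ that depends only on $L$ and on an upper bound for $F(x_0)-F_*$, every number of rounds $$T\ \ge\ C\Big(1+\frac{2M\tau}{A}\Big)\cdot\frac{\tau}{\tau-1}\cdot\frac1\varepsilon$$ suffices for $\min_{0\le t<T}\mathbb E\|\nabla F(x_t)\|^2\le\varepsilon$; that is, $T=O\big((1+\frac{2M\tau}{A})\frac{\tau}{\tau-1}\frac1\varepsilon\big)$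 rounds suffice, with $F(x_0)-F_*$ and $L$ treated as constants. -/

import Mathlib

open MeasureTheory ProbabilityTheory
open scoped ENNReal

noncomputable section

namespace FedAMD

/-- The parameter space `ℝ^d` with its Euclidean norm. -/
abbrev Vec (d : ℕ) := EuclideanSpace ℝ (Fin d)

/-! ### Local data and batches -/

/-- The training data of one client, with samples in `Ξ`: either a finite data set of `n` samples,
or (the streaming / online case, of infinite size) a probability distribution on `Ξ`. -/
inductive LocalData (Ξ : Type*) [MeasurableSpace Ξ] where
  | finite (n : ℕ) (data : Fin n → Ξ)
  | online (P : ProbabilityMeasure Ξ)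

namespace LocalData

variable {Ξ : Type*} [MeasurableSpace Ξ]

/-- The size `|D|` of the local data, infinite in the online case. -/
def size : LocalData Ξ → ℕ∞
  | finite n _ => n
  | online _ => ⊤

/-- The law of one random sample of the local data. -/
def sampleLaw : LocalData Ξ → Measure Ξ
  | finite n data => (n : ℝ≥0∞)⁻¹ • ∑ j : Fin n, Measure.dirac (data j)
  | online P => (P : Measure Ξ)

/-- The law of a random batch of `β` samples, listed in random order: drawn uniformly without
replacement from a finite data set, i.i.d. in the online case. It is used for `β ≤ D.size`. -/
def batchLaw (β : ℕ) : LocalData Ξ → Measure (Fin β → Ξ)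
  | finite n data =>
      (Fintype.card (Fin β ↪ Fin n) : ℝ≥0∞)⁻¹ •
        ∑ e : Fin β ↪ Fin n, Measure.dirac (fun j => data (e j))
  | online P => Measure.pi fun _ => (P : Measure Ξ)

end LocalData

/-! ### Loss functions -/

section Losses

variable {Ξ : Type*} [MeasurableSpace Ξ] {d M : ℕ}

/-- The empirical loss `f(x, B)` of a batch `B`, for the per-sample loss `f`. -/
def batchLoss (f : Vec d → Ξ → ℝ) {β : ℕ} (x : Vec d) (B : Fin β → Ξ) : ℝ :=
  (β : ℝ)⁻¹ * ∑ j, f x (B j)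

/-- The stochastic gradient `∇ f(x, B)`, with respect to `x`. -/
def batchGrad (f : Vec d → Ξ → ℝ) {β : ℕ} (x : Vec d) (B : Fin β → Ξ) : Vec d :=
  gradient (fun y => batchLoss f y B) x

/-- The local expected loss `F_m`. -/
def localLoss (D : Fin M → LocalData Ξ) (f : Fin M → Vec d → Ξ → ℝ) (m : Fin M) (x : Vec d) : ℝ :=
  ∫ ξ, f m x ξ ∂(D m).sampleLaw

/-- The global objective `F = (1 / M) ∑ F_m`. -/
def globalLoss (D : Fin M → LocalData Ξ) (f : Fin M → Vec d → Ξ → ℝ) (x : Vec d) : ℝ :=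
  (M : ℝ)⁻¹ * ∑ m, localLoss D f m x

/-- Standing regularity: each per-sample loss is differentiable in the model, and measurable and
integrable in the sample. -/
structure Regular (D : Fin M → LocalData Ξ) (f : Fin M → Vec d → Ξ → ℝ) : Prop where
  differentiable : ∀ m ξ, Differentiable ℝ fun x => f m x ξ
  measurable : ∀ m x, Measurable (f m x)
  integrable : ∀ m x, Integrable (f m x) (D m).sampleLaw

/-- `L`-smoothness of the local objective functions. -/
def LSmooth (D : Fin M → LocalData Ξ) (f : Fin M → Vec d → Ξ → ℝ) (L : ℝ) : Prop :=
  ∀ m, Differentiable ℝ (localLoss D f m) ∧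
    ∀ v w, ‖gradient (localLoss D f m) v - gradient (localLoss D f m) w‖ ≤ L * ‖v - w‖

/-- Bounded noise: the stochastic gradient over a batch `B` has variance at most `σ² / |B|`. -/
def BoundedNoise (D : Fin M → LocalData Ξ) (f : Fin M → Vec d → Ξ → ℝ) (σ : ℝ) : Prop :=
  ∀ (m : Fin M) (β : ℕ), 1 ≤ β → (β : ℕ∞) ≤ (D m).size → ∀ v : Vec d,
    ∫⁻ B, ‖batchGrad (f m) v B - gradient (localLoss D f m) v‖ₑ ^ 2 ∂(D m).batchLaw β
      ≤ ENNReal.ofReal (σ ^ 2 / β)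

/-- Average `L_σ`-smoothness of the stochastic gradients. -/
def AvgSmooth (D : Fin M → LocalData Ξ) (f : Fin M → Vec d → Ξ → ℝ) (Lσ : ℝ) : Prop :=
  ∀ (m : Fin M) (β : ℕ), 1 ≤ β → (β : ℕ∞) ≤ (D m).size → ∀ v w : Vec d,
    ∫⁻ B, ‖(batchGrad (f m) v B - batchGrad (f m) w B) -
        (gradient (localLoss D f m) v - gradient (localLoss D f m) w)‖ₑ ^ 2 ∂(D m).batchLaw β
      ≤ ENNReal.ofReal (Lσ ^ 2 / β * ‖v - w‖ ^ 2)

end Losses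

/-! ### The algorithm -/

section Algorithm

variable {Ξ : Type*} {d M b b' K : ℕ}

/-- State of a miner after `k` local updates: `prev = x_{k-1}`, `cur = x_k`, `dir = g_k`. -/
structure LocalState (d : ℕ) where
  prev : Vec d
  cur : Vec d
  dir : Vec d

/-- One local update of a miner with the minibatch `B`:
`g_{k+1} = g_k - ∇f(x_{k-1}, B) + ∇f(x_k, B)` and `x_{k+1} = x_k - η_l g_{k+1}`. -/
def localStep (f : Vec d → Ξ → ℝ) (ηl : ℝ) (s : LocalState d) (B : Fin b' → Ξ) : LocalState d :=
  let g := s.dir - batchGrad f s.prev B + batchGrad f s.cur B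
  { prev := s.cur, cur := s.cur - ηl • g, dir := g }

/-- The miner's state after `k ≤ K` local updates, started at `x_{-1} = x_0 = x`, `g_0 = g`. -/
def localState (f : Vec d → Ξ → ℝ) (ηl : ℝ) (x g : Vec d) (B : Fin K → Fin b' → Ξ) :
    ℕ → LocalState d
  | 0 => { prev := x, cur := x, dir := g }
  | k + 1 =>
      if h : k < K then localStep f ηl (localState f ηl x g B k) (B ⟨k, h⟩)
      else localState f ηl x g B k

/-- The model change `Δx = x - x_K` a miner sends to the server. -/
def localDelta (f : Vec d → Ξ → ℝ) (ηl : ℝ) (x g : Vec d) (B : Fin K → Fin b' → Ξ) : Vec d :=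
  x - (localState f ηl x g B K).cur

/-- State of the system at the beginning of a round: the global model and the caching gradients. -/
structure State (d M : ℕ) where
  model : Vec d
  cache : Fin M → Vec d

/-- The global bullseye: the average of all the caching gradients. -/
def State.bullseye (s : State d M) : Vec d := (M : ℝ)⁻¹ • ∑ m, s.cache m

/-- The randomness of one round: the set of sampled clients, the Bernoulli variables (`true` means
anchor), the large batches and the small batches of the local updates. -/
abbrev RoundSeed (Ξ : Type*) (M b b' K : ℕ) :=
  Finset (Fin M) × (Fin M → Bool) × (Fin M → Fin b → Ξ) × (Fin M → Fin K → Fin b' → Ξ)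

/-- One round of FedAMD. -/
def roundStep (f : Fin M → Vec d → Ξ → ℝ) (ηs ηl : ℝ) (s : State d M)
    (ω : RoundSeed Ξ M b b' K) : State d M :=
  let sampled := ω.1
  let coin := ω.2.1
  let large := ω.2.2.1
  let small := ω.2.2.2
  let miners := sampled.filter fun i => coin i = false
  { model :=
      if miners.Nonempty then
        s.model - ηs • ((miners.card : ℝ)⁻¹ •
          ∑ i ∈ miners, localDelta (f i) ηl s.model s.bullseye (small i))
      else s.model
    cache := fun i =>
      if i ∈ sampled ∧ coin i = true then batchGrad (f i) s.model (large i) else s.cache i }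

/-- All the randomness of a run: the large batches that initialize the caching gradients, and the
randomness of the rounds `t = 0, 1, 2, …`. -/
abbrev Seed (Ξ : Type*) (M b b' K : ℕ) := (Fin M → Fin b → Ξ) × (ℕ → RoundSeed Ξ M b b' K)

/-- The state at the beginning of round `t`; initially `v_0^{(m)} = ∇ f_m(x₀, B_{m,0})`. -/
def run (f : Fin M → Vec d → Ξ → ℝ) (ηs ηl : ℝ) (x₀ : Vec d) (ω : Seed Ξ M b b' K) :
    ℕ → State d M
  | 0 => { model := x₀, cache := fun m => batchGrad (f m) x₀ (ω.1 m) }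
  | t + 1 => roundStep f ηs ηl (run f ηs ηl x₀ ω t) (ω.2 t)

end Algorithm

/-! ### The law of the randomness -/

section Law

variable {Ξ : Type*} [MeasurableSpace Ξ] {M : ℕ}

/-- The Bernoulli distribution with parameter `p ∈ [0, 1]`. -/
def coinLaw (p : ℝ) : Measure Bool :=
  ENNReal.ofReal p • Measure.dirac true + ENNReal.ofReal (1 - p) • Measure.dirac false

/-- The law of the randomness of a round with anchor probability `p`: a uniformly random set of `A`
clients, Bernoulli variables, and batches, all independent. -/
def roundLaw (D : Fin M → LocalData Ξ) (A b b' K : ℕ) (p : ℝ) : Measure (RoundSeed Ξ M b b' K) :=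
  (uniformOn {s : Finset (Fin M) | s.card = A}).prod
    ((Measure.pi fun _ => coinLaw p).prod
      ((Measure.pi fun m => (D m).batchLaw b).prod
        (Measure.pi fun m => Measure.pi fun _ : Fin K => (D m).batchLaw b')))

/-- The law of the randomness of a run with anchor probabilities `p_t`: the initial batches and the
rounds are all independent. -/
def seedLaw (D : Fin M → LocalData Ξ) (A b b' K : ℕ) (p : ℕ → ℝ) : Measure (Seed Ξ M b b' K) :=
  (Measure.pi fun m => (D m).batchLaw b).prod
    (Measure.infinitePi fun t => roundLaw D A b b' K (p t))

/-- The sequential probability setting of period `τ`. -/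
def seqProb (τ t : ℕ) : ℝ := if t % τ = 0 then 1 else 0

end Law

end FedAMD

end

open MeasureTheory ProbabilityTheory
open scoped ENNReal

noncomputable section

namespace FedAMD

/-! ### Probability on product spaces -/

/-! With sequential probabilities a run splits into periods of `τ` rounds. The first round of a
period keeps the model and refreshes the caches of `A` random clients; the other `τ - 1` rounds keep
the caches, hence the bullseye `g`. A period is therefore close to a single gradient step of length
`κ = ηs ηl K (τ - 1)` along `-g`. With `r = A / M`, the step size rule gives `L κ = (τ - 1) / (1 + 2
τ / r) ≤ r / 2`.

Mining (`GradOracle.moments_localDelta`, `RoundModel.moments_mining`). Stochastic gradients are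
unbiased and every batch is independent of the local state before it. A local direction changes by a
gradient difference over a displacement at most `ηl` times the previous direction, so second moments
grow geometrically with a ratio `1 + O(1 / K)`. Over a whole phase this costs a factor `5 / 4` in
the second moment and an error of `0.127 ‖u‖ ‖g‖` in the alignment with a test vector `u`.

Anchoring (`RoundModel.anchor_step`). In expectation the refresh moves the bullseye by the fraction
`r` towards the true gradient. Its second moment also contains the dispersion of the cache errors,
caused by sampling without replacement, and the noise of the large batches. The choice of `b` bounds
the latter by `M ε` per client (`lintegral_large_noise`); independence between clients turns this
into `ε` for the average of all of them.

Four expectations are tracked at the beginnings of periods: the suboptimality of the model, the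
alignment of gradient and bullseye, the second moment of the bullseye, and the mean squared cache
error. A linear combination of them (`lyapunov`) is nonnegative (`lyapunov_nonneg`), and one period
lowers it by at least `r k` times the expected squared gradient, up to a noise term `0.98 r k ε`
(`lyapunov_step`, with the weight from `exists_weight`). If the expected squared gradient exceeded
`ε` at the beginnings of `N` periods, the function would fall by more than `0.02 r k ε` each time;
its initial value, of order `k L Δ r (1 + 2 τ / r) / (τ - 1)`, makes that impossible for large `N`
(`RoundModel.exists_gradSq_le`). -/

theorem measurable_comp_pair {α E F G : Type*} [MeasurableSpace α] [MeasurableSpace E]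
    [MeasurableSpace F] [MeasurableSpace G] {f : E → F → G}
    (h : Measurable fun p : E × F => f p.1 p.2) {a : α → E} {b : α → F} (ha : Measurable a)
    (hb : Measurable b) : Measurable fun x => f (a x) (b x) :=
  h.comp (ha.prodMk hb)

section Products

variable {ι : Type*} {Ω : ι → Type*} [∀ i, MeasurableSpace (Ω i)] {E : Type*} [MeasurableSpace E]

/-- A measurable function of finitely many coordinates is independent of any other coordinate. -/
theorem map_prod_infinitePi (μ : ∀ i, Measure (Ω i)) [∀ i, IsProbabilityMeasure (μ i)]
    {X : (∀ i, Ω i) → E} (hX : Measurable X) {S : Finset ι} (hS : DependsOn X S) {k : ι}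
    (hk : k ∉ S) :
    (Measure.infinitePi μ).map (fun ω => (X ω, ω k)) =
      ((Measure.infinitePi μ).map X).prod (μ k) := by
  classical
  have hne : ∀ i, Nonempty (Ω i) := fun i => (μ i).nonempty_of_neZero
  let o : ∀ i, Ω i := fun i => (hne i).some
  -- `X` only sees the coordinates in `S`, so it factors through the restriction to `S`; the other
  -- coordinates are filled with arbitrary points. Independence then passes from the two disjoint
  -- blocks `S` and `{k}` to `X` and coordinate `k`.
  let ext : (∀ i : S, Ω i) → ∀ i, Ω i := fun y i => if h : i ∈ S then y ⟨i, h⟩ else o i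
  have hext : Measurable ext := by
    refine measurable_pi_lambda _ fun i => ?_
    by_cases h : i ∈ S
    · simpa [ext, h] using measurable_pi_apply _
    · simp [ext, h]
  have hfac : ∀ ω, X ω = X (ext fun i : S => ω i) := by
    intro ω
    refine hS fun i hi => ?_
    have hi' : i ∈ S := hi
    simp [ext, hi']
  have hind : iIndepFun (fun i (ω : ∀ i, Ω i) => ω i) (Measure.infinitePi μ) :=
    iIndepFun_infinitePi (P := μ) (X := fun i (x : Ω i) => x) fun i => measurable_id
  have h2 := hind.indepFun_finset S {k} (by simpa using hk) fun i => measurable_pi_apply i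
  have h3 : IndepFun X (fun ω => ω k) (Measure.infinitePi μ) := by
    have hψ : Measurable fun y : (∀ i : ({k} : Finset ι), Ω i) => y ⟨k, by simp⟩ :=
      measurable_pi_apply _
    have := h2.comp (φ := fun y => X (ext y)) (hX.comp hext) hψ
    have e : X = (fun y => X (ext y)) ∘ fun (ω : ∀ i, Ω i) (i : S) => ω i := by
      funext ω; exact hfac ω
    rw [e]; exact this
  have h4 := (indepFun_iff_map_prod_eq_prod_map_map hX.aemeasurable
    (measurable_pi_apply k).aemeasurable).1 h3
  rw [h4, Measure.infinitePi_map_eval]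

/-- The version of `map_prod_infinitePi` for finite products. -/
theorem map_prod_pi [Fintype ι] (μ : ∀ i, Measure (Ω i)) [∀ i, IsProbabilityMeasure (μ i)]
    {X : (∀ i, Ω i) → E} (hX : Measurable X) {S : Finset ι} (hS : DependsOn X S) {k : ι}
    (hk : k ∉ S) :
    (Measure.pi μ).map (fun ω => (X ω, ω k)) = ((Measure.pi μ).map X).prod (μ k) := by
  rw [← Measure.infinitePi_eq_pi]
  exact map_prod_infinitePi μ hX hS hk

/-- The version of `map_prod_infinitePi` with an additional independent variable. -/
theorem map_prod_prod_infinitePi {Ω₀ : Type*} [MeasurableSpace Ω₀] (ν : Measure Ω₀)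
    [IsProbabilityMeasure ν] (μ : ∀ i, Measure (Ω i)) [∀ i, IsProbabilityMeasure (μ i)]
    {X : Ω₀ × (∀ i, Ω i) → E} (hX : Measurable X) {S : Finset ι}
    (hS : ∀ a, DependsOn (fun ω => X (a, ω)) S) {k : ι} (hk : k ∉ S) :
    (ν.prod (Measure.infinitePi μ)).map (fun ω => (X ω, ω.2 k)) =
      ((ν.prod (Measure.infinitePi μ)).map X).prod (μ k) := by
  have hm : Measurable fun ω : Ω₀ × (∀ i, Ω i) => (X ω, ω.2 k) := by fun_prop
  refine Measure.ext_of_lintegral _ fun f hf => ?_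
  have h1 : Measurable fun ω : Ω₀ × (∀ i, Ω i) => f (X ω, ω.2 k) := hf.comp hm
  have h2 : Measurable fun ω : Ω₀ × (∀ i, Ω i) => ∫⁻ y, f (X ω, y) ∂μ k :=
    hf.lintegral_prod_right'.comp hX
  rw [lintegral_map hf hm, lintegral_prod _ h1.aemeasurable,
    lintegral_prod _ hf.aemeasurable, lintegral_map hf.lintegral_prod_right' hX,
    lintegral_prod _ h2.aemeasurable]
  refine lintegral_congr fun a => ?_
  have hXa : Measurable fun ω => X (a, ω) := by fun_prop
  have := congrArg (fun m => ∫⁻ z, f z ∂m) (map_prod_infinitePi μ hXa (hS a) hk)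
  rw [lintegral_map hf (by fun_prop), lintegral_prod _ hf.aemeasurable,
    lintegral_map hf.lintegral_prod_right' hXa] at this
  exact this

end Products

theorem integral_comp_measurePreserving {α β E : Type*} [MeasurableSpace α] [MeasurableSpace β]
    [NormedAddCommGroup E] [NormedSpace ℝ E] {μ : Measure α} {ν : Measure β} {g : α → β}
    (hg : MeasurePreserving g μ ν) {φ : β → E} (hφ : AEStronglyMeasurable φ ν) :
    ∫ a, φ (g a) ∂μ = ∫ y, φ y ∂ν := by
  have h := integral_map hg.measurable.aemeasurable (hg.map_eq.symm ▸ hφ)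
  rw [hg.map_eq] at h
  exact h.symm

/-! ### Second moments and the bias-variance decomposition -/

section Moments

variable {Ω : Type*} [MeasurableSpace Ω] {μ : Measure Ω} {E : Type*} [NormedAddCommGroup E]

/-- The second moment of an integrable square is bounded by a bound for its lower integral. -/
theorem integral_sq_norm_le_of_lintegral {X : Ω → E} (hX : AEStronglyMeasurable X μ) {c : ℝ}
    (hc : 0 ≤ c) (h : ∫⁻ ω, ‖X ω‖ₑ ^ 2 ∂μ ≤ ENNReal.ofReal c) :
    Integrable (fun ω => ‖X ω‖ ^ 2) μ ∧ ∫ ω, ‖X ω‖ ^ 2 ∂μ ≤ c := by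
  have e : ∀ ω, ENNReal.ofReal (‖X ω‖ ^ 2) = ‖X ω‖ₑ ^ 2 := fun ω => by
    rw [ENNReal.ofReal_pow (norm_nonneg _), ofReal_norm]
  have hm : AEStronglyMeasurable (fun ω => ‖X ω‖ ^ 2) μ := hX.norm.pow 2
  have hi : Integrable (fun ω => ‖X ω‖ ^ 2) μ := by
    refine ⟨hm, ?_⟩
    rw [hasFiniteIntegral_iff_ofReal (Filter.Eventually.of_forall fun ω => by positivity)]
    simp_rw [e]
    exact h.trans_lt ENNReal.ofReal_lt_top
  refine ⟨hi, ?_⟩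
  rw [integral_eq_lintegral_of_nonneg_ae (Filter.Eventually.of_forall fun ω => by positivity) hm]
  simp_rw [e]
  exact ENNReal.toReal_le_of_le_ofReal hc h

theorem memLp_two_of_integrable_sq_norm {X : Ω → E} (hX : AEStronglyMeasurable X μ)
    (h : Integrable (fun ω => ‖X ω‖ ^ 2) μ) : MemLp X 2 μ :=
  (memLp_two_iff_integrable_sq_norm hX).2 h

/-- The difference of the two sides is the variance of the norm. -/
theorem sq_integral_norm_le [IsProbabilityMeasure μ] {X : Ω → E} (hX : MemLp X 2 μ) :
    (∫ ω, ‖X ω‖ ∂μ) ^ 2 ≤ ∫ ω, ‖X ω‖ ^ 2 ∂μ := by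
  have h := variance_nonneg (fun ω => ‖X ω‖) μ
  rw [variance_eq_sub hX.norm] at h
  simpa using sub_nonneg.1 h

variable [InnerProductSpace ℝ E]

theorem MemLp.integrable_inner_two {X Y : Ω → E} (hX : MemLp X 2 μ) (hY : MemLp Y 2 μ) :
    Integrable (fun ω => inner ℝ (X ω) (Y ω)) μ := by
  refine Integrable.mono' ((hX.integrable_norm_pow two_ne_zero).add
    (hY.integrable_norm_pow two_ne_zero)) (hX.1.inner hY.1) ?_
  refine Filter.Eventually.of_forall fun ω => ?_
  have := norm_inner_le_norm (𝕜 := ℝ) (X ω) (Y ω)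
  simp only [Pi.add_apply]
  nlinarith [sq_nonneg (‖X ω‖ - ‖Y ω‖), sq_nonneg (‖X ω‖), sq_nonneg (‖Y ω‖)]

/-- Bias-variance decomposition. -/
theorem integral_sq_norm_const_add [CompleteSpace E] [IsProbabilityMeasure μ] {X : Ω → E}
    (hX : MemLp X 2 μ) (a y : E) (hy : ∫ ω, X ω ∂μ = y) :
    ∫ ω, ‖a + X ω‖ ^ 2 ∂μ = ‖a + y‖ ^ 2 + ∫ ω, ‖X ω - y‖ ^ 2 ∂μ := by
  have hi : Integrable X μ := hX.integrable (by norm_num)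
  have hc : MemLp (fun ω => X ω - y) 2 μ := hX.sub (memLp_const y)
  have e : ∀ ω, ‖a + X ω‖ ^ 2 =
      ‖a + y‖ ^ 2 + 2 * inner ℝ (a + y) (X ω - y) + ‖X ω - y‖ ^ 2 := fun ω => by
    rw [← norm_add_sq_real]; congr 2; abel
  simp_rw [e]
  have hd : Integrable (fun ω => X ω - y) μ := hi.sub (integrable_const y)
  have h0 : ∫ ω, inner ℝ (a + y) (X ω - y) ∂μ = 0 := by
    rw [integral_inner hd, integral_sub hi (integrable_const y), hy]
    simp
  have h1 : Integrable (fun ω => 2 * inner ℝ (a + y) (X ω - y)) μ :=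
    (hd.const_inner _).const_mul 2
  have h2 : Integrable (fun ω => ‖a + y‖ ^ 2 + 2 * inner ℝ (a + y) (X ω - y)) μ :=
    (integrable_const _).add h1
  rw [integral_add h2 (hc.integrable_norm_pow two_ne_zero),
    integral_add (integrable_const _) h1, integral_const_mul, h0]
  simp

omit [InnerProductSpace ℝ E] in
theorem lintegral_enorm_sq {X : Ω → E} (hX : MemLp X 2 μ) :
    ∫⁻ ω, ‖X ω‖ₑ ^ 2 ∂μ = ENNReal.ofReal (∫ ω, ‖X ω‖ ^ 2 ∂μ) := by
  rw [ofReal_integral_eq_lintegral_ofReal (hX.integrable_norm_pow two_ne_zero)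
    (Filter.Eventually.of_forall fun ω => by positivity)]
  refine lintegral_congr fun ω => ?_
  rw [ENNReal.ofReal_pow (norm_nonneg _), ofReal_norm]

end Moments

/-! ### Expectations given an independent variable -/

section Independent

variable {Ω F G : Type*} [MeasurableSpace Ω] [MeasurableSpace F] [MeasurableSpace G]
  {P : Measure Ω} {ν : Measure G} [IsProbabilityMeasure P] [IsProbabilityMeasure ν]
  {X : Ω → F} {Y : Ω → G}

omit [IsProbabilityMeasure P] in
theorem lintegral_indep (hX : Measurable X) (hY : Measurable Y)
    (h : P.map (fun ω => (X ω, Y ω)) = (P.map X).prod ν) {φ : F → G → ℝ≥0∞}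
    (hφ : Measurable fun p : F × G => φ p.1 p.2) :
    ∫⁻ ω, φ (X ω) (Y ω) ∂P = ∫⁻ ω, ∫⁻ y, φ (X ω) y ∂ν ∂P := by
  have h1 := lintegral_map (μ := P) hφ (hX.prodMk hY)
  rw [h, lintegral_prod _ hφ.aemeasurable, lintegral_map hφ.lintegral_prod_right' hX] at h1
  exact h1.symm

omit [IsProbabilityMeasure P] in
/-- A conditional bound for the second moment gives an unconditional one. -/
theorem integral_sq_norm_le_of_indep {E : Type*} [NormedAddCommGroup E] [MeasurableSpace E]
    [BorelSpace E] [SecondCountableTopology E] (hX : Measurable X) (hY : Measurable Y)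
    (h : P.map (fun ω => (X ω, Y ω)) = (P.map X).prod ν) {φ : F → G → E}
    (hφ : Measurable fun p : F × G => φ p.1 p.2) {c : F → ℝ} (hc : ∀ e, 0 ≤ c e)
    (hcX : Integrable (fun ω => c (X ω)) P)
    (hb : ∀ e, ∫⁻ y, ‖φ e y‖ₑ ^ 2 ∂ν ≤ ENNReal.ofReal (c e)) :
    MemLp (fun ω => φ (X ω) (Y ω)) 2 P ∧
      ∫ ω, ‖φ (X ω) (Y ω)‖ ^ 2 ∂P ≤ ∫ ω, c (X ω) ∂P := by
  have hm : AEStronglyMeasurable (fun ω => φ (X ω) (Y ω)) P :=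
    (measurable_comp_pair hφ hX hY).aestronglyMeasurable
  have h0 : 0 ≤ ∫ ω, c (X ω) ∂P := integral_nonneg fun ω => hc _
  have h1 : ∫⁻ ω, ‖φ (X ω) (Y ω)‖ₑ ^ 2 ∂P ≤ ENNReal.ofReal (∫ ω, c (X ω) ∂P) := by
    rw [lintegral_indep hX hY h (φ := fun e y => ‖φ e y‖ₑ ^ 2) (hφ.enorm.pow_const 2),
      ofReal_integral_eq_lintegral_ofReal hcX (Filter.Eventually.of_forall fun ω => hc _)]
    exact lintegral_mono fun ω => hb _
  have h2 := integral_sq_norm_le_of_lintegral hm h0 h1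
  exact ⟨memLp_two_of_integrable_sq_norm hm h2.1, h2.2⟩

/-- A conditional lower bound for an expectation gives an unconditional one. -/
theorem le_integral_of_indep (hX : Measurable X) (hY : Measurable Y)
    (h : P.map (fun ω => (X ω, Y ω)) = (P.map X).prod ν) {φ : F → G → ℝ}
    (hφ : Measurable fun p : F × G => φ p.1 p.2)
    (hi : Integrable (fun ω => φ (X ω) (Y ω)) P) {c : F → ℝ}
    (hcX : Integrable (fun ω => c (X ω)) P) (hb : ∀ e, c e ≤ ∫ y, φ e y ∂ν) :
    ∫ ω, c (X ω) ∂P ≤ ∫ ω, φ (X ω) (Y ω) ∂P := by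
  have hXY : Measurable fun ω => (X ω, Y ω) := hX.prodMk hY
  have hi2 : Integrable (fun p : F × G => φ p.1 p.2) ((P.map X).prod ν) := by
    rw [← h]
    exact (integrable_map_measure hφ.aestronglyMeasurable hXY.aemeasurable).2 hi
  have := Measure.isProbabilityMeasure_map (μ := P) hX.aemeasurable
  have h1 := integral_map (μ := P) hXY.aemeasurable (f := fun p : F × G => φ p.1 p.2)
    hφ.aestronglyMeasurable
  have hm : AEStronglyMeasurable (fun e => ∫ y, φ e y ∂ν) (P.map X) :=
    hφ.stronglyMeasurable.integral_prod_right'.aestronglyMeasurable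
  rw [h, integral_prod _ hi2, integral_map hX.aemeasurable hm] at h1
  rw [← h1]
  have hi3 := hi2.integral_prod_left
  exact integral_mono hcX ((integrable_map_measure hm hX.aemeasurable).1 hi3) fun ω => hb _

end Independent

/-! ### Stochastic gradients -/

section Gradients

variable {Ξ : Type*} [MeasurableSpace Ξ] {d : ℕ} {f : Vec d → Ξ → ℝ}

theorem gradient_const_mul_sum {ι : Type*} {s : Finset ι} {g : ι → Vec d → ℝ}
    (hg : ∀ i, Differentiable ℝ (g i)) (c : ℝ) (x : Vec d) :
    gradient (fun y => c * ∑ i ∈ s, g i y) x = c • ∑ i ∈ s, gradient (g i) x := by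
  have h1 : HasGradientAt (fun y => ∑ i ∈ s, g i y) (∑ i ∈ s, gradient (g i) x) x := by
    rw [hasGradientAt_iff_hasFDerivAt, map_sum]
    exact HasFDerivAt.fun_sum fun i _ => (hg i x).hasGradientAt.hasFDerivAt
  have h2 : HasGradientAt (fun y => c * ∑ i ∈ s, g i y) (c • ∑ i ∈ s, gradient (g i) x) x := by
    rw [hasGradientAt_iff_hasFDerivAt, map_smul]
    exact h1.hasFDerivAt.const_mul c
  exact h2.gradient

omit [MeasurableSpace Ξ] in
theorem batchGrad_eq (hf : ∀ ξ, Differentiable ℝ fun x => f x ξ) {β : ℕ} (x : Vec d)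
    (B : Fin β → Ξ) :
    batchGrad f x B = (β : ℝ)⁻¹ • ∑ j, gradient (fun y => f y (B j)) x :=
  gradient_const_mul_sum (fun j => hf (B j)) _ x

/-- The gradient of a Carathéodory function is jointly measurable. -/
theorem measurable_gradient_uncurry (hf : ∀ ξ, Differentiable ℝ fun x => f x ξ)
    (hm : ∀ x, Measurable (f x)) :
    Measurable fun p : Vec d × Ξ => gradient (fun y => f y p.2) p.1 := by
  have hu : Measurable (Function.uncurry f) :=
    measurable_uncurry_of_continuous_of_measurable (fun ξ => (hf ξ).continuous) hm
  have hd : ∀ v : Vec d, Measurable fun p : Vec d × Ξ => fderiv ℝ (fun y => f y p.2) p.1 v := by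
    intro v
    -- Each directional derivative is a limit of the difference quotients with step `1 / n`, which
    -- are jointly measurable because a Carathéodory function is.
    have hlim : Filter.Tendsto (fun (n : ℕ) (p : Vec d × Ξ) =>
        (n : ℝ) * (f (p.1 + (n : ℝ)⁻¹ • v) p.2 - f p.1 p.2)) Filter.atTop
        (nhds fun p => fderiv ℝ (fun y => f y p.2) p.1 v) := by
      rw [tendsto_pi_nhds]
      intro p
      have := (hf p.2 p.1).hasFDerivAt.lim v (c := fun n : ℕ => (n : ℝ))
        (l := Filter.atTop) (by simpa using tendsto_natCast_atTop_atTop (R := ℝ))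
      simpa using this
    refine measurable_of_tendsto_metrizable (fun n => ?_) hlim
    have h1 : Measurable fun p : Vec d × Ξ => f (p.1 + (n : ℝ)⁻¹ • v) p.2 :=
      hu.comp ((measurable_fst.add_const _).prodMk measurable_snd)
    exact (h1.sub hu).const_mul _
  let b := EuclideanSpace.basisFun (Fin d) ℝ
  have e : (fun p : Vec d × Ξ => gradient (fun y => f y p.2) p.1) =
      fun p => ∑ i, fderiv ℝ (fun y => f y p.2) p.1 (b i) • b i := by
    funext p
    rw [← b.sum_repr' (gradient (fun y => f y p.2) p.1)]
    refine Finset.sum_congr rfl fun i _ => ?_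
    congr 1
    rw [real_inner_comm, gradient, InnerProductSpace.toDual_symm_apply]
  rw [e]
  exact Finset.measurable_fun_sum _ fun i _ => (hd (b i)).smul_const _

theorem measurable_batchGrad (hf : ∀ ξ, Differentiable ℝ fun x => f x ξ)
    (hm : ∀ x, Measurable (f x)) {β : ℕ} :
    Measurable fun p : Vec d × (Fin β → Ξ) => batchGrad f p.1 p.2 := by
  have h := measurable_gradient_uncurry hf hm
  have e : (fun p : Vec d × (Fin β → Ξ) => batchGrad f p.1 p.2) =
      fun p => (β : ℝ)⁻¹ • ∑ j, gradient (fun y => f y (p.2 j)) p.1 := by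
    funext p; exact batchGrad_eq hf p.1 p.2
  rw [e]
  have hs : ∀ j : Fin β, Measurable fun p : Vec d × (Fin β → Ξ) =>
      gradient (fun y => f y (p.2 j)) p.1 := fun j =>
    h.comp (measurable_fst.prodMk ((measurable_pi_apply j).comp measurable_snd))
  have hs' : Measurable fun p : Vec d × (Fin β → Ξ) =>
      ∑ j, gradient (fun y => f y (p.2 j)) p.1 := Finset.measurable_fun_sum _ fun j _ => hs j
  exact hs'.const_smul (β : ℝ)⁻¹

theorem measurable_batchGrad_right (hf : ∀ ξ, Differentiable ℝ fun x => f x ξ)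
    (hm : ∀ x, Measurable (f x)) {β : ℕ} (v : Vec d) :
    Measurable fun B : Fin β → Ξ => batchGrad f v B :=
  measurable_comp_pair (f := fun v (B : Fin β → Ξ) => batchGrad f v B)
    (measurable_batchGrad hf hm) measurable_const measurable_id

end Gradients

/-! ### Averages over random batches -/

namespace LocalData

variable {Ξ : Type*} [MeasurableSpace Ξ] {d : ℕ}

/-- The size bound matters: with more draws than samples there is no injection and the law is the
zero measure. -/
theorem isProbabilityMeasure_batchLaw (D : LocalData Ξ) {β : ℕ} (h : (β : ℕ∞) ≤ D.size) :
    IsProbabilityMeasure (D.batchLaw β) := by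
  cases D with
  | finite n data =>
    have hn : β ≤ n := by simpa [size] using h
    have hpos : Fintype.card (Fin β ↪ Fin n) ≠ 0 := by
      rw [Fintype.card_embedding_eq, Fintype.card_fin, Fintype.card_fin]
      exact (Nat.descFactorial_pos.2 hn).ne'
    constructor
    simp only [batchLaw, Measure.smul_apply, Measure.finsetSum_apply, measure_univ,
      Finset.sum_const, Finset.card_univ, smul_eq_mul, nsmul_eq_mul, mul_one]
    exact ENNReal.inv_mul_cancel (by exact_mod_cast hpos) (by simp)
  | online P =>
    simp only [batchLaw]
    infer_instance

theorem integral_batchLaw_finite {E : Type*} [NormedAddCommGroup E] [NormedSpace ℝ E]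
    [CompleteSpace E] {n : ℕ} (data : Fin n → Ξ) {β : ℕ} {g : (Fin β → Ξ) → E}
    (hg : StronglyMeasurable g) :
    Integrable g ((finite n data).batchLaw β) ∧ ∫ B, g B ∂(finite n data).batchLaw β =
      (Fintype.card (Fin β ↪ Fin n) : ℝ)⁻¹ • ∑ e : Fin β ↪ Fin n, g fun j => data (e j) := by
  have hi : ∀ e ∈ (Finset.univ : Finset (Fin β ↪ Fin n)),
      Integrable g (Measure.dirac fun j => data (e j)) := fun e _ =>
    integrable_dirac' hg (by simp)
  constructor
  · by_cases h0 : Fintype.card (Fin β ↪ Fin n) = 0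
    · have : IsEmpty (Fin β ↪ Fin n) := Fintype.card_eq_zero_iff.1 h0
      simp [batchLaw]
    · refine Integrable.smul_measure (integrable_finsetSum_measure.2 hi) ?_
      simpa using h0
  · simp only [batchLaw]
    rw [integral_smul_measure, integral_finsetSum_measure hi]
    simp [integral_dirac' g _ hg]

theorem integral_sampleLaw_finite {n : ℕ} (data : Fin n → Ξ) {g : Ξ → ℝ} (hg : Measurable g) :
    ∫ ξ, g ξ ∂(finite n data).sampleLaw = (n : ℝ)⁻¹ * ∑ j, g (data j) := by
  simp only [sampleLaw]
  rw [integral_smul_measure, integral_finsetSum_measure fun e _ =>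
    integrable_dirac' hg.stronglyMeasurable (by simp)]
  simp [integral_dirac' g _ hg.stronglyMeasurable]

end LocalData

/-- Every element of a random batch drawn without replacement is uniformly distributed. -/
theorem sum_embedding_apply {E : Type*} [AddCommGroup E] [Module ℝ E] {β n : ℕ} (j : Fin β)
    (g : Fin n → E) :
    (n : ℝ) • ∑ e : Fin β ↪ Fin n, g (e j) =
      (Fintype.card (Fin β ↪ Fin n) : ℝ) • ∑ i, g i := by
  rcases n with _ | n
  · have : IsEmpty (Fin β ↪ Fin 0) := ⟨fun e => (e j).elim0⟩
    simp
  -- Cyclic shifts of the data set permute the injections, so shifting changes nothing; averaging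
  -- over all shifts replaces the value at `e j` by the mean over the data set.
  have h1 : ∀ k : Fin (n + 1), ∑ e : Fin β ↪ Fin (n + 1), g (e j + k) =
      ∑ e : Fin β ↪ Fin (n + 1), g (e j) := fun k =>
    Fintype.sum_equiv ((Equiv.refl _).embeddingCongr (Equiv.addRight k)) _ _ fun e => by simp
  have h2 : ∑ k : Fin (n + 1), ∑ e : Fin β ↪ Fin (n + 1), g (e j + k) =
      ((n + 1 : ℕ) : ℝ) • ∑ e : Fin β ↪ Fin (n + 1), g (e j) := by
    simp_rw [h1]
    simp [Nat.cast_smul_eq_nsmul ℝ, -Nat.cast_add, -Nat.cast_one]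
  rw [← h2, Finset.sum_comm]
  have h3 : ∀ a : Fin (n + 1), ∑ k, g (a + k) = ∑ k, g k := fun a =>
    Fintype.sum_equiv (Equiv.addLeft a) _ _ fun k => by simp
  simp_rw [h3]
  simp [Nat.cast_smul_eq_nsmul ℝ]


/-! ### Unbiasedness of the stochastic gradients -/

section Unbiased

variable {Ξ : Type*} [MeasurableSpace Ξ] {d : ℕ} {f : Vec d → Ξ → ℝ} {D : LocalData Ξ}

theorem memLp_batchGrad (hf : ∀ ξ, Differentiable ℝ fun x => f x ξ)
    (hm : ∀ x, Measurable (f x)) {β : ℕ} (hβ : (β : ℕ∞) ≤ D.size) {v y : Vec d} {c : ℝ}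
    (hc : 0 ≤ c)
    (h : ∫⁻ B, ‖batchGrad f v B - y‖ₑ ^ 2 ∂D.batchLaw β ≤ ENNReal.ofReal c) :
    MemLp (fun B => batchGrad f v B) 2 (D.batchLaw β) := by
  have := D.isProbabilityMeasure_batchLaw hβ
  have hmeas : Measurable fun B : Fin β → Ξ => batchGrad f v B :=
    measurable_batchGrad_right hf hm v
  have h1 : AEStronglyMeasurable (fun B : Fin β → Ξ => batchGrad f v B - y) (D.batchLaw β) :=
    (hmeas.sub_const y).aestronglyMeasurable
  have h2 := memLp_two_of_integrable_sq_norm h1 (integral_sq_norm_le_of_lintegral h1 hc h).1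
  have h3 := h2.add (memLp_const y)
  refine h3.ae_eq (Filter.Eventually.of_forall fun B => ?_)
  simp

theorem gradient_expectedLoss_finite (hf : ∀ ξ, Differentiable ℝ fun x => f x ξ)
    (hm : ∀ x, Measurable (f x)) {n : ℕ} (data : Fin n → Ξ) (v : Vec d) :
    gradient (fun x => ∫ ξ, f x ξ ∂(LocalData.finite n data).sampleLaw) v =
      (n : ℝ)⁻¹ • ∑ i, gradient (fun y => f y (data i)) v := by
  rw [← gradient_const_mul_sum (fun i => hf (data i))]
  congr 1
  funext x
  exact LocalData.integral_sampleLaw_finite data (hm x)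

/-- Stochastic gradients with variance `O(1 / |B|)` around the gradient of the expected loss are
unbiased. -/
theorem integral_batchGrad (hf : ∀ ξ, Differentiable ℝ fun x => f x ξ)
    (hm : ∀ x, Measurable (f x)) {σ : ℝ} (v : Vec d)
    (h : ∀ β : ℕ, 1 ≤ β → (β : ℕ∞) ≤ D.size →
      ∫⁻ B, ‖batchGrad f v B - gradient (fun x => ∫ ξ, f x ξ ∂D.sampleLaw) v‖ₑ ^ 2 ∂D.batchLaw β
        ≤ ENNReal.ofReal (σ ^ 2 / β))
    {β : ℕ} (h1 : 1 ≤ β) (hβ : (β : ℕ∞) ≤ D.size) :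
    ∫ B, batchGrad f v B ∂D.batchLaw β = gradient (fun x => ∫ ξ, f x ξ ∂D.sampleLaw) v := by
  have hβ0 : (β : ℝ) ≠ 0 := by positivity
  cases D with
  | finite n data =>
    have hmeas : Measurable fun B : Fin β → Ξ => batchGrad f v B :=
      measurable_batchGrad_right hf hm v
    have hn : β ≤ n := by simpa [LocalData.size] using hβ
    have hn0 : (n : ℝ) ≠ 0 := by
      have : 0 < n := by omega
      positivity
    have hpos : (Fintype.card (Fin β ↪ Fin n) : ℝ) ≠ 0 := by
      rw [Fintype.card_embedding_eq, Fintype.card_fin, Fintype.card_fin]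
      exact_mod_cast (Nat.descFactorial_pos.2 hn).ne'
    rw [(LocalData.integral_batchLaw_finite data hmeas.stronglyMeasurable).2,
      gradient_expectedLoss_finite hf hm]
    simp_rw [batchGrad_eq hf]
    rw [← Finset.smul_sum, Finset.sum_comm]
    have h2 : ∀ j : Fin β, ∑ e : Fin β ↪ Fin n, gradient (fun y => f y (data (e j))) v =
        (n : ℝ)⁻¹ • (Fintype.card (Fin β ↪ Fin n) : ℝ) •
          ∑ i, gradient (fun y => f y (data i)) v := fun j => by
      rw [← sum_embedding_apply j fun i => gradient (fun y => f y (data i)) v, inv_smul_smul₀ hn0]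
    simp_rw [h2]
    rw [Finset.sum_const, Finset.card_univ, Fintype.card_fin, ← Nat.cast_smul_eq_nsmul ℝ,
      inv_smul_smul₀ hβ0, smul_comm, inv_smul_smul₀ hpos]
  | online P =>
    set y := gradient (fun x => ∫ ξ, f x ξ ∂(LocalData.online P).sampleLaw) v with hy
    let γ : Ξ → Vec d := fun ξ => gradient (fun x => f x ξ) v
    have hγ : Measurable γ :=
      (measurable_gradient_uncurry hf hm).comp (measurable_prodMk_left (x := v))
    have hsz : ∀ b : ℕ, (b : ℕ∞) ≤ (LocalData.online P).size := fun b => le_top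
    have hmem : ∀ b : ℕ, 1 ≤ b → MemLp (fun B : Fin b → Ξ => batchGrad f v B) 2
        ((LocalData.online P).batchLaw b) := fun b hb =>
      memLp_batchGrad hf hm (hsz b) (by positivity) (h b hb (hsz b))
    -- Integrability of the per-sample gradient is not assumed: it comes from the finite second
    -- moment of batches of size one.
    have hγi : Integrable γ (P : Measure Ξ) := by
      have := (LocalData.online P).isProbabilityMeasure_batchLaw (hsz 1)
      have h2 := (hmem 1 le_rfl).integrable (by norm_num)
      have e : (fun B : Fin 1 → Ξ => batchGrad f v B) = γ ∘ Function.eval 0 := by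
        funext B
        simp [batchGrad_eq hf, γ]
      rw [e] at h2
      exact ((measurePreserving_eval (fun _ : Fin 1 => (P : Measure Ξ)) 0).integrable_comp
        hγ.aestronglyMeasurable).1 h2
    have hint : ∀ b : ℕ, 1 ≤ b →
        ∫ B, batchGrad f v B ∂(LocalData.online P).batchLaw b = ∫ ξ, γ ξ ∂(P : Measure Ξ) := by
      intro b hb
      have hb0 : (b : ℝ) ≠ 0 := by positivity
      simp_rw [batchGrad_eq hf, LocalData.batchLaw]
      have h3 : ∀ j : Fin b, Integrable (fun B : Fin b → Ξ => γ (B j))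
          (Measure.pi fun _ => (P : Measure Ξ)) := fun j =>
        ((measurePreserving_eval (fun _ : Fin b => (P : Measure Ξ)) j).integrable_comp
          hγ.aestronglyMeasurable).2 hγi
      have h4 : ∀ j : Fin b, ∫ B : Fin b → Ξ, γ (B j) ∂(Measure.pi fun _ => (P : Measure Ξ)) =
          ∫ ξ, γ ξ ∂(P : Measure Ξ) := fun j => integral_comp_eval hγ.aestronglyMeasurable
      rw [integral_smul, integral_finsetSum _ fun j _ => h3 j]
      rw [Finset.sum_congr rfl fun j _ => h4 j]
      rw [Finset.sum_const, Finset.card_univ, Fintype.card_fin, ← Nat.cast_smul_eq_nsmul ℝ,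
        inv_smul_smul₀ hb0]
    -- The mean of the stochastic gradient is the same for every batch size, while its squared
    -- distance to `y` is at most the mean squared deviation `σ² / b`. Letting `b` tend to infinity
    -- forces equality, with no need to differentiate under the integral sign.
    have hbound : ∀ b : ℕ, 1 ≤ b → ‖∫ ξ, γ ξ ∂(P : Measure Ξ) - y‖ ^ 2 ≤ σ ^ 2 / b := by
      intro b hb
      have := (LocalData.online P).isProbabilityMeasure_batchLaw (hsz b)
      have h5 := (hmem b hb).sub (memLp_const y)
      have h6 := (integral_sq_norm_le_of_lintegral h5.1 (by positivity) (h b hb (hsz b))).2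
      refine le_trans ?_ h6
      refine le_trans ?_ (sq_integral_norm_le h5)
      refine pow_le_pow_left₀ (norm_nonneg _) ?_ 2
      refine le_trans (le_of_eq ?_) (norm_integral_le_integral_norm _)
      congr 1
      have h7 := (hmem b hb).integrable (by norm_num)
      simp only [Pi.sub_apply]
      rw [integral_sub h7 (integrable_const y), hint b hb]
      simp
    have hzero : ‖∫ ξ, γ ξ ∂(P : Measure Ξ) - y‖ ^ 2 ≤ 0 := by
      refine ge_of_tendsto (tendsto_const_div_atTop_nhds_zero_nat (σ ^ 2)) ?_
      filter_upwards [Filter.eventually_ge_atTop 1] with b hb using hbound b hb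
    rw [hint β h1]
    have : ‖∫ ξ, γ ξ ∂(P : Measure Ξ) - y‖ = 0 := by
      nlinarith [norm_nonneg (∫ ξ, γ ξ ∂(P : Measure Ξ) - y)]
    exact sub_eq_zero.1 (norm_eq_zero.1 this)

/-- A batch that exhausts a finite data set has no noise. -/
theorem batchGrad_full (hf : ∀ ξ, Differentiable ℝ fun x => f x ξ)
    (hm : ∀ x, Measurable (f x)) {β : ℕ} (hβ : (β : ℕ∞) = D.size) (v : Vec d) :
    ∫⁻ B, ‖batchGrad f v B - gradient (fun x => ∫ ξ, f x ξ ∂D.sampleLaw) v‖ₑ ^ 2 ∂D.batchLaw β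
      = 0 := by
  cases D with
  | online P => simp [LocalData.size] at hβ
  | finite n data =>
    have hn : β = n := by simpa [LocalData.size] using hβ
    subst hn
    have hmeas : Measurable fun B : Fin β → Ξ => batchGrad f v B :=
      measurable_batchGrad_right hf hm v
    have hme : Measurable fun B : Fin β → Ξ => ‖batchGrad f v B -
        gradient (fun x => ∫ ξ, f x ξ ∂(LocalData.finite β data).sampleLaw) v‖ₑ ^ 2 :=
      (hmeas.sub_const _).enorm.pow_const 2
    simp only [LocalData.batchLaw]
    rw [lintegral_smul_measure, lintegral_finsetSum_measure]
    simp_rw [lintegral_dirac' _ hme]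
    rw [Finset.sum_eq_zero, smul_zero]
    intro e _
    -- A batch of full size is a reordering of the data set, so its average is the exact one.
    have hb : Function.Bijective e := (Fintype.bijective_iff_injective_and_card e).2 ⟨e.2, rfl⟩
    rw [gradient_expectedLoss_finite hf hm, batchGrad_eq hf,
      hb.sum_comp fun i => gradient (fun y => f y (data i)) v, sub_self]
    simp

end Unbiased

/-! ### Local updates -/

section Local

variable {Ξ : Type*} [MeasurableSpace Ξ] {d b' K : ℕ} {f : Vec d → Ξ → ℝ}

/-- The stochastic gradients over batches with law `μ` are unbiased estimators of the field `gr`,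
which is `L`-Lipschitz, and their differences have variance at most `V ‖v - w‖²`. -/
structure GradOracle (f : Vec d → Ξ → ℝ) (μ : Measure (Fin b' → Ξ)) (gr : Vec d → Vec d)
    (L V : ℝ) : Prop where
  measurable : Measurable fun p : Vec d × (Fin b' → Ξ) => batchGrad f p.1 p.2
  memLp : ∀ v, MemLp (fun B => batchGrad f v B) 2 μ
  mean : ∀ v, ∫ B, batchGrad f v B ∂μ = gr v
  lipschitz : ∀ v w, ‖gr v - gr w‖ ≤ L * ‖v - w‖
  variance : ∀ v w, ∫ B, ‖(batchGrad f v B - batchGrad f w B) - (gr v - gr w)‖ ^ 2 ∂μ ≤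
    V * ‖v - w‖ ^ 2

theorem measurable_localState
    (hG : Measurable fun p : Vec d × (Fin b' → Ξ) => batchGrad f p.1 p.2) (ηl : ℝ) (k : ℕ) :
    (Measurable fun p : (Vec d × Vec d) × (Fin K → Fin b' → Ξ) =>
      (localState f ηl p.1.1 p.1.2 p.2 k).prev) ∧
    (Measurable fun p : (Vec d × Vec d) × (Fin K → Fin b' → Ξ) =>
      (localState f ηl p.1.1 p.1.2 p.2 k).cur) ∧
    Measurable fun p : (Vec d × Vec d) × (Fin K → Fin b' → Ξ) =>
      (localState f ηl p.1.1 p.1.2 p.2 k).dir := by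
  induction k with
  | zero =>
    simp only [localState]
    exact ⟨by fun_prop, by fun_prop, by fun_prop⟩
  | succ k ih =>
    by_cases hk : k < K
    · obtain ⟨h1, h2, h3⟩ := ih
      have hB : Measurable fun p : (Vec d × Vec d) × (Fin K → Fin b' → Ξ) => p.2 ⟨k, hk⟩ :=
        (measurable_pi_apply _).comp measurable_snd
      have hd := (h3.sub (measurable_comp_pair (f := fun v (B : Fin b' → Ξ) => batchGrad f v B)
        hG h1 hB)).add (measurable_comp_pair (f := fun v (B : Fin b' → Ξ) => batchGrad f v B)
        hG h2 hB)
      simp only [localState, hk, dif_pos, localStep]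
      exact ⟨h2, h2.sub (hd.const_smul ηl), hd⟩
    · simpa only [localState, hk, dif_neg, not_false_eq_true] using ih

omit [MeasurableSpace Ξ] in
-- This makes the batch of step `k` independent of the local state from which that step starts.
theorem dependsOn_localState (ηl : ℝ) (x g : Vec d) (k : ℕ) :
    DependsOn (fun B : Fin K → Fin b' → Ξ => localState f ηl x g B k)
      (Finset.univ.filter fun i : Fin K => (i : ℕ) < k : Finset (Fin K)) := by
  induction k with
  | zero => intro B B' _; rfl
  | succ k ih =>
    intro B B' hB
    have h1 : localState f ηl x g B k = localState f ηl x g B' k := ih fun i hi => hB i (by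
      simp only [Finset.coe_filter, Finset.mem_univ, true_and, Set.mem_ofPred_eq] at hi ⊢; omega)
    by_cases hk : k < K
    · simp only [localState, hk, dif_pos, h1, hB ⟨k, hk⟩ (by simp)]
    · simpa only [localState, hk, dif_neg, not_false_eq_true] using h1

omit [MeasurableSpace Ξ] in
theorem localState_succ (ηl : ℝ) (x g : Vec d) (B : Fin K → Fin b' → Ξ) {k : ℕ} (hk : k < K) :
    localState f ηl x g B (k + 1) = localStep f ηl (localState f ηl x g B k) (B ⟨k, hk⟩) := by
  simp only [localState, hk, dif_pos]

omit [MeasurableSpace Ξ] in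
theorem norm_cur_sub_prev_le {ηl : ℝ} (hη : 0 ≤ ηl) (x g : Vec d) (B : Fin K → Fin b' → Ξ)
    {k : ℕ} (hk : k ≤ K) :
    ‖(localState f ηl x g B k).cur - (localState f ηl x g B k).prev‖ ≤
      ηl * ‖(localState f ηl x g B k).dir‖ := by
  cases k with
  | zero => simp only [localState, sub_self, norm_zero]; positivity
  | succ k =>
    rw [localState_succ ηl x g B hk]
    simp only [localStep]
    rw [sub_sub_cancel_left, norm_neg, norm_smul, Real.norm_of_nonneg hη]

omit [MeasurableSpace Ξ] in
-- The previous and current points coincide at the start, so the two stochastic gradients cancel for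
-- every batch: the first local step is deterministic.
theorem localState_dir_one (ηl : ℝ) (x g : Vec d) (B : Fin K → Fin b' → Ξ) (hK : 0 < K) :
    (localState f ηl x g B 1).dir = g := by
  rw [localState_succ ηl x g B hK]
  simp [localStep, localState]

omit [MeasurableSpace Ξ] in
theorem sub_cur_localState (ηl : ℝ) (x g : Vec d) (B : Fin K → Fin b' → Ξ) {k : ℕ}
    (hk : k ≤ K) :
    x - (localState f ηl x g B k).cur =
      ηl • ∑ j ∈ Finset.range k, (localState f ηl x g B (j + 1)).dir := by
  induction k with
  | zero => simp [localState]
  | succ k ih =>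
    have e : (localState f ηl x g B (k + 1)).cur =
        (localState f ηl x g B k).cur - ηl • (localState f ηl x g B (k + 1)).dir := by
      rw [localState_succ ηl x g B hk]; rfl
    rw [Finset.sum_range_succ, smul_add, ← ih (by omega), e]
    module

variable {μ : Measure (Fin b' → Ξ)} [IsProbabilityMeasure μ] {gr : Vec d → Vec d} {L V : ℝ}

/-- Bias-variance decomposition: the mean of the new direction is `g + (gr c - gr p)`, controlled by
the Lipschitz bound, and the centred part only adds its variance, without a cross term. -/
theorem GradOracle.sq_norm_step_le (h : GradOracle f μ gr L V) (p c g : Vec d) :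
    ∫⁻ B, ‖g - batchGrad f p B + batchGrad f c B‖ₑ ^ 2 ∂μ ≤
      ENNReal.ofReal ((‖g‖ + L * ‖c - p‖) ^ 2 + V * ‖c - p‖ ^ 2) := by
  have hY : MemLp (fun B => batchGrad f c B - batchGrad f p B) 2 μ := (h.memLp c).sub (h.memLp p)
  have hy : ∫ B, (batchGrad f c B - batchGrad f p B) ∂μ = gr c - gr p := by
    rw [integral_sub ((h.memLp c).integrable (by norm_num)) ((h.memLp p).integrable (by norm_num)),
      h.mean, h.mean]
  have e : ∀ B : Fin b' → Ξ, g - batchGrad f p B + batchGrad f c B =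
      g + (batchGrad f c B - batchGrad f p B) := fun B => by abel
  simp_rw [e]
  have hm : MemLp (fun B => g + (batchGrad f c B - batchGrad f p B)) 2 μ := (memLp_const g).add hY
  rw [lintegral_enorm_sq hm, integral_sq_norm_const_add hY g _ hy]
  refine ENNReal.ofReal_le_ofReal (add_le_add ?_ (h.variance c p))
  refine pow_le_pow_left₀ (norm_nonneg _) ?_ 2
  exact (norm_add_le _ _).trans (add_le_add_right (h.lipschitz c p) _)

theorem GradOracle.le_inner_step (h : GradOracle f μ gr L V) (u p c g : Vec d) :
    inner ℝ u g - ‖u‖ * (L * ‖c - p‖) ≤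
      ∫ B, inner ℝ u (g - batchGrad f p B + batchGrad f c B) ∂μ := by
  have hp := (h.memLp p).integrable (by norm_num)
  have hc := (h.memLp c).integrable (by norm_num)
  have h1 : Integrable (fun B => g - batchGrad f p B) μ := (integrable_const g).sub hp
  have h2 : Integrable (fun B => g - batchGrad f p B + batchGrad f c B) μ := h1.add hc
  rw [integral_inner h2, integral_add h1 hc, integral_sub (integrable_const g) hp, h.mean, h.mean]
  have e : (∫ _ : Fin b' → Ξ, g ∂μ) - gr p + gr c = g + (gr c - gr p) := by
    simp; abel
  rw [e, inner_add_right]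
  have h3 := abs_le.1 (abs_real_inner_le_norm u (gr c - gr p))
  have h4 := mul_le_mul_of_nonneg_left (h.lipschitz c p) (norm_nonneg u)
  linarith [h3.1]

/-- The one-step bounds hold conditionally on the state and integrate because the fresh batch is
independent of it. The displacement `cur - prev` is at most `ηl` times the current direction, so the
recursion closes in the direction alone. -/
theorem GradOracle.localState_step (h : GradOracle f μ gr L V) (hL : 0 ≤ L) (hV : 0 ≤ V) {ηl : ℝ}
    (hη : 0 ≤ ηl) (u x g : Vec d) {k : ℕ} (hk : k < K)
    (hm : MemLp (fun B : Fin K → Fin b' → Ξ => (localState f ηl x g B k).dir) 2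
      (Measure.pi fun _ => μ)) :
    MemLp (fun B : Fin K → Fin b' → Ξ => (localState f ηl x g B (k + 1)).dir) 2
        (Measure.pi fun _ => μ) ∧
      ∫ B : Fin K → Fin b' → Ξ, ‖(localState f ηl x g B (k + 1)).dir‖ ^ 2
          ∂(Measure.pi fun _ => μ) ≤
        ((1 + L * ηl) ^ 2 + V * ηl ^ 2) *
          ∫ B : Fin K → Fin b' → Ξ, ‖(localState f ηl x g B k).dir‖ ^ 2
            ∂(Measure.pi fun _ => μ) ∧
      ∫ B : Fin K → Fin b' → Ξ, inner ℝ u (localState f ηl x g B k).dir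
            ∂(Measure.pi fun _ => μ) -
          ‖u‖ * (L * ηl) * ∫ B : Fin K → Fin b' → Ξ, ‖(localState f ηl x g B k).dir‖
            ∂(Measure.pi fun _ => μ) ≤
        ∫ B : Fin K → Fin b' → Ξ, inner ℝ u (localState f ηl x g B (k + 1)).dir
          ∂(Measure.pi fun _ => μ) := by
  set P : Measure (Fin K → Fin b' → Ξ) := Measure.pi fun _ => μ with hP
  let X : (Fin K → Fin b' → Ξ) → Vec d × Vec d × Vec d := fun B =>
    ((localState f ηl x g B k).prev, (localState f ηl x g B k).cur, (localState f ηl x g B k).dir)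
  have hX : Measurable X := by
    obtain ⟨h1, h2, h3⟩ := measurable_localState (K := K) h.measurable ηl k
    have hi : Measurable fun B : Fin K → Fin b' → Ξ => ((x, g), B) := measurable_prodMk_left
    exact (h1.comp hi).prodMk ((h2.comp hi).prodMk (h3.comp hi))
  have hdep : DependsOn X (Finset.univ.filter fun i : Fin K => (i : ℕ) < k : Finset (Fin K)) := by
    intro B B' hB
    have := dependsOn_localState (f := f) ηl x g k hB
    simp only at this
    simp only [X, this]
  have hlaw : P.map (fun B => (X B, B ⟨k, hk⟩)) = (P.map X).prod μ :=
    map_prod_pi (fun _ => μ) hX hdep (by simp)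
  have hY : Measurable fun B : Fin K → Fin b' → Ξ => B ⟨k, hk⟩ := measurable_pi_apply _
  let φ : Vec d × Vec d × Vec d → (Fin b' → Ξ) → Vec d := fun e B =>
    e.2.2 - batchGrad f e.1 B + batchGrad f e.2.1 B
  have hφ : Measurable fun p : (Vec d × Vec d × Vec d) × (Fin b' → Ξ) => φ p.1 p.2 := by
    have h1 := measurable_comp_pair (f := fun v (B : Fin b' → Ξ) => batchGrad f v B) h.measurable
      (a := fun p : (Vec d × Vec d × Vec d) × (Fin b' → Ξ) => p.1.1) (by fun_prop) measurable_snd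
    have h2 := measurable_comp_pair (f := fun v (B : Fin b' → Ξ) => batchGrad f v B) h.measurable
      (a := fun p : (Vec d × Vec d × Vec d) × (Fin b' → Ξ) => p.1.2.1) (by fun_prop)
      measurable_snd
    have h3 : Measurable fun p : (Vec d × Vec d × Vec d) × (Fin b' → Ξ) => p.1.2.2 := by fun_prop
    exact (h3.sub h1).add h2
  have hnext : ∀ B, φ (X B) (B ⟨k, hk⟩) = (localState f ηl x g B (k + 1)).dir := fun B => by
    rw [localState_succ ηl x g B hk]; rfl
  let c : Vec d × Vec d × Vec d → ℝ := fun e =>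
    (‖e.2.2‖ + L * ‖e.2.1 - e.1‖) ^ 2 + V * ‖e.2.1 - e.1‖ ^ 2
  have hc0 : ∀ e, 0 ≤ c e := fun e => by positivity
  have hcm : Measurable c := by fun_prop
  have hstep : ∀ B : Fin K → Fin b' → Ξ,
      ‖(localState f ηl x g B k).cur - (localState f ηl x g B k).prev‖ ≤
      ηl * ‖(localState f ηl x g B k).dir‖ := fun B => norm_cur_sub_prev_le hη x g B hk.le
  have hcle : ∀ B : Fin K → Fin b' → Ξ, c (X B) ≤
      ((1 + L * ηl) ^ 2 + V * ηl ^ 2) * ‖(localState f ηl x g B k).dir‖ ^ 2 := by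
    intro B
    have h1 := hstep B
    have h2 := mul_le_mul_of_nonneg_left h1 hL
    simp only [c, X]
    calc _ ≤ (‖(localState f ηl x g B k).dir‖ + L * (ηl * ‖(localState f ηl x g B k).dir‖)) ^ 2 +
          V * (ηl * ‖(localState f ηl x g B k).dir‖) ^ 2 := by gcongr
      _ = _ := by ring
  have hsq := hm.integrable_norm_pow two_ne_zero
  have hcX : Integrable (fun B => c (X B)) P := by
    refine Integrable.mono' (hsq.const_mul ((1 + L * ηl) ^ 2 + V * ηl ^ 2))
      (hcm.comp hX).aestronglyMeasurable (Filter.Eventually.of_forall fun B => ?_)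
    rw [Real.norm_of_nonneg (hc0 _)]
    exact hcle B
  obtain ⟨h1, h2⟩ := integral_sq_norm_le_of_indep hX hY hlaw hφ hc0 hcX
    fun e => h.sq_norm_step_le e.1 e.2.1 e.2.2
  simp only [hnext] at h1 h2
  refine ⟨h1, ?_, ?_⟩
  · rw [← integral_const_mul]
    exact h2.trans (integral_mono hcX (hsq.const_mul _) hcle)
  · have hi : Integrable (fun B => inner ℝ u (φ (X B) (B ⟨k, hk⟩))) P := by
      simp only [hnext]
      exact (h1.integrable (by norm_num)).const_inner u
    have hn := (hm.integrable (by norm_num)).norm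
    have hin : Integrable (fun B => inner ℝ u (localState f ηl x g B k).dir) P :=
      (hm.integrable (by norm_num)).const_inner u
    have hdm : Integrable (fun B => ‖u‖ *
        (L * ‖(localState f ηl x g B k).cur - (localState f ηl x g B k).prev‖)) P := by
      have hm2 : Measurable fun B => ‖u‖ * (L * ‖(X B).2.1 - (X B).1‖) := by fun_prop
      refine Integrable.mono' (hn.const_mul (‖u‖ * (L * ηl))) hm2.aestronglyMeasurable
        (Filter.Eventually.of_forall fun B => ?_)
      rw [Real.norm_of_nonneg (by positivity)]
      have := mul_le_mul_of_nonneg_left (mul_le_mul_of_nonneg_left (hstep B) hL) (norm_nonneg u)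
      linarith
    have h3 := le_integral_of_indep hX hY hlaw (φ := fun e B => inner ℝ u (φ e B))
      (measurable_const.inner hφ) hi
      (c := fun e => inner ℝ u e.2.2 - ‖u‖ * (L * ‖e.2.1 - e.1‖)) (hin.sub hdm)
      fun e => h.le_inner_step u e.1 e.2.1 e.2.2
    simp only [hnext] at h3
    refine le_trans ?_ h3
    rw [← integral_const_mul, ← integral_sub hin (hn.const_mul _)]
    refine integral_mono (hin.sub (hn.const_mul _)) (hin.sub hdm) fun B => ?_
    have := mul_le_mul_of_nonneg_left (mul_le_mul_of_nonneg_left (hstep B) hL) (norm_nonneg u)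
    simp only [X]
    linarith

/-- Moments of the directions of a miner. -/
theorem GradOracle.moments_dir (h : GradOracle f μ gr L V) (hL : 0 ≤ L) (hV : 0 ≤ V) {ηl : ℝ}
    (hη : 0 ≤ ηl) (u x g : Vec d) {q r : ℝ} (hq : (1 + L * ηl) ^ 2 + V * ηl ^ 2 ≤ q) (hr : 0 ≤ r)
    {k : ℕ} (hk : k < K) (hqr : ∀ j < k, q ^ j ≤ r ^ 2) :
    MemLp (fun B : Fin K → Fin b' → Ξ => (localState f ηl x g B (k + 1)).dir) 2
        (Measure.pi fun _ => μ) ∧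
      ∫ B : Fin K → Fin b' → Ξ, ‖(localState f ηl x g B (k + 1)).dir‖ ^ 2
          ∂(Measure.pi fun _ => μ) ≤ q ^ k * ‖g‖ ^ 2 ∧
      inner ℝ u g - k * (L * ηl * r * (‖u‖ * ‖g‖)) ≤
        ∫ B : Fin K → Fin b' → Ξ, inner ℝ u (localState f ηl x g B (k + 1)).dir
          ∂(Measure.pi fun _ => μ) := by
  have hq0 : 0 ≤ q := le_trans (by positivity) hq
  induction k with
  | zero =>
    -- The first direction equals `g` exactly, so the growth after `k + 1` steps is `q ^ k` and the
    -- bias has `k` terms.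
    simp_rw [zero_add, localState_dir_one ηl x g _ hk]
    refine ⟨memLp_const g, by simp, by simp⟩
  | succ k ih =>
    obtain ⟨h1, h2, h3⟩ := ih (by omega) fun j hj => hqr j (by omega)
    obtain ⟨g1, g2, g3⟩ := h.localState_step hL hV hη u x g hk h1
    refine ⟨g1, g2.trans ?_, le_trans ?_ g3⟩
    · have h0 : 0 ≤ ∫ B : Fin K → Fin b' → Ξ, ‖(localState f ηl x g B (k + 1)).dir‖ ^ 2
          ∂(Measure.pi fun _ => μ) := integral_nonneg fun B => by positivity
      calc _ ≤ q * (q ^ k * ‖g‖ ^ 2) := mul_le_mul hq h2 h0 hq0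
        _ = _ := by ring
    · have h4 := sq_integral_norm_le h1
      -- Jensen's inequality turns the second moment bound into a first moment bound, with `r` a
      -- common root bound for all the powers `q ^ j`.
      have h5 : ∫ B : Fin K → Fin b' → Ξ, ‖(localState f ηl x g B (k + 1)).dir‖
          ∂(Measure.pi fun _ => μ) ≤ r * ‖g‖ := by
        refine le_of_sq_le_sq ?_ (by positivity)
        refine h4.trans (h2.trans ?_)
        rw [mul_pow]
        exact mul_le_mul_of_nonneg_right (hqr k (by omega)) (by positivity)
      have h6 := mul_le_mul_of_nonneg_left h5 (by positivity : 0 ≤ ‖u‖ * (L * ηl))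
      push_cast
      linarith

/-- The model change is `ηl` times the sum of the `K` directions: Cauchy-Schwarz gives the factor
`K` before the geometric sum, and the biases, linear in the step index, add up to at most `K² / 2`
times the single one. -/
theorem GradOracle.moments_localDelta (h : GradOracle f μ gr L V) (hL : 0 ≤ L) (hV : 0 ≤ V)
    {ηl : ℝ} (hη : 0 ≤ ηl) (u x g : Vec d) {q r : ℝ} (hq : (1 + L * ηl) ^ 2 + V * ηl ^ 2 ≤ q)
    (hr : 0 ≤ r) (hqr : ∀ j < K, q ^ j ≤ r ^ 2) :
    MemLp (fun B : Fin K → Fin b' → Ξ => localDelta f ηl x g B) 2 (Measure.pi fun _ => μ) ∧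
      ∫ B : Fin K → Fin b' → Ξ, ‖localDelta f ηl x g B‖ ^ 2 ∂(Measure.pi fun _ => μ) ≤
        ηl ^ 2 * K * (∑ k ∈ Finset.range K, q ^ k) * ‖g‖ ^ 2 ∧
      ηl * K * (inner ℝ u g - K * (L * ηl) * r / 2 * (‖u‖ * ‖g‖)) ≤
        ∫ B : Fin K → Fin b' → Ξ, inner ℝ u (localDelta f ηl x g B)
          ∂(Measure.pi fun _ => μ) := by
  have hd := fun k (hk : k < K) => h.moments_dir hL hV hη u x g hq hr hk
    fun j hj => hqr j (by omega)
  have e : ∀ B : Fin K → Fin b' → Ξ, localDelta f ηl x g B =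
      ηl • ∑ j ∈ Finset.range K, (localState f ηl x g B (j + 1)).dir := fun B =>
    sub_cur_localState ηl x g B le_rfl
  simp_rw [e]
  have hm : ∀ j ∈ Finset.range K, MemLp (fun B : Fin K → Fin b' → Ξ =>
      (localState f ηl x g B (j + 1)).dir) 2 (Measure.pi fun _ => μ) := fun j hj =>
    (hd j (Finset.mem_range.1 hj)).1
  have hsum : MemLp (fun B : Fin K → Fin b' → Ξ =>
      ∑ j ∈ Finset.range K, (localState f ηl x g B (j + 1)).dir) 2 (Measure.pi fun _ => μ) :=
    memLp_finsetSum _ hm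
  refine ⟨hsum.const_smul ηl, ?_, ?_⟩
  · simp_rw [norm_smul, mul_pow, Real.norm_eq_abs, sq_abs]
    rw [integral_const_mul]
    have h1 : ∀ B : Fin K → Fin b' → Ξ,
        ‖∑ j ∈ Finset.range K, (localState f ηl x g B (j + 1)).dir‖ ^ 2 ≤
          K * ∑ j ∈ Finset.range K, ‖(localState f ηl x g B (j + 1)).dir‖ ^ 2 := by
      intro B
      refine (pow_le_pow_left₀ (norm_nonneg _) (norm_sum_le _ _) 2).trans ?_
      simpa using sq_sum_le_card_mul_sum_sq (s := Finset.range K)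
        (f := fun j => ‖(localState f ηl x g B (j + 1)).dir‖)
    have hi : ∀ j ∈ Finset.range K, Integrable (fun B : Fin K → Fin b' → Ξ =>
        ‖(localState f ηl x g B (j + 1)).dir‖ ^ 2) (Measure.pi fun _ => μ) := fun j hj =>
      (hm j hj).integrable_norm_pow two_ne_zero
    have h2 := integral_mono (hsum.integrable_norm_pow two_ne_zero)
      ((integrable_finsetSum _ hi).const_mul (K : ℝ)) h1
    rw [integral_const_mul, integral_finsetSum _ hi] at h2
    have h3 : ∑ j ∈ Finset.range K, ∫ B : Fin K → Fin b' → Ξ,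
        ‖(localState f ηl x g B (j + 1)).dir‖ ^ 2 ∂(Measure.pi fun _ => μ) ≤
        (∑ k ∈ Finset.range K, q ^ k) * ‖g‖ ^ 2 := by
      rw [Finset.sum_mul]
      exact Finset.sum_le_sum fun j hj => (hd j (Finset.mem_range.1 hj)).2.1
    calc _ ≤ ηl ^ 2 * (K * ((∑ k ∈ Finset.range K, q ^ k) * ‖g‖ ^ 2)) := by
          refine mul_le_mul_of_nonneg_left (h2.trans ?_) (by positivity)
          exact mul_le_mul_of_nonneg_left h3 (by positivity)
      _ = _ := by ring
  · simp_rw [inner_smul_right, inner_sum]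
    have hi : ∀ j ∈ Finset.range K, Integrable (fun B : Fin K → Fin b' → Ξ =>
        inner ℝ u (localState f ηl x g B (j + 1)).dir) (Measure.pi fun _ => μ) := fun j hj =>
      ((hm j hj).integrable (by norm_num)).const_inner u
    rw [integral_const_mul, integral_finsetSum _ hi, mul_assoc]
    refine mul_le_mul_of_nonneg_left ?_ hη
    have h3 := Finset.sum_le_sum fun j (hj : j ∈ Finset.range K) =>
      (hd j (Finset.mem_range.1 hj)).2.2
    refine le_trans ?_ h3
    rw [Finset.sum_sub_distrib, ← Finset.sum_mul]
    simp only [Finset.sum_const, Finset.card_range, nsmul_eq_mul]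
    have h4 : (∑ i ∈ Finset.range K, (i : ℝ)) ≤ K * K / 2 := by
      have := Finset.sum_range_id_mul_two K
      have h5 : (∑ i ∈ Finset.range K, (i : ℝ)) * 2 = K * ((K - 1 : ℕ) : ℝ) := by
        rw [← Nat.cast_mul, ← this]; push_cast; rfl
      have h6 : ((K - 1 : ℕ) : ℝ) ≤ K := by exact_mod_cast Nat.sub_le K 1
      nlinarith [(Nat.cast_nonneg K : (0 : ℝ) ≤ K)]
    have h5 := mul_le_mul_of_nonneg_right h4
      (by positivity : 0 ≤ L * ηl * r * (‖u‖ * ‖g‖))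
    linarith

end Local

/-- Growth of the directions over one phase of local updates, for the step sizes in use. -/
theorem localGrowth_le {L V ηl : ℝ} {K : ℕ} (hK : 1 ≤ K) (hL : 0 ≤ L) (hη : 0 ≤ ηl)
    (h1 : L * ηl * K ≤ 0.20413) (h2 : 48 * K * (V * ηl ^ 2) ≤ 1) (hV : 0 ≤ V * ηl ^ 2) :
    (1 + L * ηl) ^ 2 + V * ηl ^ 2 ≤ Real.exp (0.4291 / K) ∧
      (∀ j < K, Real.exp (0.4291 / K) ^ j ≤ Real.exp (0.4291 / 2) ^ 2) ∧
      ∑ k ∈ Finset.range K, Real.exp (0.4291 / K) ^ k ≤ 5 / 4 * K ∧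
      K * (L * ηl) * Real.exp (0.4291 / 2) / 2 ≤ 0.127 := by
  have hK0 : (0 : ℝ) < K := by positivity
  have he : Real.exp 0.4291 ≤ 1.5363 := by
    have := Real.exp_bound' (x := 0.4291) (by norm_num) (by norm_num) (n := 6) (by norm_num)
    refine this.trans ?_
    norm_num [Finset.sum_range_succ, Nat.factorial]
  refine ⟨?_, ?_, ?_, ?_⟩
  · have h3 : L * ηl ≤ 0.20413 / K := by rw [le_div_iff₀ hK0]; exact h1
    have h4 : V * ηl ^ 2 ≤ 1 / (48 * K) := by rw [le_div_iff₀ (by positivity)]; linarith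
    -- The constants round up `1 / (2 √6)` to `0.20413` and `1 / 48` to `0.02084`, and `0.4291` is
    -- twice the first plus the second.
    have h5 : 0.4291 / (K : ℝ) ≥ 2 * (L * ηl) + V * ηl ^ 2 := by
      have : 0.4291 / (K : ℝ) = 2 * (0.20413 / K) + 0.02084 / K := by field_simp; norm_num
      have h6 : 1 / (48 * (K : ℝ)) ≤ 0.02084 / K := by
        rw [div_le_div_iff₀ (by positivity) hK0]; linarith
      linarith
    have h6 : 0 ≤ L * ηl := by positivity
    refine le_trans ?_ (Real.exp_le_exp.2 h5)
    -- With `s = 2 L ηl + V ηl²`, the left side is `1 + s + (L ηl)²`, and `(L ηl)² ≤ s² / 2`.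
    refine le_trans ?_ (Real.quadratic_le_exp_of_nonneg (add_nonneg (by positivity) hV))
    nlinarith [mul_nonneg h6 hV]
  · intro j hj
    rw [← Real.exp_nat_mul, ← Real.exp_nat_mul]
    refine Real.exp_le_exp.2 ?_
    have : (j : ℝ) ≤ K := by exact_mod_cast hj.le
    push_cast
    rw [mul_div_assoc', div_le_iff₀ hK0]
    linarith
  -- The geometric sum is `(exp 0.4291 - 1) / (exp (0.4291 / K) - 1)`. By `exp s - 1 ≥ s` it is at
  -- most `K (exp 0.4291 - 1) / 0.4291`, just below `5 / 4 * K`.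
  · have hz : 0.4291 / (K : ℝ) ≤ Real.exp (0.4291 / K) - 1 := by
      linarith [Real.add_one_le_exp (0.4291 / (K : ℝ))]
    have hz0 : 0 < 0.4291 / (K : ℝ) := by positivity
    rw [geom_sum_eq (by linarith), ← Real.exp_nat_mul, mul_div_cancel₀ _ hK0.ne',
      div_le_iff₀ (by linarith)]
    have : 5 / 4 * (K : ℝ) * (0.4291 / K) = 0.536375 := by field_simp; norm_num
    nlinarith [mul_le_mul_of_nonneg_left hz (by positivity : 0 ≤ 5 / 4 * (K : ℝ))]
  · have h3 : Real.exp (0.4291 / 2) ≤ 1.2395 := by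
      refine le_of_sq_le_sq ?_ (by norm_num)
      rw [← Real.exp_nat_mul]
      refine le_trans (le_of_eq ?_) (he.trans (by norm_num))
      norm_num
    have h4 : 0 ≤ K * (L * ηl) := by positivity
    nlinarith [mul_le_mul_of_nonneg_left h3 h4]

/-! ### Uniformly random sets of clients -/

section Sampling

variable {M A : ℕ}

theorem card_powersetCard_superset (T : Finset (Fin M)) (h : T.card ≤ A) :
    ((Finset.powersetCard A (Finset.univ : Finset (Fin M))).filter fun S => T ⊆ S).card =
      (M - T.card).choose (A - T.card) := by
  have h1 : (Finset.powersetCard (A - T.card) (Finset.univ \ T)).card =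
      (M - T.card).choose (A - T.card) := by
    rw [Finset.card_powersetCard, Finset.card_sdiff_of_subset (Finset.subset_univ T)]
    simp
  rw [← h1]
  refine Finset.card_bij' (fun S _ => S \ T) (fun S _ => S ∪ T) ?_ ?_ ?_ ?_
  · intro S hS
    obtain ⟨hS1, hS2⟩ := Finset.mem_filter.1 hS
    rw [Finset.mem_powersetCard] at hS1 ⊢
    exact ⟨Finset.sdiff_subset_sdiff (Finset.subset_univ _) subset_rfl, by
      rw [Finset.card_sdiff_of_subset hS2, hS1.2]⟩
  · intro S hS
    obtain ⟨hS1, hS2⟩ := Finset.mem_powersetCard.1 hS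
    have hd : Disjoint S T := Finset.disjoint_of_subset_left hS1 Finset.sdiff_disjoint
    rw [Finset.mem_filter, Finset.mem_powersetCard]
    refine ⟨⟨Finset.subset_univ _, ?_⟩, Finset.subset_union_right⟩
    rw [Finset.card_union_of_disjoint hd, hS2]
    omega
  · intro S hS
    exact Finset.sdiff_union_of_subset (Finset.mem_filter.1 hS).2
  · intro S hS
    obtain ⟨hS1, -⟩ := Finset.mem_powersetCard.1 hS
    have hd : Disjoint S T := Finset.disjoint_of_subset_left hS1 Finset.sdiff_disjoint
    rw [Finset.union_sdiff_right, Finset.sdiff_eq_self_of_disjoint hd]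

theorem isProbabilityMeasure_uniformOn_card (hA : A ≤ M) :
    IsProbabilityMeasure (uniformOn {s : Finset (Fin M) | s.card = A}) := by
  refine isProbabilityMeasure_uniformOn (Set.toFinite _) ?_
  obtain ⟨s, -, hs⟩ := Finset.exists_subset_card_eq (s := (Finset.univ : Finset (Fin M)))
    (n := A) (by simpa using hA)
  exact ⟨s, hs⟩

theorem integral_uniformOn_card (hA : A ≤ M) (φ : Finset (Fin M) → ℝ) :
    ∫ S, φ S ∂(uniformOn {s : Finset (Fin M) | s.card = A}) =
      (M.choose A : ℝ)⁻¹ * ∑ S ∈ Finset.powersetCard A Finset.univ, φ S := by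
  have := isProbabilityMeasure_uniformOn_card hA
  rw [integral_fintype (Integrable.of_finite)]
  have hset : {s : Finset (Fin M) | s.card = A} =
      ((Finset.powersetCard A Finset.univ : Finset (Finset (Fin M))) : Set (Finset (Fin M))) := by
    ext s; simp [Finset.mem_powersetCard]
  have h1 : ∀ S : Finset (Fin M), (uniformOn {s : Finset (Fin M) | s.card = A}).real {S} =
      if S ∈ Finset.powersetCard A Finset.univ then (M.choose A : ℝ)⁻¹ else 0 := by
    intro S
    rw [Measure.real, uniformOn, cond_apply (Set.toFinite _).measurableSet, hset,
      Measure.count_apply_finset]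
    split_ifs with hS
    · rw [Set.inter_eq_self_of_subset_right (by simpa using hS)]
      simp
    · rw [Set.inter_singleton_eq_empty.2 (by simpa using hS)]
      simp
  simp_rw [h1, smul_eq_mul, ite_mul, zero_mul]
  rw [← Finset.sum_filter, Finset.mul_sum]
  refine Finset.sum_congr ?_ fun _ _ => rfl
  ext; simp

theorem integral_uniformOn_superset (hA : A ≤ M) (T : Finset (Fin M)) (h : T.card ≤ A) :
    ∫ S, (if T ⊆ S then (1 : ℝ) else 0) ∂(uniformOn {s : Finset (Fin M) | s.card = A}) =
      ((M - T.card).choose (A - T.card) : ℝ) / M.choose A := by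
  rw [integral_uniformOn_card hA, Finset.sum_boole, card_powersetCard_superset T h,
    div_eq_inv_mul]

theorem integral_uniformOn_mem (hA0 : 1 ≤ A) (hA : A ≤ M) (i : Fin M) :
    ∫ S, (if i ∈ S then (1 : ℝ) else 0) ∂(uniformOn {s : Finset (Fin M) | s.card = A}) =
      (A : ℝ) / M := by
  have h := integral_uniformOn_superset hA {i} (by simpa using hA0)
  simp only [Finset.singleton_subset_iff, Finset.card_singleton] at h
  rw [h]
  obtain ⟨a, rfl⟩ : ∃ a, A = a + 1 := ⟨A - 1, by omega⟩
  obtain ⟨m, rfl⟩ : ∃ m, M = m + 1 := ⟨M - 1, by omega⟩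
  have h1 := Nat.add_one_mul_choose_eq m a
  have h2 : ((m + 1 : ℕ) : ℝ) * m.choose a = (m + 1).choose (a + 1) * (a + 1 : ℕ) := by
    exact_mod_cast h1
  have h3 : ((m + 1).choose (a + 1) : ℝ) ≠ 0 := by exact_mod_cast (Nat.choose_pos hA).ne'
  rw [div_eq_div_iff h3 (by positivity)]
  simp only [Nat.add_sub_cancel]
  linarith

theorem integral_uniformOn_mem_mem (hA0 : 1 ≤ A) (hA : A ≤ M) {i j : Fin M} (hij : i ≠ j) :
    ∫ S, (if i ∈ S ∧ j ∈ S then (1 : ℝ) else 0)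
        ∂(uniformOn {s : Finset (Fin M) | s.card = A}) =
      (A : ℝ) * (A - 1) / (M * (M - 1)) := by
  -- For `A = 1` no pair is sampled and both sides vanish; the count of supersets needs sets of at
  -- least two elements.
  rcases hA0.eq_or_lt with rfl | hA1
  · rw [integral_uniformOn_card hA, Finset.sum_eq_zero]
    · simp
    · intro S hS
      rw [if_neg]
      rintro ⟨hi, hj⟩
      obtain ⟨a, rfl⟩ := Finset.card_eq_one.1 (Finset.mem_powersetCard.1 hS).2
      exact hij ((Finset.mem_singleton.1 hi).trans (Finset.mem_singleton.1 hj).symm)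
  have h := integral_uniformOn_superset hA {i, j} (by rw [Finset.card_pair hij]; exact hA1)
  simp only [Finset.insert_subset_iff, Finset.singleton_subset_iff, Finset.card_pair hij] at h
  rw [h]
  obtain ⟨a, rfl⟩ : ∃ a, A = a + 2 := ⟨A - 2, by omega⟩
  obtain ⟨m, rfl⟩ : ∃ m, M = m + 2 := ⟨M - 2, by omega⟩
  have h1 := Nat.add_one_mul_choose_eq m a
  have h2 : ((m + 1 : ℕ) : ℝ) * m.choose a = (m + 1).choose (a + 1) * (a + 1 : ℕ) := by
    exact_mod_cast h1
  have h1' := Nat.add_one_mul_choose_eq (m + 1) (a + 1)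
  have h2' : ((m + 2 : ℕ) : ℝ) * (m + 1).choose (a + 1) =
      (m + 2).choose (a + 2) * (a + 2 : ℕ) := by
    exact_mod_cast h1'
  have h3 : ((m + 2).choose (a + 2) : ℝ) ≠ 0 := by exact_mod_cast (Nat.choose_pos hA).ne'
  have h4 : ((m + 2 : ℕ) : ℝ) * (((m + 2 : ℕ) : ℝ) - 1) ≠ 0 := by
    push_cast
    have : (m : ℝ) + 2 - 1 ≠ 0 := by
      have := (Nat.cast_nonneg m : (0 : ℝ) ≤ m); linarith
    positivity
  rw [div_eq_div_iff h3 h4]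
  simp only [Nat.add_sub_cancel]
  push_cast at h2 h2' ⊢
  linear_combination ((m : ℝ) + 2) * h2 + ((a : ℝ) + 1) * h2'

end Sampling

/-! ### The law of a round -/

section Round

variable {Ξ : Type*} [MeasurableSpace Ξ] {d M A b b' K : ℕ} {D : Fin M → LocalData Ξ}

theorem isProbabilityMeasure_coinLaw {p : ℝ} (h0 : 0 ≤ p) (h1 : p ≤ 1) :
    IsProbabilityMeasure (coinLaw p) := by
  constructor
  simp only [coinLaw, Measure.add_apply, Measure.smul_apply, measure_univ, smul_eq_mul, mul_one]
  rw [← ENNReal.ofReal_add h0 (by linarith)]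
  simp

/-- Hypotheses under which the laws of the batches are probability measures. -/
structure ValidSizes (D : Fin M → LocalData Ξ) (A b b' : ℕ) : Prop where
  one_le : 1 ≤ A
  le : A ≤ M
  large : ∀ m, (b : ℕ∞) ≤ (D m).size
  small : ∀ m, (b' : ℕ∞) ≤ (D m).size

theorem isProbabilityMeasure_roundLaw (h : ValidSizes D A b b') {p : ℝ} (h0 : 0 ≤ p)
    (h1 : p ≤ 1) : IsProbabilityMeasure (roundLaw D A b b' K p) := by
  have := isProbabilityMeasure_uniformOn_card h.le
  have := isProbabilityMeasure_coinLaw h0 h1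
  have := fun m => (D m).isProbabilityMeasure_batchLaw (h.large m)
  have := fun m => (D m).isProbabilityMeasure_batchLaw (h.small m)
  unfold roundLaw
  infer_instance

theorem ae_coin (h : ValidSizes D A b b') {p : ℝ} (h0 : 0 ≤ p) (h1 : p ≤ 1) {c : Bool}
    (hc : coinLaw p {!c} = 0) :
    ∀ᵐ ω ∂(roundLaw D A b b' K p), ∀ i, ω.2.1 i = c := by
  have := isProbabilityMeasure_uniformOn_card h.le
  have := isProbabilityMeasure_coinLaw h0 h1
  have := fun m => (D m).isProbabilityMeasure_batchLaw (h.large m)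
  have := fun m => (D m).isProbabilityMeasure_batchLaw (h.small m)
  have hmp : ∀ i, MeasurePreserving (fun ω : RoundSeed Ξ M b b' K => ω.2.1 i)
      (roundLaw D A b b' K p) (coinLaw p) := fun i =>
    (measurePreserving_eval _ i).comp (measurePreserving_fst.comp measurePreserving_snd)
  rw [ae_all_iff]
  intro i
  have h2 : ∀ᵐ z ∂(coinLaw p), z = c := by
    rw [ae_iff]
    refine measure_mono_null (fun z hz => ?_) hc
    cases z <;> cases c <;> simp_all
  exact (hmp i).quasiMeasurePreserving.ae h2

theorem ae_coin_zero (h : ValidSizes D A b b') :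
    ∀ᵐ ω ∂(roundLaw D A b b' K 0), ∀ i, ω.2.1 i = false :=
  ae_coin h le_rfl zero_le_one (by simp [coinLaw])

theorem ae_coin_one (h : ValidSizes D A b b') :
    ∀ᵐ ω ∂(roundLaw D A b b' K 1), ∀ i, ω.2.1 i = true :=
  ae_coin h zero_le_one le_rfl (by simp [coinLaw])

theorem measurePreserving_sampled_large (h : ValidSizes D A b b') {p : ℝ} (h0 : 0 ≤ p)
    (h1 : p ≤ 1) :
    MeasurePreserving (fun ω : RoundSeed Ξ M b b' K => (ω.1, ω.2.2.1)) (roundLaw D A b b' K p)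
      ((uniformOn {s : Finset (Fin M) | s.card = A}).prod
        (Measure.pi fun m => (D m).batchLaw b)) := by
  have := isProbabilityMeasure_uniformOn_card h.le
  have := isProbabilityMeasure_coinLaw h0 h1
  have := fun m => (D m).isProbabilityMeasure_batchLaw (h.large m)
  have := fun m => (D m).isProbabilityMeasure_batchLaw (h.small m)
  exact (MeasurePreserving.id _).prod (measurePreserving_fst.comp measurePreserving_snd)

theorem measurePreserving_sampled_small (h : ValidSizes D A b b') {p : ℝ} (h0 : 0 ≤ p)
    (h1 : p ≤ 1) (i : Fin M) :
    MeasurePreserving (fun ω : RoundSeed Ξ M b b' K => (ω.1, ω.2.2.2 i)) (roundLaw D A b b' K p)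
      ((uniformOn {s : Finset (Fin M) | s.card = A}).prod
        (Measure.pi fun _ : Fin K => (D i).batchLaw b')) := by
  have := isProbabilityMeasure_uniformOn_card h.le
  have := isProbabilityMeasure_coinLaw h0 h1
  have := fun m => (D m).isProbabilityMeasure_batchLaw (h.large m)
  have := fun m => (D m).isProbabilityMeasure_batchLaw (h.small m)
  exact (MeasurePreserving.id _).prod ((measurePreserving_eval
    (fun m => Measure.pi fun _ : Fin K => (D m).batchLaw b') i).comp
    (measurePreserving_snd.comp measurePreserving_snd))

theorem ae_card_sampled (h : ValidSizes D A b b') {p : ℝ} (h0 : 0 ≤ p) (h1 : p ≤ 1) :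
    ∀ᵐ ω ∂(roundLaw D A b b' K p), ω.1.card = A := by
  have := isProbabilityMeasure_uniformOn_card h.le
  have := isProbabilityMeasure_coinLaw h0 h1
  have := fun m => (D m).isProbabilityMeasure_batchLaw (h.large m)
  have := fun m => (D m).isProbabilityMeasure_batchLaw (h.small m)
  have hmp : MeasurePreserving (fun ω : RoundSeed Ξ M b b' K => ω.1)
      (roundLaw D A b b' K p) (uniformOn {s : Finset (Fin M) | s.card = A}) :=
    measurePreserving_fst
  have h2 : ∀ᵐ S ∂(uniformOn {s : Finset (Fin M) | s.card = A}), S.card = A := by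
    have := ae_cond_mem (μ := Measure.count)
      (Set.toFinite {s : Finset (Fin M) | s.card = A}).measurableSet
    exact this
  exact hmp.quasiMeasurePreserving.ae h2

omit [MeasurableSpace Ξ] in
-- The case without miners is absorbed: the sum is then empty and the inverse of the cardinality is
-- `0`. This gives one formula for both kinds of rounds.
theorem roundStep_model (f : Fin M → Vec d → Ξ → ℝ) (ηs ηl : ℝ) (s : State d M)
    (ω : RoundSeed Ξ M b b' K) :
    (roundStep f ηs ηl s ω).model = s.model -
      ηs • (((ω.1.filter fun i => ω.2.1 i = false).card : ℝ)⁻¹ •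
        ∑ i, if i ∈ ω.1 ∧ ω.2.1 i = false then
          localDelta (f i) ηl s.model s.bullseye (ω.2.2.2 i) else 0) := by
  simp only [roundStep]
  rw [← Finset.sum_filter]
  have e : (Finset.univ.filter fun i => i ∈ ω.1 ∧ ω.2.1 i = false) =
      ω.1.filter fun i => ω.2.1 i = false := by ext; simp
  rw [e]
  split_ifs with h
  · rfl
  · rw [Finset.not_nonempty_iff_eq_empty.1 h]
    simp

theorem measurable_bullseye :
    Measurable fun s : Vec d × (Fin M → Vec d) => (State.mk s.1 s.2).bullseye := by
  simp only [State.bullseye]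
  have : Measurable fun s : Vec d × (Fin M → Vec d) => ∑ m, s.2 m :=
    Finset.measurable_fun_sum _ fun m _ => (measurable_pi_apply m).comp measurable_snd
  exact this.const_smul (M : ℝ)⁻¹

theorem measurable_roundStep_model {f : Fin M → Vec d → Ξ → ℝ}
    (hG : ∀ i, Measurable fun p : Vec d × (Fin b' → Ξ) => batchGrad (f i) p.1 p.2) (ηs ηl : ℝ) :
    Measurable fun p : (Vec d × (Fin M → Vec d)) × RoundSeed Ξ M b b' K =>
      (roundStep f ηs ηl ⟨p.1.1, p.1.2⟩ p.2).model := by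
  simp only [roundStep_model]
  have hdisc : ∀ (E : Type) [MeasurableSpace E] (φ : Finset (Fin M) × (Fin M → Bool) → E),
      Measurable fun p : (Vec d × (Fin M → Vec d)) × RoundSeed Ξ M b b' K =>
        φ (p.2.1, p.2.2.1) := fun E _ φ =>
    (measurable_of_finite φ).comp (by fun_prop)
  have hD : ∀ i, Measurable fun p : (Vec d × (Fin M → Vec d)) × RoundSeed Ξ M b b' K =>
      localDelta (f i) ηl p.1.1 (State.mk p.1.1 p.1.2).bullseye (p.2.2.2.2 i) := by
    intro i
    have h1 := (measurable_localState (K := K) (hG i) ηl K).2.1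
    have h2 : Measurable fun p : (Vec d × (Fin M → Vec d)) × RoundSeed Ξ M b b' K =>
        ((p.1.1, (State.mk p.1.1 p.1.2).bullseye), p.2.2.2.2 i) :=
      ((measurable_fst.comp measurable_fst).prodMk (measurable_bullseye.comp measurable_fst)).prodMk
        (by fun_prop)
    exact (measurable_fst.comp measurable_fst).sub (h1.comp h2)
  have hS : ∀ i, MeasurableSet {p : (Vec d × (Fin M → Vec d)) × RoundSeed Ξ M b b' K |
      i ∈ p.2.1 ∧ p.2.2.1 i = false} := fun i =>
    measurableSet_setOfPred.2 (hdisc Prop fun q => i ∈ q.1 ∧ q.2 i = false)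
  have hsum : Measurable fun p : (Vec d × (Fin M → Vec d)) × RoundSeed Ξ M b b' K =>
      ∑ i, if i ∈ p.2.1 ∧ p.2.2.1 i = false then
        localDelta (f i) ηl p.1.1 (State.mk p.1.1 p.1.2).bullseye (p.2.2.2.2 i) else 0 :=
    Finset.measurable_fun_sum _ fun i _ => Measurable.ite (hS i) (hD i) measurable_const
  have hc := hdisc ℝ fun q => ((q.1.filter fun i => q.2 i = false).card : ℝ)⁻¹
  exact (measurable_fst.comp measurable_fst).sub ((hc.smul hsum).const_smul ηs)

theorem measurable_roundStep_cache {f : Fin M → Vec d → Ξ → ℝ}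
    (hG : ∀ i, Measurable fun p : Vec d × (Fin b → Ξ) => batchGrad (f i) p.1 p.2) (ηs ηl : ℝ) :
    Measurable fun p : (Vec d × (Fin M → Vec d)) × RoundSeed Ξ M b b' K =>
      (roundStep f ηs ηl ⟨p.1.1, p.1.2⟩ p.2).cache := by
  refine measurable_pi_lambda _ fun i => ?_
  simp only [roundStep]
  have hS : MeasurableSet {p : (Vec d × (Fin M → Vec d)) × RoundSeed Ξ M b b' K |
      i ∈ p.2.1 ∧ p.2.2.1 i = true} := by
    have h1 : Measurable fun q : Finset (Fin M) × (Fin M → Bool) => i ∈ q.1 ∧ q.2 i = true :=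
      measurable_of_finite _
    have h2 : Measurable fun p : (Vec d × (Fin M → Vec d)) × RoundSeed Ξ M b b' K =>
        (p.2.1, p.2.2.1) := by fun_prop
    exact measurableSet_setOfPred.2 (h1.comp h2)
  refine Measurable.ite hS ?_ (by fun_prop)
  exact measurable_comp_pair (f := fun v (B : Fin b → Ξ) => batchGrad (f i) v B) (hG i)
    (by fun_prop) (by fun_prop)

end Round

/-! ### Sampled clients with independent data -/

section SampledData

variable {M A : ℕ} {G : Type*} [MeasurableSpace G] {ν : Measure G} [IsProbabilityMeasure ν]

theorem measurable_mem_indicator {E : Type*} [MeasurableSpace E] {i : Fin M} {φ ψ : G → E}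
    (hφ : Measurable φ) (hψ : Measurable ψ) :
    Measurable fun p : Finset (Fin M) × G => if i ∈ p.1 then φ p.2 else ψ p.2 :=
  measurable_from_prod_countable_right fun S => by
    by_cases h : i ∈ S
    · simpa [h] using hφ
    · simpa [h] using hψ

theorem integral_mem_mul (hA0 : 1 ≤ A) (hA : A ≤ M) (i : Fin M) (ψ : G → ℝ) :
    ∫ p, (if i ∈ p.1 then ψ p.2 else 0)
        ∂((uniformOn {s : Finset (Fin M) | s.card = A}).prod ν) = (A : ℝ) / M * ∫ y, ψ y ∂ν := by
  rw [← integral_uniformOn_mem hA0 hA i]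
  have := isProbabilityMeasure_uniformOn_card hA
  rw [← integral_prod_mul (fun S : Finset (Fin M) => if i ∈ S then (1 : ℝ) else 0) ψ]
  refine integral_congr_ae (Filter.Eventually.of_forall fun p => ?_)
  simp

omit [IsProbabilityMeasure ν] in
theorem integrable_mem_mul (hA : A ≤ M) (i : Fin M) {ψ : G → ℝ} (hψ : Integrable ψ ν) :
    Integrable (fun p : Finset (Fin M) × G => if i ∈ p.1 then ψ p.2 else 0)
      ((uniformOn {s : Finset (Fin M) | s.card = A}).prod ν) := by
  have := isProbabilityMeasure_uniformOn_card hA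
  have h1 : Integrable (fun S : Finset (Fin M) => if i ∈ S then (1 : ℝ) else 0)
      (uniformOn {s : Finset (Fin M) | s.card = A}) := Integrable.of_finite
  refine (h1.mul_prod hψ).congr (Filter.Eventually.of_forall fun p => ?_)
  simp

theorem integral_mem_ite (hA0 : 1 ≤ A) (hA : A ≤ M) (i : Fin M) {ψ : G → ℝ}
    (hψ : Integrable ψ ν) (c : ℝ) :
    Integrable (fun p : Finset (Fin M) × G => if i ∈ p.1 then ψ p.2 else c)
        ((uniformOn {s : Finset (Fin M) | s.card = A}).prod ν) ∧
      ∫ p, (if i ∈ p.1 then ψ p.2 else c)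
        ∂((uniformOn {s : Finset (Fin M) | s.card = A}).prod ν) =
        (A : ℝ) / M * ∫ y, ψ y ∂ν + (1 - (A : ℝ) / M) * c := by
  have := isProbabilityMeasure_uniformOn_card hA
  have e : ∀ p : Finset (Fin M) × G, (if i ∈ p.1 then ψ p.2 else c) =
      (if i ∈ p.1 then ψ p.2 - c else 0) + c := fun p => by split_ifs <;> simp
  have h1 := integrable_mem_mul hA i (hψ.sub (integrable_const c))
  simp_rw [e]
  refine ⟨h1.add (integrable_const c), ?_⟩
  simp only [Pi.sub_apply] at h1
  rw [integral_add h1 (integrable_const c), integral_mem_mul hA0 hA i fun y => ψ y - c,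
    integral_sub hψ (integrable_const c)]
  simp
  ring

/-- The sum of independent centered vectors. -/
theorem integral_sq_norm_sum_le {ι : Type*} [Fintype ι] {Ω : ι → Type*}
    [∀ i, MeasurableSpace (Ω i)] {μ : ∀ i, Measure (Ω i)} [∀ i, IsProbabilityMeasure (μ i)]
    {E : Type*} [NormedAddCommGroup E] [InnerProductSpace ℝ E] [CompleteSpace E]
    [MeasurableSpace E] [BorelSpace E] [SecondCountableTopology E] {X : ∀ i, Ω i → E}
    (hX : ∀ i, Measurable (X i)) (hm : ∀ i, MemLp (X i) 2 (μ i)) (h0 : ∀ i, ∫ y, X i y ∂μ i = 0)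
    (S : Finset ι) :
    MemLp (fun ω => ∑ i ∈ S, X i (ω i)) 2 (Measure.pi μ) ∧
      ∫ ω, ∑ i ∈ S, X i (ω i) ∂Measure.pi μ = 0 ∧
      ∫ ω, ‖∑ i ∈ S, X i (ω i)‖ ^ 2 ∂Measure.pi μ ≤ ∑ i ∈ S, ∫ y, ‖X i y‖ ^ 2 ∂μ i := by
  classical
  have hm' : ∀ i, MemLp (fun ω : ∀ i, Ω i => X i (ω i)) 2 (Measure.pi μ) := fun i =>
    (hm i).comp_measurePreserving (measurePreserving_eval μ i)
  have hi' : ∀ i, Integrable (fun ω : ∀ i, Ω i => X i (ω i)) (Measure.pi μ) := fun i =>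
    (hm' i).integrable (by norm_num)
  refine ⟨memLp_finsetSum _ fun i _ => hm' i, ?_, ?_⟩
  · rw [integral_finsetSum _ fun i _ => hi' i]
    refine Finset.sum_eq_zero fun i _ => ?_
    rw [integral_comp_eval (hm i).1, h0]
  -- Independence and centring make the cross terms vanish. Only this sign is needed, and it follows
  -- from the conditional lower bound applied to `-X j`.
  have hcross : ∀ i j, i ≠ j →
      ∫ ω, inner ℝ (X i (ω i)) (X j (ω j)) ∂Measure.pi μ ≤ 0 := by
    intro i j hij
    have hXi : Measurable fun ω : ∀ i, Ω i => X i (ω i) := (hX i).comp (measurable_pi_apply i)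
    have hlaw := map_prod_pi μ hXi (S := {i}) (k := j)
      (fun ω ω' h => by simp only; rw [h i (by simp)]) (by simpa using hij.symm)
    have h1 := le_integral_of_indep hXi (measurable_pi_apply j) hlaw
      (φ := fun e y => inner ℝ e (-X j y))
      (measurable_fst.inner ((hX j).comp measurable_snd).neg)
      (MemLp.integrable_inner_two (hm' i) (hm' j).neg) (c := fun _ => 0) (integrable_const _)
      fun e => by
        have hi : Integrable (fun y => -X j y) (μ j) := ((hm j).integrable (by norm_num)).neg
        rw [integral_inner hi, integral_neg, h0]
        simp
    simp only [inner_neg_right, integral_neg, integral_zero] at h1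
    linarith
  induction S using Finset.induction_on with
  | empty => simp
  | insert i S hi ih =>
    have hS : MemLp (fun ω : ∀ i, Ω i => ∑ i ∈ S, X i (ω i)) 2 (Measure.pi μ) :=
      memLp_finsetSum _ fun i _ => hm' i
    have e : ∀ ω : ∀ i, Ω i, ‖∑ i ∈ insert i S, X i (ω i)‖ ^ 2 =
        ‖X i (ω i)‖ ^ 2 + 2 * (∑ j ∈ S, inner ℝ (X i (ω i)) (X j (ω j))) +
          ‖∑ i ∈ S, X i (ω i)‖ ^ 2 := fun ω => by
      rw [Finset.sum_insert hi, norm_add_sq_real, inner_sum]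
    simp_rw [e]
    have i1 := (hm' i).integrable_norm_pow two_ne_zero
    have i2 : ∀ j ∈ S, Integrable (fun ω : ∀ i, Ω i => inner ℝ (X i (ω i)) (X j (ω j)))
        (Measure.pi μ) := fun j _ => MemLp.integrable_inner_two (hm' i) (hm' j)
    have i3 := integrable_finsetSum S i2
    have i4 : Integrable (fun ω : ∀ i, Ω i => ‖X i (ω i)‖ ^ 2 +
        2 * (∑ j ∈ S, inner ℝ (X i (ω i)) (X j (ω j)))) (Measure.pi μ) := i1.add (i3.const_mul 2)
    rw [integral_add i4 (hS.integrable_norm_pow two_ne_zero), integral_add i1 (i3.const_mul 2),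
      integral_const_mul, integral_finsetSum S i2, Finset.sum_insert hi]
    have h1 : ∫ ω : ∀ i, Ω i, ‖X i (ω i)‖ ^ 2 ∂Measure.pi μ = ∫ y, ‖X i y‖ ^ 2 ∂μ i :=
      integral_comp_eval (f := fun y => ‖X i y‖ ^ 2)
        ((hm i).integrable_norm_pow two_ne_zero).1
    have h2 := Finset.sum_nonpos fun j (hj : j ∈ S) =>
      hcross i j fun h => hi (h ▸ hj)
    linarith

/-- Moments of the average of the vectors of the sampled clients. -/
theorem moments_sampled_average {Ω : Type*} [MeasurableSpace Ω] {P : Measure Ω}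
    [IsProbabilityMeasure P] {G : Fin M → Type*} [∀ i, MeasurableSpace (G i)]
    {ν : ∀ i, Measure (G i)} [∀ i, IsProbabilityMeasure (ν i)] (hA0 : 1 ≤ A) (hA : A ≤ M)
    {S : Ω → Finset (Fin M)} {y : ∀ i, Ω → G i}
    (hmp : ∀ i, MeasurePreserving (fun ω => (S ω, y i ω)) P
      ((uniformOn {s : Finset (Fin M) | s.card = A}).prod (ν i)))
    (hS : ∀ᵐ ω ∂P, (S ω).card = A) {E : Type*} [NormedAddCommGroup E] [InnerProductSpace ℝ E]
    [CompleteSpace E] [MeasurableSpace E] [BorelSpace E] [SecondCountableTopology E]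
    {Δ : ∀ i, G i → E} (hΔm : ∀ i, Measurable (Δ i)) (hΔ : ∀ i, MemLp (Δ i) 2 (ν i)) {u : E}
    {c₁ c₂ : ℝ} (h₁ : ∀ i, ∫ z, ‖Δ i z‖ ^ 2 ∂ν i ≤ c₁) (h₂ : ∀ i, c₂ ≤ ∫ z, inner ℝ u (Δ i z) ∂ν i) :
    MemLp (fun ω => (A : ℝ)⁻¹ • ∑ i, if i ∈ S ω then Δ i (y i ω) else 0) 2 P ∧
      ∫ ω, ‖(A : ℝ)⁻¹ • ∑ i, if i ∈ S ω then Δ i (y i ω) else 0‖ ^ 2 ∂P ≤ c₁ ∧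
      c₂ ≤ ∫ ω, inner ℝ u ((A : ℝ)⁻¹ • ∑ i, if i ∈ S ω then Δ i (y i ω) else 0) ∂P := by
  have hA1 : (A : ℝ) ≠ 0 := by positivity
  have hM1 : (M : ℝ) ≠ 0 := by
    have : 0 < M := by omega
    positivity
  let Z : Fin M → Ω → E := fun i ω => if i ∈ S ω then Δ i (y i ω) else 0
  have hZm : ∀ i, Measurable (Z i) := fun i =>
    (measurable_mem_indicator (i := i) (hΔm i) measurable_const).comp (hmp i).measurable
  have hsq : ∀ i, Integrable (fun ω => ‖Z i ω‖ ^ 2) P ∧ ∫ ω, ‖Z i ω‖ ^ 2 ∂P ≤ A / M * c₁ := by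
    intro i
    have e : (fun ω => ‖Z i ω‖ ^ 2) = (fun p : Finset (Fin M) × G i =>
        if i ∈ p.1 then ‖Δ i p.2‖ ^ 2 else 0) ∘ fun ω => (S ω, y i ω) := by
      funext ω
      simp only [Z, Function.comp]
      split_ifs <;> simp
    have h1 := integrable_mem_mul hA i ((hΔ i).integrable_norm_pow two_ne_zero)
    constructor
    · rw [e]
      exact (hmp i).integrable_comp_of_integrable h1
    · rw [e]
      simp only [Function.comp_def]
      rw [integral_comp_measurePreserving (hmp i) h1.1]
      refine (integral_mem_mul (ν := ν i) hA0 hA i fun z => ‖Δ i z‖ ^ 2).trans_le ?_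
      exact mul_le_mul_of_nonneg_left (h₁ i) (by positivity)
  have hZ : ∀ i, MemLp (Z i) 2 P := fun i =>
    memLp_two_of_integrable_sq_norm (hZm i).aestronglyMeasurable (hsq i).1
  have hin : ∀ i, A / M * c₂ ≤ ∫ ω, inner ℝ u (Z i ω) ∂P := by
    intro i
    have e : (fun ω => inner ℝ u (Z i ω)) = (fun p : Finset (Fin M) × G i =>
        if i ∈ p.1 then inner ℝ u (Δ i p.2) else 0) ∘ fun ω => (S ω, y i ω) := by
      funext ω
      simp only [Z, Function.comp]
      split_ifs <;> simp
    have h1 := integrable_mem_mul hA i (((hΔ i).integrable (by norm_num)).const_inner u)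
    rw [e]
    simp only [Function.comp_def]
    rw [integral_comp_measurePreserving (hmp i) h1.1]
    refine le_trans ?_ (integral_mem_mul (ν := ν i) hA0 hA i fun z => inner ℝ u (Δ i z)).ge
    exact mul_le_mul_of_nonneg_left (h₂ i) (by positivity)
  have hsum : MemLp (fun ω => (A : ℝ)⁻¹ • ∑ i, Z i ω) 2 P :=
    (memLp_finsetSum _ fun i _ => hZ i).const_smul _
  -- The model changes are not centred, so independence is of no use here. Cauchy-Schwarz over
  -- exactly `A` clients costs a factor `A`, which the normalization `A⁻²` and the inclusion
  -- probability `A / M` absorb.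
  have hae : ∀ᵐ ω ∂P, ‖∑ i, Z i ω‖ ^ 2 ≤ A * ∑ i, ‖Z i ω‖ ^ 2 := by
    filter_upwards [hS] with ω h2
    have e1 : ∑ i, Z i ω = ∑ i ∈ S ω, Δ i (y i ω) := by
      simp only [Z]; rw [← Finset.sum_filter]; simp
    have e2 : ∑ i, ‖Z i ω‖ ^ 2 = ∑ i ∈ S ω, ‖Δ i (y i ω)‖ ^ 2 := by
      have : ∀ i, ‖Z i ω‖ ^ 2 = if i ∈ S ω then ‖Δ i (y i ω)‖ ^ 2 else 0 := fun i => by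
        simp only [Z]; split_ifs <;> simp
      simp_rw [this]; rw [← Finset.sum_filter]; simp
    rw [e1, e2, ← h2]
    exact (pow_le_pow_left₀ (norm_nonneg _) (norm_sum_le _ _) 2).trans sq_sum_le_card_mul_sum_sq
  refine ⟨hsum, ?_, ?_⟩
  · have hi2 : Integrable (fun ω => ∑ i, ‖Z i ω‖ ^ 2) P :=
      integrable_finsetSum _ fun i _ => (hsq i).1
    calc ∫ ω, ‖(A : ℝ)⁻¹ • ∑ i, Z i ω‖ ^ 2 ∂P
        ≤ ∫ ω, (A : ℝ)⁻¹ * ∑ i, ‖Z i ω‖ ^ 2 ∂P := by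
          refine integral_mono_ae (hsum.integrable_norm_pow two_ne_zero) (hi2.const_mul _) ?_
          filter_upwards [hae] with ω hω
          rw [norm_smul, mul_pow, Real.norm_eq_abs, sq_abs]
          calc (A : ℝ)⁻¹ ^ 2 * ‖∑ i, Z i ω‖ ^ 2
              ≤ (A : ℝ)⁻¹ ^ 2 * (A * ∑ i, ‖Z i ω‖ ^ 2) := by gcongr
            _ = _ := by field_simp
      _ = (A : ℝ)⁻¹ * ∑ i, ∫ ω, ‖Z i ω‖ ^ 2 ∂P := by
          rw [integral_const_mul, integral_finsetSum _ fun i _ => (hsq i).1]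
      _ ≤ (A : ℝ)⁻¹ * ∑ _i : Fin M, A / M * c₁ := by
          gcongr with i; exact (hsq i).2
      _ = c₁ := by
          simp only [Finset.sum_const, Finset.card_univ, Fintype.card_fin, nsmul_eq_mul]
          field_simp
  · have e : ∫ ω, inner ℝ u ((A : ℝ)⁻¹ • ∑ i, Z i ω) ∂P =
        (A : ℝ)⁻¹ * ∑ i, ∫ ω, inner ℝ u (Z i ω) ∂P := by
      simp_rw [inner_smul_right, inner_sum]
      rw [integral_const_mul, integral_finsetSum _ fun i _ =>
        ((hZ i).integrable (by norm_num)).const_inner u]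
    calc c₂ = (A : ℝ)⁻¹ * ∑ _i : Fin M, A / M * c₂ := by
          simp only [Finset.sum_const, Finset.card_univ, Fintype.card_fin, nsmul_eq_mul]
          field_simp
      _ ≤ (A : ℝ)⁻¹ * ∑ i, ∫ ω, inner ℝ u (Z i ω) ∂P := by
          gcongr with i; exact hin i
      _ = _ := e.symm

end SampledData

/-! ### A round of mining -/

section Miner

variable {Ξ : Type*} [MeasurableSpace Ξ] {d M A b b' K : ℕ} {D : Fin M → LocalData Ξ}
  {f : Fin M → Vec d → Ξ → ℝ} {gr : Fin M → Vec d → Vec d} {L V ηs ηl : ℝ}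

/-- Admissible local step sizes. -/
structure SmallStep (L V ηl : ℝ) (K : ℕ) : Prop where
  one_le : 1 ≤ K
  L_nonneg : 0 ≤ L
  V_nonneg : 0 ≤ V
  nonneg : 0 ≤ ηl
  drift : L * ηl * K ≤ 0.20413
  noise : 48 * K * (V * ηl ^ 2) ≤ 1

/-- The two constants of a mining phase, uniform in the number `K` of local steps. -/
theorem SmallStep.moments_localDelta (hs : SmallStep L V ηl K) {Ξ : Type*} [MeasurableSpace Ξ]
    {d b' : ℕ} {f : Vec d → Ξ → ℝ} {μ : Measure (Fin b' → Ξ)} [IsProbabilityMeasure μ]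
    {gr : Vec d → Vec d} (h : GradOracle f μ gr L V) (u x g : Vec d) :
    MemLp (fun B : Fin K → Fin b' → Ξ => localDelta f ηl x g B) 2 (Measure.pi fun _ => μ) ∧
      ∫ B : Fin K → Fin b' → Ξ, ‖localDelta f ηl x g B‖ ^ 2 ∂(Measure.pi fun _ => μ) ≤
        (ηl * K) ^ 2 * (5 / 4) * ‖g‖ ^ 2 ∧
      ηl * K * (inner ℝ u g - 0.127 * (‖u‖ * ‖g‖)) ≤
        ∫ B : Fin K → Fin b' → Ξ, inner ℝ u (localDelta f ηl x g B)
          ∂(Measure.pi fun _ => μ) := by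
  have hη := hs.nonneg
  have hV := hs.V_nonneg
  obtain ⟨g1, g2, g3, g4⟩ := localGrowth_le hs.one_le hs.L_nonneg hs.nonneg hs.drift hs.noise
    (by positivity)
  obtain ⟨m1, m2, m3⟩ := h.moments_localDelta hs.L_nonneg hs.V_nonneg hs.nonneg u x g g1
    (Real.exp_nonneg _) g2
  refine ⟨m1, m2.trans ?_, le_trans ?_ m3⟩
  · calc _ ≤ ηl ^ 2 * K * (5 / 4 * K) * ‖g‖ ^ 2 := by gcongr
      _ = _ := by ring
  · refine mul_le_mul_of_nonneg_left ?_ (by positivity)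
    have := mul_le_mul_of_nonneg_right g4 (by positivity : 0 ≤ ‖u‖ * ‖g‖)
    linarith

/-- Almost surely every sampled client mines, so the average runs over exactly `A` clients, and each
of them, whatever its data, moves by about `ηl K g`: all miners follow the same bullseye. -/
theorem moments_miner_round (hv : ValidSizes D A b b') (hs : SmallStep L V ηl K)
    (hG : ∀ i, GradOracle (f i) ((D i).batchLaw b') (gr i) L V) (hηs : 0 ≤ ηs)
    (u x : Vec d) (v : Fin M → Vec d) :
    ∫⁻ ω : RoundSeed Ξ M b b' K, ‖x - (roundStep f ηs ηl ⟨x, v⟩ ω).model‖ₑ ^ 2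
        ∂(roundLaw D A b b' K 0) ≤
      ENNReal.ofReal ((ηs * ηl * K) ^ 2 * (5 / 4) * ‖(State.mk x v).bullseye‖ ^ 2) ∧
    ηs * ηl * K * (inner ℝ u (State.mk x v).bullseye -
        0.127 * (‖u‖ * ‖(State.mk x v).bullseye‖)) ≤
      ∫ ω : RoundSeed Ξ M b b' K, inner ℝ u (x - (roundStep f ηs ηl ⟨x, v⟩ ω).model)
        ∂(roundLaw D A b b' K 0) := by
  have := fun m => (D m).isProbabilityMeasure_batchLaw (hv.large m)
  have := fun m => (D m).isProbabilityMeasure_batchLaw (hv.small m)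
  have := isProbabilityMeasure_roundLaw (K := K) hv le_rfl zero_le_one
  generalize hg : (State.mk x v).bullseye = g
  have hΔ := fun i => hs.moments_localDelta (hG i) u x g
  have hΔm : ∀ i, Measurable fun B : Fin K → Fin b' → Ξ => localDelta (f i) ηl x g B := fun i => by
    have h1 := (measurable_localState (K := K) (hG i).measurable ηl K).2.1
    have h2 : Measurable fun B : Fin K → Fin b' → Ξ => ((x, g), B) := measurable_prodMk_left
    exact measurable_const.sub (h1.comp h2)
  obtain ⟨h1, h2, h3⟩ := moments_sampled_average hv.one_le hv.le
    (fun i => measurePreserving_sampled_small (K := K) hv le_rfl zero_le_one i)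
    (ae_card_sampled hv le_rfl zero_le_one) hΔm (fun i => (hΔ i).1) (fun i => (hΔ i).2.1)
    fun i => (hΔ i).2.2
  have hae : ∀ᵐ ω ∂(roundLaw D A b b' K 0), x - (roundStep f ηs ηl ⟨x, v⟩ ω).model =
      ηs • ((A : ℝ)⁻¹ • ∑ i, if i ∈ ω.1 then localDelta (f i) ηl x g (ω.2.2.2 i) else 0) := by
    filter_upwards [ae_coin_zero hv, ae_card_sampled hv le_rfl zero_le_one] with ω h1 h2
    have e : (ω.1.filter fun i => ω.2.1 i = false) = ω.1 :=
      Finset.filter_true_of_mem fun i _ => h1 i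
    rw [roundStep_model, e, h2]
    simp only [h1, and_true, sub_sub_cancel, hg]
  have h1' : MemLp (fun ω : RoundSeed Ξ M b b' K => ηs • ((A : ℝ)⁻¹ • ∑ i,
      if i ∈ ω.1 then localDelta (f i) ηl x g (ω.2.2.2 i) else 0)) 2 (roundLaw D A b b' K 0) :=
    h1.const_smul ηs
  constructor
  · rw [lintegral_congr_ae (g := fun ω : RoundSeed Ξ M b b' K => ‖ηs • ((A : ℝ)⁻¹ • ∑ i,
        if i ∈ ω.1 then localDelta (f i) ηl x g (ω.2.2.2 i) else 0)‖ₑ ^ 2)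
      (by filter_upwards [hae] with ω hω; rw [hω]), lintegral_enorm_sq h1']
    refine ENNReal.ofReal_le_ofReal ?_
    simp_rw [norm_smul ηs, mul_pow, Real.norm_eq_abs, sq_abs]
    rw [integral_const_mul]
    calc _ ≤ ηs ^ 2 * ((ηl * K) ^ 2 * (5 / 4) * ‖g‖ ^ 2) :=
          mul_le_mul_of_nonneg_left h2 (by positivity)
      _ = _ := by ring
  · rw [integral_congr_ae (g := fun ω : RoundSeed Ξ M b b' K => ηs * inner ℝ u ((A : ℝ)⁻¹ • ∑ i,
        if i ∈ ω.1 then localDelta (f i) ηl x g (ω.2.2.2 i) else 0))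
      (by filter_upwards [hae] with ω hω; rw [hω, inner_smul_right]), integral_const_mul]
    calc _ = ηs * (ηl * K * (inner ℝ u g - 0.127 * (‖u‖ * ‖g‖))) := by ring
      _ ≤ _ := mul_le_mul_of_nonneg_left h3 hηs

/-- The bullseye is thus frozen during mining, which lets a period act as one long step. The null
set does not depend on `s`, so a random state may be inserted; the same holds for
`anchor_round_model`. -/
theorem miner_round_cache (hv : ValidSizes D A b b') (ηs ηl : ℝ) (f : Fin M → Vec d → Ξ → ℝ) :
    ∀ᵐ ω ∂(roundLaw D A b b' K 0), ∀ s : State d M, (roundStep f ηs ηl s ω).cache = s.cache := by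
  filter_upwards [ae_coin_zero hv] with ω hω s
  funext i
  simp [roundStep, hω i]

theorem anchor_round_model (hv : ValidSizes D A b b') (ηs ηl : ℝ) (f : Fin M → Vec d → Ξ → ℝ) :
    ∀ᵐ ω ∂(roundLaw D A b b' K 1), ∀ s : State d M, (roundStep f ηs ηl s ω).model = s.model := by
  filter_upwards [ae_coin_one hv] with ω hω s
  rw [roundStep_model]
  simp [hω]

end Miner

/-! ### A round of anchoring -/

section SampledRefresh

variable {M A : ℕ} {E : Type*} [NormedAddCommGroup E] [InnerProductSpace ℝ E]

/-- The second moment of the sum of the vectors of a random set of clients. -/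
theorem integral_sq_norm_sub_sampled (hA0 : 1 ≤ A) (hA : A ≤ M) (a : E) (u : Fin M → E) (κ : ℝ) :
    ∫ S, (‖a - (M : ℝ)⁻¹ • ∑ i ∈ S, u i‖ ^ 2 + κ * S.card)
        ∂(uniformOn {s : Finset (Fin M) | s.card = A}) =
      ‖a‖ ^ 2 - 2 * (A / M) * inner ℝ a ((M : ℝ)⁻¹ • ∑ i, u i) +
        A * (A - 1) / (M * (M - 1)) * ‖(M : ℝ)⁻¹ • ∑ i, u i‖ ^ 2 +
        (A / M - A * (A - 1) / (M * (M - 1))) / M * ((M : ℝ)⁻¹ * ∑ i, ‖u i‖ ^ 2) + κ * A := by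
  have := isProbabilityMeasure_uniformOn_card hA
  have hM1 : (M : ℝ) ≠ 0 := by
    have : 0 < M := by omega
    positivity
  set U := uniformOn {s : Finset (Fin M) | s.card = A} with hU
  have hfin : ∀ φ : Finset (Fin M) → ℝ, Integrable φ U := fun φ => Integrable.of_finite
  -- Expansion in indicators of single clients and of pairs, so that only their inclusion
  -- probabilities enter. The term with `κ` carries the batch noise, proportional to the number of
  -- refreshed entries.
  have e : ∀ S : Finset (Fin M), ‖a - (M : ℝ)⁻¹ • ∑ i ∈ S, u i‖ ^ 2 + κ * S.card =
      ‖a‖ ^ 2 + ((∑ i, (if i ∈ S then (1 : ℝ) else 0) * (-(2 * (M : ℝ)⁻¹) * inner ℝ a (u i) + κ)) +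
        ∑ i, ∑ j, (if i ∈ S ∧ j ∈ S then (1 : ℝ) else 0) *
          (((M : ℝ)⁻¹) ^ 2 * inner ℝ (u i) (u j))) := by
    intro S
    have e1 : ∑ i, (if i ∈ S then (1 : ℝ) else 0) * (-(2 * (M : ℝ)⁻¹) * inner ℝ a (u i) + κ) =
        -(2 * (M : ℝ)⁻¹) * inner ℝ a (∑ i ∈ S, u i) + κ * S.card := by
      simp_rw [ite_mul, one_mul, zero_mul]
      rw [← Finset.sum_filter, inner_sum, Finset.mul_sum]
      simp [Finset.sum_add_distrib, mul_comm]
    have e2 : ∑ i, ∑ j, (if i ∈ S ∧ j ∈ S then (1 : ℝ) else 0) *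
        (((M : ℝ)⁻¹) ^ 2 * inner ℝ (u i) (u j)) = ((M : ℝ)⁻¹) ^ 2 * ‖∑ i ∈ S, u i‖ ^ 2 := by
      have e3 : ∀ i, ∑ j, (if i ∈ S ∧ j ∈ S then (1 : ℝ) else 0) *
          (((M : ℝ)⁻¹) ^ 2 * inner ℝ (u i) (u j)) =
          if i ∈ S then ∑ j ∈ S, ((M : ℝ)⁻¹) ^ 2 * inner ℝ (u i) (u j) else 0 := by
        intro i
        by_cases hi : i ∈ S
        · simp only [hi, true_and, ite_mul, one_mul, zero_mul, if_true]
          rw [← Finset.sum_filter]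
          simp
        · simp [hi]
      simp_rw [e3]
      rw [← Finset.sum_filter, ← real_inner_self_eq_norm_sq, sum_inner, Finset.mul_sum]
      simp_rw [inner_sum, Finset.mul_sum]
      simp
    rw [e1, e2, norm_sub_sq_real, norm_smul, inner_smul_right, mul_pow, Real.norm_eq_abs, sq_abs]
    ring
  have hP : ∀ i j : Fin M, ∫ S, (if i ∈ S ∧ j ∈ S then (1 : ℝ) else 0) ∂U =
      A * (A - 1) / (M * (M - 1)) + if i = j then
        ((A : ℝ) / M - A * (A - 1) / (M * (M - 1))) else 0 := by
    intro i j
    split_ifs with h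
    · subst h
      simp only [and_self]
      rw [integral_uniformOn_mem hA0 hA]
      ring
    · rw [integral_uniformOn_mem_mem hA0 hA h, add_zero]
  have hsum1 : ∫ S, (∑ i, (if i ∈ S then (1 : ℝ) else 0) *
      (-(2 * (M : ℝ)⁻¹) * inner ℝ a (u i) + κ)) ∂U =
      A / M * ∑ i, (-(2 * (M : ℝ)⁻¹) * inner ℝ a (u i) + κ) := by
    rw [integral_finsetSum _ fun _ _ => hfin _, Finset.mul_sum]
    refine Finset.sum_congr rfl fun i _ => ?_
    rw [integral_mul_const, integral_uniformOn_mem hA0 hA]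
  have hsum2 : ∫ S, (∑ i, ∑ j, (if i ∈ S ∧ j ∈ S then (1 : ℝ) else 0) *
      (((M : ℝ)⁻¹) ^ 2 * inner ℝ (u i) (u j))) ∂U =
      ∑ i, ∑ j, (A * (A - 1) / (M * (M - 1)) + if i = j then
        ((A : ℝ) / M - A * (A - 1) / (M * (M - 1))) else 0) *
          (((M : ℝ)⁻¹) ^ 2 * inner ℝ (u i) (u j)) := by
    rw [integral_finsetSum _ fun _ _ => hfin _]
    refine Finset.sum_congr rfl fun i _ => ?_
    rw [integral_finsetSum _ fun _ _ => hfin _]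
    refine Finset.sum_congr rfl fun j _ => ?_
    rw [integral_mul_const, hP]
  have hsum3 : ∑ i, ∑ j, (A * (A - 1) / (M * (M - 1)) + if i = j then
        ((A : ℝ) / M - A * (A - 1) / (M * (M - 1))) else 0) *
          (((M : ℝ)⁻¹) ^ 2 * inner ℝ (u i) (u j)) =
      A * (A - 1) / (M * (M - 1)) * (((M : ℝ)⁻¹) ^ 2 * ‖∑ i, u i‖ ^ 2) +
        ((A : ℝ) / M - A * (A - 1) / (M * (M - 1))) * (((M : ℝ)⁻¹) ^ 2 * ∑ i, ‖u i‖ ^ 2) := by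
    simp only [add_mul, ite_mul, zero_mul, Finset.sum_add_distrib, Finset.sum_ite_eq,
      Finset.mem_univ, if_true, real_inner_self_eq_norm_sq]
    simp_rw [← Finset.mul_sum]
    rw [← real_inner_self_eq_norm_sq (∑ i, u i), sum_inner]
    simp_rw [inner_sum]
  simp_rw [e]
  rw [integral_add (hfin _) (hfin _), integral_add (hfin _) (hfin _), hsum1, hsum2, hsum3,
    Finset.sum_add_distrib, ← Finset.mul_sum, ← inner_sum]
  simp only [integral_const, probReal_univ, smul_eq_mul, one_mul, Finset.sum_const,
    Finset.card_univ, Fintype.card_fin, nsmul_eq_mul]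
  rw [norm_smul, inner_smul_right, mul_pow, Real.norm_eq_abs, sq_abs]
  have h1 : (A : ℝ) / M * (M * κ) = κ * A := by field_simp
  rw [mul_add, h1]
  ring

variable [CompleteSpace E] [MeasurableSpace E] [BorelSpace E] [SecondCountableTopology E]
  {G : Fin M → Type*} [∀ i, MeasurableSpace (G i)] {ν : ∀ i, Measure (G i)}
  [∀ i, IsProbabilityMeasure (ν i)] {X : ∀ i, G i → E} {y : Fin M → E} {c : ℝ}

/-- Refreshing the entries of a random set of clients by unbiased estimates: moments of the new
entries. -/
theorem moments_refresh_entry (hA0 : 1 ≤ A) (hA : A ≤ M) (hX : ∀ i, Measurable (X i))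
    (hm : ∀ i, MemLp (X i) 2 (ν i)) (h0 : ∀ i, ∫ z, X i z ∂ν i = y i)
    (hc : ∀ i, ∫ z, ‖X i z - y i‖ ^ 2 ∂ν i ≤ c) (w : E) (v : Fin M → E) (i : Fin M) :
    MemLp (fun p : Finset (Fin M) × (∀ i, G i) => if i ∈ p.1 then X i (p.2 i) else v i) 2
        ((uniformOn {s : Finset (Fin M) | s.card = A}).prod (Measure.pi ν)) ∧
      ∫ p : Finset (Fin M) × (∀ i, G i), ‖(if i ∈ p.1 then X i (p.2 i) else v i) - y i‖ ^ 2
          ∂((uniformOn {s : Finset (Fin M) | s.card = A}).prod (Measure.pi ν)) ≤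
        A / M * c + (1 - A / M) * ‖v i - y i‖ ^ 2 ∧
      ∫ p : Finset (Fin M) × (∀ i, G i), inner ℝ w (if i ∈ p.1 then X i (p.2 i) else v i)
          ∂((uniformOn {s : Finset (Fin M) | s.card = A}).prod (Measure.pi ν)) =
        A / M * inner ℝ w (y i) + (1 - A / M) * inner ℝ w (v i) := by
  have := isProbabilityMeasure_uniformOn_card hA
  have hm' : MemLp (fun z : ∀ i, G i => X i (z i)) 2 (Measure.pi ν) :=
    (hm i).comp_measurePreserving (measurePreserving_eval ν i)
  have hd : MemLp (fun z : ∀ i, G i => X i (z i) - y i) 2 (Measure.pi ν) :=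
    hm'.sub (memLp_const (y i))
  have hmeas : Measurable fun p : Finset (Fin M) × (∀ i, G i) =>
      if i ∈ p.1 then X i (p.2 i) else v i :=
    measurable_mem_indicator ((hX i).comp (measurable_pi_apply i)) measurable_const
  have e1 : ∀ p : Finset (Fin M) × (∀ i, G i), ‖(if i ∈ p.1 then X i (p.2 i) else v i) - y i‖ ^ 2 =
      if i ∈ p.1 then ‖X i (p.2 i) - y i‖ ^ 2 else ‖v i - y i‖ ^ 2 := fun p => by
    split_ifs <;> rfl
  have e2 : ∀ p : Finset (Fin M) × (∀ i, G i), inner ℝ w (if i ∈ p.1 then X i (p.2 i) else v i) =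
      if i ∈ p.1 then inner ℝ w (X i (p.2 i)) else inner ℝ w (v i) := fun p => by
    split_ifs <;> rfl
  obtain ⟨i1, i2⟩ := integral_mem_ite (ν := Measure.pi ν) hA0 hA i
    (hd.integrable_norm_pow two_ne_zero) (‖v i - y i‖ ^ 2)
  obtain ⟨j1, j2⟩ := integral_mem_ite (ν := Measure.pi ν) hA0 hA i
    ((hm'.integrable (by norm_num)).const_inner w) (inner ℝ w (v i))
  refine ⟨?_, ?_, ?_⟩
  · have h1 := memLp_two_of_integrable_sq_norm (hmeas.sub_const (y i)).aestronglyMeasurable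
      (i1.congr (Filter.Eventually.of_forall fun p => (e1 p).symm))
    refine (h1.add (memLp_const (y i))).ae_eq (Filter.Eventually.of_forall fun p => ?_)
    simp
  · simp_rw [e1]
    refine i2.trans_le ?_
    have h3 : ∫ z : ∀ i, G i, ‖X i (z i) - y i‖ ^ 2 ∂Measure.pi ν = ∫ z, ‖X i z - y i‖ ^ 2 ∂ν i :=
      integral_comp_eval (f := fun z => ‖X i z - y i‖ ^ 2)
        (((hm i).sub (memLp_const (y i))).integrable_norm_pow two_ne_zero).1
    rw [h3]
    have := mul_le_mul_of_nonneg_left (hc i) (by positivity : 0 ≤ (A : ℝ) / M)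
    linarith
  · simp_rw [e2]
    refine j2.trans ?_
    have h3 : ∫ z : ∀ i, G i, inner ℝ w (X i (z i)) ∂Measure.pi ν = inner ℝ w (y i) := by
      rw [← h0 i, ← integral_inner ((hm i).integrable (by norm_num))]
      exact integral_comp_eval (f := fun z => inner ℝ w (X i z))
        (((hm i).integrable (by norm_num)).const_inner w).1
    rw [h3]

/-- The average of the entries after a refresh. -/
theorem moments_refresh_average (hA0 : 1 ≤ A) (hA : A ≤ M) (hX : ∀ i, Measurable (X i))
    (hm : ∀ i, MemLp (X i) 2 (ν i)) (h0 : ∀ i, ∫ z, X i z ∂ν i = y i)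
    (hc : ∀ i, ∫ z, ‖X i z - y i‖ ^ 2 ∂ν i ≤ c) (w : E) (v : Fin M → E) :
    MemLp (fun p : Finset (Fin M) × (∀ i, G i) =>
        (M : ℝ)⁻¹ • ∑ i, if i ∈ p.1 then X i (p.2 i) else v i) 2
        ((uniformOn {s : Finset (Fin M) | s.card = A}).prod (Measure.pi ν)) ∧
      ∫ p : Finset (Fin M) × (∀ i, G i),
          ‖(M : ℝ)⁻¹ • ∑ i, if i ∈ p.1 then X i (p.2 i) else v i‖ ^ 2
          ∂((uniformOn {s : Finset (Fin M) | s.card = A}).prod (Measure.pi ν)) ≤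
        ‖(M : ℝ)⁻¹ • ∑ i, v i‖ ^ 2 - 2 * (A / M) *
            inner ℝ ((M : ℝ)⁻¹ • ∑ i, v i) ((M : ℝ)⁻¹ • ∑ i, (v i - y i)) +
          A * (A - 1) / (M * (M - 1)) * ‖(M : ℝ)⁻¹ • ∑ i, (v i - y i)‖ ^ 2 +
          (A / M - A * (A - 1) / (M * (M - 1))) / M * ((M : ℝ)⁻¹ * ∑ i, ‖v i - y i‖ ^ 2) +
          A / M * (c / M) ∧
      ∫ p : Finset (Fin M) × (∀ i, G i),
          inner ℝ w ((M : ℝ)⁻¹ • ∑ i, if i ∈ p.1 then X i (p.2 i) else v i)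
          ∂((uniformOn {s : Finset (Fin M) | s.card = A}).prod (Measure.pi ν)) =
        A / M * inner ℝ w ((M : ℝ)⁻¹ • ∑ i, y i) +
          (1 - A / M) * inner ℝ w ((M : ℝ)⁻¹ • ∑ i, v i) := by
  have := isProbabilityMeasure_uniformOn_card hA
  have hM1 : (M : ℝ) ≠ 0 := by
    have : 0 < M := by omega
    positivity
  have hen := moments_refresh_entry hA0 hA hX hm h0 hc w v
  have hmem : MemLp (fun p : Finset (Fin M) × (∀ i, G i) =>
      (M : ℝ)⁻¹ • ∑ i, if i ∈ p.1 then X i (p.2 i) else v i) 2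
      ((uniformOn {s : Finset (Fin M) | s.card = A}).prod (Measure.pi ν)) :=
    (memLp_finsetSum _ fun i _ => (hen i).1).const_smul _
  refine ⟨hmem, ?_, ?_⟩
  · rw [integral_prod _ (hmem.integrable_norm_pow two_ne_zero)]
    set a := (M : ℝ)⁻¹ • ∑ i, v i with ha
    -- For a fixed set `S`, the new average is the old one, corrected on `S` by the exact errors,
    -- plus a sum of independent centred noises; these add at most `c |S| / M²` to the second
    -- moment.
    have hin : ∀ S : Finset (Fin M), ∫ z : ∀ i, G i,
        ‖(M : ℝ)⁻¹ • ∑ i, if i ∈ S then X i (z i) else v i‖ ^ 2 ∂Measure.pi ν ≤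
        ‖a - (M : ℝ)⁻¹ • ∑ i ∈ S, (v i - y i)‖ ^ 2 + ((M : ℝ)⁻¹ ^ 2 * c) * S.card := by
      intro S
      obtain ⟨k1, k2, k3⟩ := integral_sq_norm_sum_le (μ := ν) (X := fun i z => X i z - y i)
        (fun i => (hX i).sub_const (y i)) (fun i => (hm i).sub (memLp_const (y i)))
        (fun i => by
          rw [integral_sub ((hm i).integrable (by norm_num)) (integrable_const _), h0]; simp) S
      have e : ∀ z : ∀ i, G i, (M : ℝ)⁻¹ • ∑ i, (if i ∈ S then X i (z i) else v i) =
          (a - (M : ℝ)⁻¹ • ∑ i ∈ S, (v i - y i)) + (M : ℝ)⁻¹ • ∑ i ∈ S, (X i (z i) - y i) := by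
        intro z
        rw [ha, ← smul_sub, ← smul_add]
        congr 1
        have e3 : ∀ w : Fin M → E, ∑ i ∈ S, w i = ∑ i, if i ∈ S then w i else 0 := fun w => by
          rw [← Finset.sum_filter]; simp
        rw [e3, e3, ← Finset.sum_sub_distrib, ← Finset.sum_add_distrib]
        refine Finset.sum_congr rfl fun i _ => ?_
        split_ifs <;> abel
      have k1' : MemLp (fun z : ∀ i, G i => (M : ℝ)⁻¹ • ∑ i ∈ S, (X i (z i) - y i)) 2
          (Measure.pi ν) := k1.const_smul _
      have k2' : ∫ z : ∀ i, G i, (M : ℝ)⁻¹ • ∑ i ∈ S, (X i (z i) - y i) ∂Measure.pi ν = 0 := by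
        rw [integral_smul, k2, smul_zero]
      simp_rw [e]
      rw [integral_sq_norm_const_add k1' _ 0 k2', add_zero]
      refine add_le_add le_rfl ?_
      simp_rw [sub_zero, norm_smul, mul_pow, Real.norm_eq_abs, sq_abs]
      rw [integral_const_mul, mul_assoc]
      refine mul_le_mul_of_nonneg_left (k3.trans ?_) (by positivity)
      refine (Finset.sum_le_sum fun i _ => hc i).trans (le_of_eq ?_)
      simp [mul_comm]
    have hle := integral_mono (μ := uniformOn {s : Finset (Fin M) | s.card = A})
      Integrable.of_finite Integrable.of_finite hin
    rw [integral_sq_norm_sub_sampled hA0 hA] at hle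
    refine hle.trans (le_of_eq ?_)
    field_simp
  · simp_rw [inner_smul_right, inner_sum]
    rw [integral_const_mul, integral_finsetSum _ fun i _ =>
      ((hen i).1.integrable (by norm_num)).const_inner w]
    simp_rw [(hen _).2.2]
    rw [Finset.sum_add_distrib, ← Finset.mul_sum, ← Finset.mul_sum]
    ring

end SampledRefresh

/-! ### One round of the algorithm -/

/-- Refreshing the entries of a random set of clients, for randomness on an arbitrary space. -/
theorem moments_refresh_law {M A : ℕ} {E : Type*} [NormedAddCommGroup E] [InnerProductSpace ℝ E]
    [CompleteSpace E] [MeasurableSpace E] [BorelSpace E] [SecondCountableTopology E]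
    {G : Fin M → Type*} [∀ i, MeasurableSpace (G i)] {ν : ∀ i, Measure (G i)}
    [∀ i, IsProbabilityMeasure (ν i)] {X : ∀ i, G i → E} {y : Fin M → E} {c : ℝ}
    {Ω : Type*} [MeasurableSpace Ω] {P : Measure Ω} [IsProbabilityMeasure P]
    {S : Ω → Finset (Fin M)} {z : Ω → ∀ i, G i} (hA0 : 1 ≤ A) (hA : A ≤ M)
    (hmp : MeasurePreserving (fun ω => (S ω, z ω)) P
      ((uniformOn {s : Finset (Fin M) | s.card = A}).prod (Measure.pi ν)))
    (hX : ∀ i, Measurable (X i)) (hm : ∀ i, MemLp (X i) 2 (ν i)) (h0 : ∀ i, ∫ z, X i z ∂ν i = y i)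
    (hc : ∀ i, ∫ z, ‖X i z - y i‖ ^ 2 ∂ν i ≤ c) (w : E) (v : Fin M → E) :
    (∀ i, ∫⁻ ω, ‖(if i ∈ S ω then X i (z ω i) else v i) - y i‖ₑ ^ 2 ∂P ≤
      ENNReal.ofReal (A / M * c + (1 - A / M) * ‖v i - y i‖ ^ 2)) ∧
    ∫⁻ ω, ‖(M : ℝ)⁻¹ • ∑ i, if i ∈ S ω then X i (z ω i) else v i‖ₑ ^ 2 ∂P ≤
      ENNReal.ofReal (‖(M : ℝ)⁻¹ • ∑ i, v i‖ ^ 2 - 2 * (A / M) *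
            inner ℝ ((M : ℝ)⁻¹ • ∑ i, v i) ((M : ℝ)⁻¹ • ∑ i, (v i - y i)) +
          A * (A - 1) / (M * (M - 1)) * ‖(M : ℝ)⁻¹ • ∑ i, (v i - y i)‖ ^ 2 +
          (A / M - A * (A - 1) / (M * (M - 1))) / M * ((M : ℝ)⁻¹ * ∑ i, ‖v i - y i‖ ^ 2) +
          A / M * (c / M)) ∧
    0 ≤ ‖(M : ℝ)⁻¹ • ∑ i, v i‖ ^ 2 - 2 * (A / M) *
            inner ℝ ((M : ℝ)⁻¹ • ∑ i, v i) ((M : ℝ)⁻¹ • ∑ i, (v i - y i)) +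
          A * (A - 1) / (M * (M - 1)) * ‖(M : ℝ)⁻¹ • ∑ i, (v i - y i)‖ ^ 2 +
          (A / M - A * (A - 1) / (M * (M - 1))) / M * ((M : ℝ)⁻¹ * ∑ i, ‖v i - y i‖ ^ 2) +
          A / M * (c / M) ∧
    ∫ ω, inner ℝ w ((M : ℝ)⁻¹ • ∑ i, if i ∈ S ω then X i (z ω i) else v i) ∂P =
      A / M * inner ℝ w ((M : ℝ)⁻¹ • ∑ i, y i) +
        (1 - A / M) * inner ℝ w ((M : ℝ)⁻¹ • ∑ i, v i) := by
  have := isProbabilityMeasure_uniformOn_card hA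
  have hen := moments_refresh_entry hA0 hA hX hm h0 hc w v
  have hav := moments_refresh_average hA0 hA hX hm h0 hc w v
  obtain ⟨Ψ, hΨ⟩ : ∃ Ψ : Finset (Fin M) × (∀ i, G i) → E, ∀ p,
      (M : ℝ)⁻¹ • ∑ i, (if i ∈ p.1 then X i (p.2 i) else v i) = Ψ p := ⟨_, fun _ => rfl⟩
  obtain ⟨Z, hZ⟩ : ∃ Z : Fin M → Finset (Fin M) × (∀ i, G i) → E, ∀ i p,
      (if i ∈ p.1 then X i (p.2 i) else v i) = Z i p := ⟨_, fun _ _ => rfl⟩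
  have e : ∀ ω, (M : ℝ)⁻¹ • ∑ i, (if i ∈ S ω then X i (z ω i) else v i) = Ψ (S ω, z ω) :=
    fun ω => hΨ (S ω, z ω)
  have e' : ∀ i ω, (if i ∈ S ω then X i (z ω i) else v i) = Z i (S ω, z ω) :=
    fun i ω => hZ i (S ω, z ω)
  simp only [hΨ] at hav
  simp only [hZ] at hen
  obtain ⟨a1, a2, a3⟩ := hav
  refine ⟨fun i => ?_, ?_, (integral_nonneg fun _ => by positivity).trans a2, ?_⟩
  · obtain ⟨b1, b2, -⟩ := hen i
    simp only [e']
    have b3 : MemLp (fun p => Z i p - y i) 2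
        ((uniformOn {s : Finset (Fin M) | s.card = A}).prod (Measure.pi ν)) :=
      b1.sub (memLp_const (y i))
    have h2 : MemLp (fun ω => Z i (S ω, z ω) - y i) 2 P := b3.comp_measurePreserving hmp
    rw [lintegral_enorm_sq h2]
    refine ENNReal.ofReal_le_ofReal (le_trans (le_of_eq ?_) b2)
    exact integral_comp_measurePreserving hmp (φ := fun p => ‖Z i p - y i‖ ^ 2)
      (b3.integrable_norm_pow two_ne_zero).1
  · simp only [e]
    have h2 : MemLp (fun ω => Ψ (S ω, z ω)) 2 P := a1.comp_measurePreserving hmp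
    rw [lintegral_enorm_sq h2]
    refine ENNReal.ofReal_le_ofReal (le_trans (le_of_eq ?_) a2)
    exact integral_comp_measurePreserving hmp (φ := fun p => ‖Ψ p‖ ^ 2)
      (a1.integrable_norm_pow two_ne_zero).1
  · simp only [e]
    refine Eq.trans ?_ a3
    exact integral_comp_measurePreserving hmp (φ := fun p => inner ℝ w (Ψ p))
      ((a1.integrable (by norm_num)).const_inner w).1

/-- Everything that the analysis uses about the data, the losses and the parameters: `gr i` is the
gradient of the objective of client `i`, and `c` bounds the variance of the large batches. -/
structure RoundModel {Ξ : Type*} [MeasurableSpace Ξ] {d M : ℕ} (D : Fin M → LocalData Ξ)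
    (f : Fin M → Vec d → Ξ → ℝ) (A b b' K : ℕ) (gr : Fin M → Vec d → Vec d)
    (L V ηs ηl c : ℝ) : Prop where
  sizes : ValidSizes D A b b'
  steps : SmallStep L V ηl K
  nonneg : 0 ≤ ηs
  small : ∀ i, GradOracle (f i) ((D i).batchLaw b') (gr i) L V
  large_measurable : ∀ i, Measurable fun p : Vec d × (Fin b → Ξ) => batchGrad (f i) p.1 p.2
  large_memLp : ∀ i v, MemLp (fun B => batchGrad (f i) v B) 2 ((D i).batchLaw b)
  large_mean : ∀ i v, ∫ B, batchGrad (f i) v B ∂(D i).batchLaw b = gr i v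
  large_noise : ∀ i v, ∫ B, ‖batchGrad (f i) v B - gr i v‖ ^ 2 ∂(D i).batchLaw b ≤ c

section Run

variable {Ξ : Type*} [MeasurableSpace Ξ] {d M A b b' K : ℕ} {D : Fin M → LocalData Ξ}
  {f : Fin M → Vec d → Ξ → ℝ} {gr : Fin M → Vec d → Vec d} {L V ηs ηl c : ℝ}

theorem RoundModel.one_le_M (H : RoundModel D f A b b' K gr L V ηs ηl c) : 1 ≤ M :=
  H.sizes.one_le.trans H.sizes.le

theorem RoundModel.c_nonneg (H : RoundModel D f A b b' K gr L V ηs ηl c) : 0 ≤ c :=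
  (integral_nonneg fun _ => by positivity).trans (H.large_noise ⟨0, H.one_le_M⟩ 0)

/-- The gradient of the global objective. -/
def meanField (gr : Fin M → Vec d → Vec d) (x : Vec d) : Vec d := (M : ℝ)⁻¹ • ∑ i, gr i x

/-- The mean squared error of the caching gradients. -/
def cacheError (gr : Fin M → Vec d → Vec d) (x : Vec d) (v : Fin M → Vec d) : ℝ :=
  (M : ℝ)⁻¹ * ∑ i, ‖v i - gr i x‖ ^ 2

/-- The bound for the second moment of the bullseye after an anchor round. -/
def anchorBound (A : ℕ) (gr : Fin M → Vec d → Vec d) (c : ℝ) (x : Vec d) (v : Fin M → Vec d) : ℝ :=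
  ‖(State.mk x v).bullseye‖ ^ 2 - 2 * (A / M) *
      inner ℝ (State.mk x v).bullseye ((State.mk x v).bullseye - meanField gr x) +
    A * (A - 1) / (M * (M - 1)) * ‖(State.mk x v).bullseye - meanField gr x‖ ^ 2 +
    (A / M - A * (A - 1) / (M * (M - 1))) / M * cacheError gr x v + A / M * (c / M)

theorem bullseye_sub_meanField (gr : Fin M → Vec d → Vec d) (x : Vec d) (v : Fin M → Vec d) :
    (State.mk x v).bullseye - meanField gr x = (M : ℝ)⁻¹ • ∑ i, (v i - gr i x) := by
  rw [State.bullseye, meanField, ← smul_sub, Finset.sum_sub_distrib]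

/-- Almost surely every sampled client is an anchor, so the round is a refresh of a uniformly random
set of caches with unbiased estimates. Nonnegativity of the bound is recorded because it is
integrated later as an extended nonnegative bound. -/
theorem RoundModel.moments_anchor_round (H : RoundModel D f A b b' K gr L V ηs ηl c) (w x : Vec d)
    (v : Fin M → Vec d) :
    (∀ i, ∫⁻ ω : RoundSeed Ξ M b b' K, ‖(roundStep f ηs ηl ⟨x, v⟩ ω).cache i - gr i x‖ₑ ^ 2
        ∂(roundLaw D A b b' K 1) ≤
      ENNReal.ofReal (A / M * c + (1 - A / M) * ‖v i - gr i x‖ ^ 2)) ∧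
    ∫⁻ ω : RoundSeed Ξ M b b' K, ‖(roundStep f ηs ηl ⟨x, v⟩ ω).bullseye‖ₑ ^ 2
        ∂(roundLaw D A b b' K 1) ≤ ENNReal.ofReal (anchorBound A gr c x v) ∧
    0 ≤ anchorBound A gr c x v ∧
    ∫ ω : RoundSeed Ξ M b b' K, inner ℝ w (roundStep f ηs ηl ⟨x, v⟩ ω).bullseye
        ∂(roundLaw D A b b' K 1) =
      A / M * inner ℝ w (meanField gr x) + (1 - A / M) * inner ℝ w (State.mk x v).bullseye := by
  have := fun m => (D m).isProbabilityMeasure_batchLaw (H.sizes.large m)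
  obtain ⟨X, hXd⟩ : ∃ X : Fin M → (Fin b → Ξ) → Vec d, X = fun i B => batchGrad (f i) x B :=
    ⟨_, rfl⟩
  have hX : ∀ i, Measurable (X i) := fun i => by
    rw [hXd]
    exact measurable_comp_pair (f := fun v (B : Fin b → Ξ) => batchGrad (f i) v B)
      (H.large_measurable i) measurable_const measurable_id
  have hX2 : ∀ i, MemLp (X i) 2 ((D i).batchLaw b) := fun i => by
    rw [hXd]; exact H.large_memLp i x
  have hX3 : ∀ i, ∫ B, X i B ∂(D i).batchLaw b = gr i x := fun i => by
    rw [hXd]; exact H.large_mean i x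
  have hX4 : ∀ i, ∫ B, ‖X i B - gr i x‖ ^ 2 ∂(D i).batchLaw b ≤ c := fun i => by
    rw [hXd]; exact H.large_noise i x
  have hae : ∀ᵐ ω ∂(roundLaw D A b b' K 1), ∀ i, (roundStep f ηs ηl ⟨x, v⟩ ω).cache i =
      if i ∈ ω.1 then X i (ω.2.2.1 i) else v i := by
    filter_upwards [ae_coin_one H.sizes] with ω hω i
    simp [roundStep, hω i, hXd]
  clear hXd
  have := isProbabilityMeasure_roundLaw (K := K) H.sizes zero_le_one le_rfl
  obtain ⟨r1, r2, r3, r4⟩ := moments_refresh_law H.sizes.one_le H.sizes.le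
    (measurePreserving_sampled_large (K := K) H.sizes zero_le_one le_rfl) hX hX2 hX3 hX4 w v
  have e : ∀ᵐ ω ∂(roundLaw D A b b' K 1), (roundStep f ηs ηl ⟨x, v⟩ ω).bullseye =
      (M : ℝ)⁻¹ • ∑ i, if i ∈ ω.1 then X i (ω.2.2.1 i) else v i := by
    filter_upwards [hae] with ω hω
    simp only [State.bullseye, hω]
  rw [anchorBound, bullseye_sub_meanField]
  refine ⟨fun i => ?_, ?_, r3, ?_⟩
  · refine (lintegral_congr_ae ?_).trans_le (r1 i)
    filter_upwards [hae] with ω hω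
    rw [hω i]
  · refine (lintegral_congr_ae ?_).trans_le r2
    filter_upwards [e] with ω hω
    rw [hω]
  · refine (integral_congr_ae ?_).trans r4
    filter_upwards [e] with ω hω
    rw [hω]

/-! ### Runs of the algorithm -/

theorem RoundModel.measurable_run (H : RoundModel D f A b b' K gr L V ηs ηl c) (x₀ : Vec d)
    (t : ℕ) :
    Measurable fun ω : Seed Ξ M b b' K =>
      ((run f ηs ηl x₀ ω t).model, (run f ηs ηl x₀ ω t).cache) := by
  induction t with
  | zero =>
    refine measurable_const.prodMk (measurable_pi_lambda _ fun i => ?_)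
    exact measurable_comp_pair (f := fun v (B : Fin b → Ξ) => batchGrad (f i) v B)
      (H.large_measurable i) measurable_const ((measurable_pi_apply i).comp measurable_fst)
  | succ t ih =>
    have h1 : Measurable fun ω : Seed Ξ M b b' K =>
        (((run f ηs ηl x₀ ω t).model, (run f ηs ηl x₀ ω t).cache), ω.2 t) :=
      ih.prodMk ((measurable_pi_apply t).comp measurable_snd)
    exact ((measurable_roundStep_model (fun i => (H.small i).measurable) ηs ηl).comp h1).prodMk
      ((measurable_roundStep_cache H.large_measurable ηs ηl).comp h1)

omit [MeasurableSpace Ξ] in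
-- A state involves only the seeds of earlier rounds, so it is independent of the seed of the
-- present one.
theorem dependsOn_run (f : Fin M → Vec d → Ξ → ℝ) (ηs ηl : ℝ) (x₀ : Vec d)
    (a : Fin M → Fin b → Ξ) {s t : ℕ} (hst : s ≤ t) :
    DependsOn (fun ω : ℕ → RoundSeed Ξ M b b' K => run f ηs ηl x₀ (a, ω) s) (Finset.range t) := by
  intro ω ω' h
  induction s with
  | zero => rfl
  | succ s ih =>
    have h1 := ih (by omega)
    have h2 : ω s = ω' s := h s (by simpa using hst)
    simp only at h1
    simp only [run, h1, h2]

variable {p : ℕ → ℝ}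

theorem isProbabilityMeasure_seedLaw (hv : ValidSizes D A b b')
    (h0 : ∀ t, 0 ≤ p t) (h1 : ∀ t, p t ≤ 1) :
    IsProbabilityMeasure (seedLaw D A b b' K p) := by
  have := fun m => (D m).isProbabilityMeasure_batchLaw (hv.large m)
  have := fun t => isProbabilityMeasure_roundLaw (K := K) hv (h0 t) (h1 t)
  unfold seedLaw
  infer_instance

theorem map_seedLaw (hv : ValidSizes D A b b') (h0 : ∀ t, 0 ≤ p t) (h1 : ∀ t, p t ≤ 1)
    {F : Type*} [MeasurableSpace F] {X : Seed Ξ M b b' K → F} (hX : Measurable X) {t : ℕ}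
    (hd : ∀ a, DependsOn (fun ω => X (a, ω)) (Finset.range t)) :
    (seedLaw D A b b' K p).map (fun ω => (X ω, ω.2 t)) =
      ((seedLaw D A b b' K p).map X).prod (roundLaw D A b b' K (p t)) := by
  have := fun m => (D m).isProbabilityMeasure_batchLaw (hv.large m)
  have := fun t => isProbabilityMeasure_roundLaw (K := K) hv (h0 t) (h1 t)
  exact map_prod_prod_infinitePi _ _ hX hd (by simp)

theorem ae_seedLaw (hv : ValidSizes D A b b') (h0 : ∀ t, 0 ≤ p t) (h1 : ∀ t, p t ≤ 1) (t : ℕ)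
    {q : RoundSeed Ξ M b b' K → Prop} (hq : ∀ᵐ y ∂(roundLaw D A b b' K (p t)), q y) :
    ∀ᵐ ω ∂(seedLaw D A b b' K p), q (ω.2 t) := by
  have := fun m => (D m).isProbabilityMeasure_batchLaw (hv.large m)
  have := fun t => isProbabilityMeasure_roundLaw (K := K) hv (h0 t) (h1 t)
  have hmp : MeasurePreserving (fun ω : Seed Ξ M b b' K => ω.2 t) (seedLaw D A b b' K p)
      (roundLaw D A b b' K (p t)) := by
    refine ⟨(measurable_pi_apply t).comp measurable_snd, ?_⟩
    have h2 : (seedLaw D A b b' K p).map (fun ω => ω.2) =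
        Measure.infinitePi fun t => roundLaw D A b b' K (p t) := measurePreserving_snd.map_eq
    have h3 := Measure.infinitePi_map_eval (fun t => roundLaw D A b b' K (p t)) t
    rw [← h2, Measure.map_map (measurable_pi_apply t) measurable_snd] at h3
    exact h3
  exact hmp.quasiMeasurePreserving.ae hq

end Run

section Expectations

variable {Ξ : Type*} [MeasurableSpace Ξ] {d M A b b' K : ℕ} {D : Fin M → LocalData Ξ}
  {f : Fin M → Vec d → Ξ → ℝ} {gr : Fin M → Vec d → Vec d} {L V ηs ηl c : ℝ} {p : ℕ → ℝ}

/-! ### One round in expectation -/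

theorem RoundModel.continuous_gr (H : RoundModel D f A b b' K gr L V ηs ηl c) (i : Fin M) :
    Continuous (gr i) := by
  have h : LipschitzWith L.toNNReal (gr i) :=
    LipschitzWith.of_dist_le_mul fun x y => by
      rw [dist_eq_norm, dist_eq_norm, Real.coe_toNNReal _ H.steps.L_nonneg]
      exact (H.small i).lipschitz x y
  exact h.continuous

theorem RoundModel.continuous_meanField (H : RoundModel D f A b b' K gr L V ηs ηl c) :
    Continuous (meanField gr) := by
  have h : Continuous fun x => ∑ i, gr i x := continuous_finsetSum _ fun i _ => H.continuous_gr i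
  exact h.const_smul (M : ℝ)⁻¹

theorem RoundModel.memLp_gr (H : RoundModel D f A b b' K gr L V ηs ηl c) {Ω : Type*}
    [MeasurableSpace Ω] {P : Measure Ω} [IsFiniteMeasure P] {X : Ω → Vec d} (hX : MemLp X 2 P)
    (i : Fin M) : MemLp (fun ω => gr i (X ω)) 2 P := by
  have h1 : MemLp (fun ω => ‖gr i 0‖ + L * ‖X ω‖) 2 P :=
    (memLp_const ‖gr i 0‖).add (hX.norm.const_mul L)
  refine h1.of_le ((H.continuous_gr i).comp_aestronglyMeasurable hX.1)
    (Filter.Eventually.of_forall fun ω => ?_)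
  have h2 := (H.small i).lipschitz (X ω) 0
  have h3 := norm_le_norm_add_norm_sub' (gr i (X ω)) (gr i 0)
  rw [sub_zero] at h2
  exact (h3.trans (by linarith)).trans (le_abs_self _)

theorem RoundModel.memLp_meanField (H : RoundModel D f A b b' K gr L V ηs ηl c) {Ω : Type*}
    [MeasurableSpace Ω] {P : Measure Ω} [IsFiniteMeasure P] {X : Ω → Vec d} (hX : MemLp X 2 P) :
    MemLp (fun ω => meanField gr (X ω)) 2 P :=
  (memLp_finsetSum _ fun i _ => H.memLp_gr hX i).const_smul (M : ℝ)⁻¹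

theorem memLp_bullseye {Ω : Type*} [MeasurableSpace Ω] {P : Measure Ω} {S : Ω → State d M}
    (hS : ∀ i, MemLp (fun ω => (S ω).cache i) 2 P) : MemLp (fun ω => (S ω).bullseye) 2 P :=
  (memLp_finsetSum _ fun i _ => hS i).const_smul (M : ℝ)⁻¹

theorem RoundModel.integrable_cacheError (H : RoundModel D f A b b' K gr L V ηs ηl c) {Ω : Type*}
    [MeasurableSpace Ω] {P : Measure Ω} [IsFiniteMeasure P] {X : Ω → Vec d} (hX : MemLp X 2 P)
    {v : Ω → Fin M → Vec d} (hv : ∀ i, MemLp (fun ω => v ω i) 2 P) :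
    Integrable (fun ω => cacheError gr (X ω) (v ω)) P := by
  unfold cacheError
  refine Integrable.const_mul (integrable_finsetSum _ fun i _ => ?_) _
  exact ((hv i).sub (H.memLp_gr hX i)).integrable_norm_pow two_ne_zero

/-- The test vector `W` may be any square integrable vector determined before the round; the
gradient at an earlier model will be used, which keeps one test vector for a whole stretch of
mining. -/
theorem RoundModel.miner_step (H : RoundModel D f A b b' K gr L V ηs ηl c)
    (h0 : ∀ t, 0 ≤ p t) (h1 : ∀ t, p t ≤ 1) {x₀ : Vec d} {t : ℕ} (ht : p t = 0)
    (hv : MemLp (fun ω => (run f ηs ηl x₀ ω t).bullseye) 2 (seedLaw D A b b' K p))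
    {W : Seed Ξ M b b' K → Vec d} (hW : Measurable W)
    (hWd : ∀ a, DependsOn (fun ω => W (a, ω)) (Finset.range t))
    (hW2 : MemLp W 2 (seedLaw D A b b' K p)) :
    MemLp (fun ω => (run f ηs ηl x₀ ω t).model - (run f ηs ηl x₀ ω (t + 1)).model) 2
        (seedLaw D A b b' K p) ∧
      ∫ ω, ‖(run f ηs ηl x₀ ω t).model - (run f ηs ηl x₀ ω (t + 1)).model‖ ^ 2
          ∂(seedLaw D A b b' K p) ≤
        (ηs * ηl * K) ^ 2 * (5 / 4) *
          ∫ ω, ‖(run f ηs ηl x₀ ω t).bullseye‖ ^ 2 ∂(seedLaw D A b b' K p) ∧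
      ηs * ηl * K * (∫ ω, inner ℝ (W ω) (run f ηs ηl x₀ ω t).bullseye ∂(seedLaw D A b b' K p) -
          0.127 * ∫ ω, ‖W ω‖ * ‖(run f ηs ηl x₀ ω t).bullseye‖ ∂(seedLaw D A b b' K p)) ≤
        ∫ ω, inner ℝ (W ω) ((run f ηs ηl x₀ ω t).model - (run f ηs ηl x₀ ω (t + 1)).model)
          ∂(seedLaw D A b b' K p) := by
  have := isProbabilityMeasure_seedLaw (K := K) H.sizes h0 h1
  have := isProbabilityMeasure_roundLaw (K := K) H.sizes le_rfl zero_le_one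
  have hX : Measurable fun ω : Seed Ξ M b b' K =>
      (W ω, ((run f ηs ηl x₀ ω t).model, (run f ηs ηl x₀ ω t).cache)) :=
    hW.prodMk (H.measurable_run x₀ t)
  have hY : Measurable fun ω : Seed Ξ M b b' K => ω.2 t :=
    (measurable_pi_apply t).comp measurable_snd
  have hlaw := map_seedLaw (p := p) H.sizes h0 h1 hX (t := t) fun a ω ω' h => by
    have h2 := dependsOn_run f ηs ηl x₀ a (le_refl t) h
    have h3 := hWd a h
    simp only at h2 h3
    simp only [h2, h3]
  rw [ht] at hlaw
  have hm := moments_miner_round H.sizes H.steps H.small H.nonneg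
  have hRm := measurable_roundStep_model (b := b) (K := K) (fun i => (H.small i).measurable) ηs ηl
  obtain ⟨R, hR⟩ : ∃ R : Vec d → (Fin M → Vec d) → RoundSeed Ξ M b b' K → Vec d,
      ∀ x v y, (roundStep f ηs ηl ⟨x, v⟩ y).model = R x v y := ⟨_, fun _ _ _ => rfl⟩
  obtain ⟨g, hg⟩ : ∃ g : (Fin M → Vec d) → Vec d, ∀ x v, (State.mk x v).bullseye = g v :=
    ⟨fun v => (M : ℝ)⁻¹ • ∑ m, v m, fun _ _ => rfl⟩
  have e1 : ∀ ω : Seed Ξ M b b' K, (run f ηs ηl x₀ ω (t + 1)).model =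
      R (run f ηs ηl x₀ ω t).model (run f ηs ηl x₀ ω t).cache (ω.2 t) := fun ω => hR _ _ _
  have e2 : ∀ ω : Seed Ξ M b b' K, (run f ηs ηl x₀ ω t).bullseye =
      g (run f ηs ηl x₀ ω t).cache := fun ω => hg _ _
  obtain ⟨x, hx⟩ : ∃ x : Seed Ξ M b b' K → Vec d, ∀ ω, (run f ηs ηl x₀ ω t).model = x ω :=
    ⟨_, fun _ => rfl⟩
  obtain ⟨v, hv'⟩ : ∃ v : Seed Ξ M b b' K → Fin M → Vec d, ∀ ω, (run f ηs ηl x₀ ω t).cache = v ω :=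
    ⟨_, fun _ => rfl⟩
  simp only [hR, hg] at hm hRm
  simp only [hx, hv'] at e1 e2 hX hlaw
  simp only [e2] at hv
  simp only [e1, e2, hx]
  clear e1 e2 hx hv' hR hg
  have hφ : Measurable fun q : (Vec d × (Vec d × (Fin M → Vec d))) × RoundSeed Ξ M b b' K =>
      q.1.2.1 - R q.1.2.1 q.1.2.2 q.2 := by
    have h5 : Measurable fun q : (Vec d × (Vec d × (Fin M → Vec d))) × RoundSeed Ξ M b b' K =>
      (q.1.2, q.2) := by fun_prop
    exact (by fun_prop : Measurable fun q : (Vec d × (Vec d × (Fin M → Vec d))) ×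
      RoundSeed Ξ M b b' K => q.1.2.1).sub (hRm.comp h5)
  have hcX := hv.integrable_norm_pow two_ne_zero
  obtain ⟨c1, c2⟩ := integral_sq_norm_le_of_indep hX hY hlaw
    (φ := fun e y => e.2.1 - R e.2.1 e.2.2 y) hφ
    (c := fun e => (ηs * ηl * K) ^ 2 * (5 / 4) * ‖g e.2.2‖ ^ 2)
    (fun e => by positivity) (hcX.const_mul _) fun e => (hm 0 e.2.1 e.2.2).1
  have hin := MemLp.integrable_inner_two hW2 hv
  have hnn : Integrable (fun ω => ‖W ω‖ * ‖g (v ω)‖)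
      (seedLaw D A b b' K p) := hW2.norm.integrable_mul hv.norm
  have c3 := le_integral_of_indep hX hY hlaw
    (φ := fun e y => inner ℝ e.1 (e.2.1 - R e.2.1 e.2.2 y))
    ((measurable_fst.comp measurable_fst).inner hφ) (MemLp.integrable_inner_two hW2 c1)
    (c := fun e => ηs * ηl * K * (inner ℝ e.1 (g e.2.2) - 0.127 * (‖e.1‖ * ‖g e.2.2‖)))
    ((hin.sub (hnn.const_mul _)).const_mul _) fun e => (hm e.1 e.2.1 e.2.2).2
  refine ⟨c1, c2.trans_eq (integral_const_mul _ _), le_trans (le_of_eq ?_) c3⟩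
  rw [integral_const_mul, integral_sub hin (hnn.const_mul _), integral_const_mul]

/-- The conditional moments of a refresh are integrated over the state before it. Cache errors
before and after are both measured at the model of round `t`, which an anchor round does not move.
-/
theorem RoundModel.anchor_step (H : RoundModel D f A b b' K gr L V ηs ηl c)
    (h0 : ∀ t, 0 ≤ p t) (h1 : ∀ t, p t ≤ 1) {x₀ : Vec d} {t : ℕ} (ht : p t = 1)
    (hx : MemLp (fun ω => (run f ηs ηl x₀ ω t).model) 2 (seedLaw D A b b' K p))
    (hv : ∀ i, MemLp (fun ω => (run f ηs ηl x₀ ω t).cache i) 2 (seedLaw D A b b' K p)) :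
    (∀ i, MemLp (fun ω => (run f ηs ηl x₀ ω (t + 1)).cache i) 2 (seedLaw D A b b' K p)) ∧
      ∫ ω, cacheError gr (run f ηs ηl x₀ ω t).model (run f ηs ηl x₀ ω (t + 1)).cache
          ∂(seedLaw D A b b' K p) ≤ A / M * c + (1 - A / M) *
        ∫ ω, cacheError gr (run f ηs ηl x₀ ω t).model (run f ηs ηl x₀ ω t).cache
          ∂(seedLaw D A b b' K p) ∧
      ∫ ω, ‖(run f ηs ηl x₀ ω (t + 1)).bullseye‖ ^ 2 ∂(seedLaw D A b b' K p) ≤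
        ∫ ω, anchorBound A gr c (run f ηs ηl x₀ ω t).model (run f ηs ηl x₀ ω t).cache
          ∂(seedLaw D A b b' K p) ∧
      A / M * ∫ ω, ‖meanField gr (run f ηs ηl x₀ ω t).model‖ ^ 2 ∂(seedLaw D A b b' K p) +
        (1 - A / M) * ∫ ω, inner ℝ (meanField gr (run f ηs ηl x₀ ω t).model)
          (run f ηs ηl x₀ ω t).bullseye ∂(seedLaw D A b b' K p) ≤
      ∫ ω, inner ℝ (meanField gr (run f ηs ηl x₀ ω t).model)
          (run f ηs ηl x₀ ω (t + 1)).bullseye ∂(seedLaw D A b b' K p) := by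
  have := isProbabilityMeasure_seedLaw (K := K) H.sizes h0 h1
  have := isProbabilityMeasure_roundLaw (K := K) H.sizes zero_le_one le_rfl
  have hM1 : (M : ℝ) ≠ 0 := by
    have := H.one_le_M
    positivity
  have hX := H.measurable_run (K := K) x₀ t
  have hY : Measurable fun ω : Seed Ξ M b b' K => ω.2 t :=
    (measurable_pi_apply t).comp measurable_snd
  have hlaw := map_seedLaw (p := p) H.sizes h0 h1 hX (t := t) fun a ω ω' h => by
    have h2 := dependsOn_run f ηs ηl x₀ a (le_refl t) h
    simp only at h2
    simp only [h2]
  rw [ht] at hlaw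
  have hm := H.moments_anchor_round
  have hcm := measurable_roundStep_cache (K := K) (b' := b') H.large_measurable ηs ηl
  obtain ⟨R, hR⟩ : ∃ R : Vec d → (Fin M → Vec d) → RoundSeed Ξ M b b' K → Fin M → Vec d,
      ∀ x v y, (roundStep f ηs ηl ⟨x, v⟩ y).cache = R x v y := ⟨_, fun _ _ _ => rfl⟩
  obtain ⟨g, hg⟩ : ∃ g : (Fin M → Vec d) → Vec d, ∀ v, (M : ℝ)⁻¹ • ∑ m, v m = g v :=
    ⟨_, fun _ => rfl⟩
  have hgm : Measurable g := by
    have := (measurable_bullseye (d := d) (M := M)).comp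
      (measurable_prodMk_left (x := (0 : Vec d)))
    simpa only [State.bullseye, Function.comp_def, hg] using this
  have hgL : MemLp (fun ω => g (run f ηs ηl x₀ ω t).cache) 2 (seedLaw D A b b' K p) := by
    simpa only [State.bullseye, hg] using memLp_bullseye hv
  have e1 : ∀ ω : Seed Ξ M b b' K, (run f ηs ηl x₀ ω (t + 1)).cache =
      R (run f ηs ηl x₀ ω t).model (run f ηs ηl x₀ ω t).cache (ω.2 t) := fun ω => hR _ _ _
  have hgi := fun i => H.memLp_gr hx i
  have hmf := H.memLp_meanField hx
  have hce := H.integrable_cacheError hx hv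
  obtain ⟨x, hx'⟩ : ∃ x : Seed Ξ M b b' K → Vec d, ∀ ω, (run f ηs ηl x₀ ω t).model = x ω :=
    ⟨_, fun _ => rfl⟩
  obtain ⟨v, hv'⟩ : ∃ v : Seed Ξ M b b' K → Fin M → Vec d, ∀ ω, (run f ηs ηl x₀ ω t).cache = v ω :=
    ⟨_, fun _ => rfl⟩
  simp only [State.bullseye, hR, hg] at hm hcm
  simp only [hx', hv'] at e1 hX hlaw hv hgL hgi hmf hce
  simp only [State.bullseye, hg, e1, hx', hv']
  have hr : 0 ≤ 1 - (A : ℝ) / M := by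
    rw [sub_nonneg, div_le_one (by have := H.one_le_M; positivity)]
    exact_mod_cast H.sizes.le
  have key : ∀ i, MemLp (fun ω => R (x ω) (v ω) (ω.2 t) i - gr i (x ω)) 2
        (seedLaw D A b b' K p) ∧
      ∫ ω, ‖R (x ω) (v ω) (ω.2 t) i - gr i (x ω)‖ ^ 2 ∂(seedLaw D A b b' K p) ≤
        A / M * c + (1 - A / M) * ∫ ω, ‖v ω i - gr i (x ω)‖ ^ 2 ∂(seedLaw D A b b' K p) := by
    intro i
    have hi : Integrable (fun ω => ‖v ω i - gr i (x ω)‖ ^ 2) (seedLaw D A b b' K p) :=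
      ((hv i).sub (hgi i)).integrable_norm_pow two_ne_zero
    have hφ : Measurable fun q : (Vec d × (Fin M → Vec d)) × RoundSeed Ξ M b b' K =>
        R q.1.1 q.1.2 q.2 i - gr i q.1.1 :=
      ((measurable_pi_apply i).comp hcm).sub
        ((H.continuous_gr i).measurable.comp (measurable_fst.comp measurable_fst))
    obtain ⟨c1, c2⟩ := integral_sq_norm_le_of_indep hX hY hlaw
      (φ := fun e y => R e.1 e.2 y i - gr i e.1) hφ
      (c := fun e => A / M * c + (1 - A / M) * ‖e.2 i - gr i e.1‖ ^ 2)
      (fun e => add_nonneg (mul_nonneg (by positivity) H.c_nonneg)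
        (mul_nonneg hr (by positivity)))
      ((integrable_const _).add (hi.const_mul _)) fun e => (hm 0 e.1 e.2).1 i
    refine ⟨c1, c2.trans_eq ?_⟩
    have e3 := integral_const_mul (μ := seedLaw D A b b' K p) (1 - (A : ℝ) / M)
      fun ω => ‖v ω i - gr i (x ω)‖ ^ 2
    rw [integral_add (integrable_const _) (hi.const_mul _), e3]
    simp only [integral_const, probReal_univ, one_smul]
  have hR2 : ∀ i, MemLp (fun ω => R (x ω) (v ω) (ω.2 t) i) 2 (seedLaw D A b b' K p) := fun i =>
    ((key i).1.add (hgi i)).ae_eq (Filter.Eventually.of_forall fun ω => by simp)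
  have hRg : MemLp (fun ω => g (R (x ω) (v ω) (ω.2 t))) 2 (seedLaw D A b b' K p) := by
    simp only [← hg]
    exact (memLp_finsetSum _ fun i _ => hR2 i).const_smul (M : ℝ)⁻¹
  have hbull : Measurable fun q : (Vec d × (Fin M → Vec d)) × RoundSeed Ξ M b b' K =>
        g (R q.1.1 q.1.2 q.2) := hgm.comp hcm
  have hin := MemLp.integrable_inner_two hmf hgL
  have hmi := hmf.integrable_norm_pow two_ne_zero
  refine ⟨hR2, ?_, ?_, ?_⟩
  · unfold cacheError
    have hi1 := fun i => (key i).1.integrable_norm_pow two_ne_zero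
    have hi2 : ∀ i, Integrable (fun ω => ‖v ω i - gr i (x ω)‖ ^ 2) (seedLaw D A b b' K p) :=
      fun i => ((hv i).sub (hgi i)).integrable_norm_pow two_ne_zero
    rw [integral_const_mul, integral_const_mul, integral_finsetSum _ fun i _ => hi1 i,
      integral_finsetSum _ fun i _ => hi2 i]
    calc _ ≤ (M : ℝ)⁻¹ * ∑ i : Fin M, (A / M * c + (1 - A / M) *
          ∫ ω, ‖v ω i - gr i (x ω)‖ ^ 2 ∂(seedLaw D A b b' K p)) := by
          gcongr with i
          exact (key i).2
      _ = _ := by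
          rw [Finset.sum_add_distrib, Finset.sum_const, ← Finset.mul_sum]
          simp only [Finset.card_univ, Fintype.card_fin, nsmul_eq_mul]
          field_simp
  · have hab : Integrable (fun ω => anchorBound A gr c (x ω) (v ω)) (seedLaw D A b b' K p) := by
      simp only [anchorBound, State.bullseye, hg]
      have i0 : MemLp (fun ω => g (v ω) - meanField gr (x ω)) 2 (seedLaw D A b b' K p) :=
        hgL.sub hmf
      have i1 := hgL.integrable_norm_pow two_ne_zero
      have i2 := MemLp.integrable_inner_two hgL i0
      have i3 := i0.integrable_norm_pow two_ne_zero
      exact (((i1.sub (i2.const_mul _)).add (i3.const_mul _)).add (hce.const_mul _)).add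
        (integrable_const _)
    exact (integral_sq_norm_le_of_indep hX hY hlaw
      (φ := fun e y => g (R e.1 e.2 y)) hbull
      (c := fun e => anchorBound A gr c e.1 e.2) (fun e => (hm 0 e.1 e.2).2.2.1) hab
      fun e => (hm 0 e.1 e.2).2.1).2
  · have hc3 : Integrable (fun ω => A / M * ‖meanField gr (x ω)‖ ^ 2 +
        (1 - A / M) * inner ℝ (meanField gr (x ω)) (g (v ω))) (seedLaw D A b b' K p) :=
      (hmi.const_mul _).add (hin.const_mul _)
    have c3 := le_integral_of_indep hX hY hlaw
      (φ := fun e y => inner ℝ (meanField gr e.1) (g (R e.1 e.2 y)))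
      ((H.continuous_meanField.measurable.comp (measurable_fst.comp measurable_fst)).inner hbull)
      (MemLp.integrable_inner_two hmf hRg)
      (c := fun e => A / M * ‖meanField gr e.1‖ ^ 2 +
        (1 - A / M) * inner ℝ (meanField gr e.1) (g e.2)) hc3
      fun e => by
        rw [(hm (meanField gr e.1) e.1 e.2).2.2.2, real_inner_self_eq_norm_sq]
    refine le_trans (le_of_eq ?_) c3
    rw [← integral_const_mul, ← integral_const_mul, ← integral_add (hmi.const_mul _)
      (hin.const_mul _)]

theorem RoundModel.anchor_step_model (H : RoundModel D f A b b' K gr L V ηs ηl c)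
    (h0 : ∀ t, 0 ≤ p t) (h1 : ∀ t, p t ≤ 1) (x₀ : Vec d) {t : ℕ} (ht : p t = 1) :
    ∀ᵐ ω ∂(seedLaw D A b b' K p),
      (run f ηs ηl x₀ ω (t + 1)).model = (run f ηs ηl x₀ ω t).model := by
  have h2 := anchor_round_model (K := K) H.sizes ηs ηl f
  rw [← ht] at h2
  filter_upwards [ae_seedLaw H.sizes h0 h1 t h2] with ω hω
  exact hω _

theorem RoundModel.miner_step_cache (H : RoundModel D f A b b' K gr L V ηs ηl c)
    (h0 : ∀ t, 0 ≤ p t) (h1 : ∀ t, p t ≤ 1) (x₀ : Vec d) {t : ℕ} (ht : p t = 0) :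
    ∀ᵐ ω ∂(seedLaw D A b b' K p),
      (run f ηs ηl x₀ ω (t + 1)).cache = (run f ηs ηl x₀ ω t).cache := by
  have h2 := miner_round_cache (K := K) H.sizes ηs ηl f
  rw [← ht] at h2
  filter_upwards [ae_seedLaw H.sizes h0 h1 t h2] with ω hω
  exact hω _

/-- All second moments are finite. -/
theorem RoundModel.memLp_run (H : RoundModel D f A b b' K gr L V ηs ηl c)
    (hp : ∀ t, p t = 0 ∨ p t = 1) (x₀ : Vec d) (t : ℕ) :
    MemLp (fun ω => (run f ηs ηl x₀ ω t).model) 2 (seedLaw D A b b' K p) ∧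
      ∀ i, MemLp (fun ω => (run f ηs ηl x₀ ω t).cache i) 2 (seedLaw D A b b' K p) := by
  have h0 : ∀ t, 0 ≤ p t := fun t => by rcases hp t with h | h <;> simp [h]
  have h1 : ∀ t, p t ≤ 1 := fun t => by rcases hp t with h | h <;> simp [h]
  have := isProbabilityMeasure_seedLaw (K := K) H.sizes h0 h1
  have := fun m => (D m).isProbabilityMeasure_batchLaw (H.sizes.large m)
  have := fun t => FedAMD.isProbabilityMeasure_roundLaw (K := K) H.sizes (h0 t) (h1 t)
  induction t with
  | zero =>
    refine ⟨memLp_const x₀, fun i => ?_⟩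
    obtain ⟨X, hX⟩ : ∃ X : (Fin b → Ξ) → Vec d, ∀ B, batchGrad (f i) x₀ B = X B :=
      ⟨_, fun _ => rfl⟩
    have h2 := H.large_memLp i x₀
    simp only [hX] at h2
    have h3 : MemLp (fun a : Fin M → Fin b → Ξ => X (a i)) 2
        (Measure.pi fun m => (D m).batchLaw b) :=
      h2.comp_measurePreserving (measurePreserving_eval _ i)
    have h4 : MemLp (fun ω : Seed Ξ M b b' K => X (ω.1 i)) 2 (seedLaw D A b b' K p) :=
      h3.comp_measurePreserving (measurePreserving_fst)
    simpa only [run, hX] using h4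
  | succ t ih =>
    obtain ⟨hx, hv⟩ := ih
    rcases hp t with ht | ht
    · constructor
      -- The zero test vector is enough: only square integrability of the increment is wanted.
      · have h2 := (H.miner_step h0 h1 ht (memLp_bullseye hv) (W := fun _ => 0) measurable_const
          (fun a ω ω' _ => rfl) (memLp_const 0)).1
        exact (hx.sub h2).ae_eq (Filter.Eventually.of_forall fun ω => by simp)
      · intro i
        refine (hv i).ae_eq ?_
        filter_upwards [H.miner_step_cache h0 h1 x₀ ht] with ω hω
        rw [hω]
    · constructor
      · refine hx.ae_eq ?_
        filter_upwards [H.anchor_step_model h0 h1 x₀ ht] with ω hω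
        rw [hω]
      · exact (H.anchor_step h0 h1 ht hx hv).1

end Expectations

/-! ### Smooth functions -/

section Smooth

variable {d : ℕ}

/-- `F` is bounded below by `m` and has the `L`-Lipschitz gradient `g`. -/
structure SmoothBounded (F : Vec d → ℝ) (g : Vec d → Vec d) (L m : ℝ) : Prop where
  pos : 0 < L
  hasGradientAt : ∀ x, HasGradientAt F (g x) x
  lipschitz : ∀ x y, ‖g x - g y‖ ≤ L * ‖x - y‖
  le : ∀ x, m ≤ F x

variable {F : Vec d → ℝ} {g : Vec d → Vec d} {L m : ℝ}

theorem SmoothBounded.continuous (h : SmoothBounded F g L m) : Continuous F :=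
  continuous_iff_continuousAt.2 fun x => (h.hasGradientAt x).hasFDerivAt.continuousAt

/-- The descent lemma. -/
theorem SmoothBounded.le_add (h : SmoothBounded F g L m) (x u : Vec d) :
    F (x + u) ≤ F x + inner ℝ (g x) u + L / 2 * ‖u‖ ^ 2 := by
  have hd : ∀ t : ℝ, HasDerivAt (fun t : ℝ => F (x + t • u) - t * inner ℝ (g x) u -
      L / 2 * ‖u‖ ^ 2 * t ^ 2) (inner ℝ (g (x + t • u)) u - inner ℝ (g x) u - L * ‖u‖ ^ 2 * t) t := by
    intro t
    have h1 : HasDerivAt (fun t : ℝ => x + t • u) u t := by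
      simpa using ((hasDerivAt_id t).smul_const u).const_add x
    have h2 := (h.hasGradientAt (x + t • u)).hasFDerivAt.comp_hasDerivAt t h1
    have h3 := ((h2.sub ((hasDerivAt_id t).mul_const (inner ℝ (g x) u))).sub
      (((hasDerivAt_id t).pow 2).const_mul (L / 2 * ‖u‖ ^ 2)))
    refine (h3.congr_deriv ?_).congr_of_eventuallyEq (Filter.Eventually.of_forall fun t => ?_)
    · simp
      ring
    · simp
  -- The Lipschitz bound makes the derivative nonpositive; the lemma compares the values at `0` and
  -- `1`.
  have hanti : AntitoneOn (fun t : ℝ => F (x + t • u) - t * inner ℝ (g x) u -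
      L / 2 * ‖u‖ ^ 2 * t ^ 2) (Set.Icc 0 1) := by
    refine antitoneOn_of_deriv_nonpos (convex_Icc 0 1)
      (fun t _ => (hd t).continuousAt.continuousWithinAt)
      (fun t _ => (hd t).differentiableAt.differentiableWithinAt) fun t ht => ?_
    rw [interior_Icc] at ht
    rw [(hd t).deriv, ← inner_sub_left]
    have h1 := real_inner_le_norm (g (x + t • u) - g x) u
    have h2 := h.lipschitz (x + t • u) x
    rw [add_sub_cancel_left, norm_smul, Real.norm_of_nonneg ht.1.le] at h2
    have h3 := mul_le_mul_of_nonneg_right h2 (norm_nonneg u)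
    nlinarith
  have := hanti (Set.left_mem_Icc.2 zero_le_one) (Set.right_mem_Icc.2 zero_le_one) zero_le_one
  simp at this
  linarith

/-- A gradient step of length `1 / L` lowers `F` by at least `‖g x‖² / (2 L)` and cannot go below
`m`. -/
theorem SmoothBounded.sq_norm_le (h : SmoothBounded F g L m) (x : Vec d) :
    ‖g x‖ ^ 2 / (2 * L) ≤ F x - m := by
  have h1 := h.le_add x (-(L⁻¹ • g x))
  have h2 := h.le (x + -(L⁻¹ • g x))
  have hL := h.pos
  rw [inner_neg_right, inner_smul_right, real_inner_self_eq_norm_sq, norm_neg, norm_smul, mul_pow,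
    Real.norm_of_nonneg (by positivity)] at h1
  have e : ‖g x‖ ^ 2 / (2 * L) = L⁻¹ * ‖g x‖ ^ 2 - L / 2 * (L⁻¹ ^ 2 * ‖g x‖ ^ 2) := by
    field_simp
    ring
  linarith

/-- `F` lies between the constant `m` and a quadratic polynomial in the norm, so square
integrability of the model suffices. -/
theorem SmoothBounded.integrable (h : SmoothBounded F g L m) {Ω : Type*} [MeasurableSpace Ω]
    {P : Measure Ω} [IsFiniteMeasure P] {X : Ω → Vec d} (hX : MemLp X 2 P) :
    Integrable (fun ω => F (X ω)) P := by
  have h1 : Integrable (fun ω => |m| + |F 0| + ‖g 0‖ * ‖X ω‖ + L / 2 * ‖X ω‖ ^ 2) P :=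
    ((integrable_const (|m| + |F 0|)).add ((hX.integrable (by norm_num)).norm.const_mul ‖g 0‖)).add
      ((hX.integrable_norm_pow two_ne_zero).const_mul (L / 2))
  refine h1.mono' (h.continuous.comp_aestronglyMeasurable hX.1)
    (Filter.Eventually.of_forall fun ω => ?_)
  have h2 := h.le_add 0 (X ω)
  rw [zero_add] at h2
  have h3 := real_inner_le_norm (g 0) (X ω)
  have h4 := h.le (X ω)
  have hL := h.pos
  have h5 : 0 ≤ ‖g 0‖ * ‖X ω‖ := by positivity
  have h6 : 0 ≤ L / 2 * ‖X ω‖ ^ 2 := by positivity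
  rw [Real.norm_eq_abs, abs_le]
  constructor <;> linarith [neg_abs_le m, le_abs_self (F 0), abs_nonneg m, abs_nonneg (F 0)]

end Smooth

section Period

variable {Ξ : Type*} [MeasurableSpace Ξ] {d M A b b' K : ℕ} {D : Fin M → LocalData Ξ}
  {f : Fin M → Vec d → Ξ → ℝ} {gr : Fin M → Vec d → Vec d} {L V ηs ηl c : ℝ} {p : ℕ → ℝ}

/-! ### A period of the algorithm -/

theorem sq_norm_sub_le {E : Type*} [NormedAddCommGroup E] {k : ℝ} (hk : 0 < k) (x y : E) :
    ‖x - y‖ ^ 2 ≤ (1 + 1 / k) * ‖x‖ ^ 2 + (1 + k) * ‖y‖ ^ 2 := by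
  have h1 := pow_le_pow_left₀ (norm_nonneg _) (norm_sub_le x y) 2
  have h2 : 2 * (‖x‖ * ‖y‖) ≤ 1 / k * ‖x‖ ^ 2 + k * ‖y‖ ^ 2 := by
    have e : 1 / k * ‖x‖ ^ 2 + k * ‖y‖ ^ 2 - 2 * (‖x‖ * ‖y‖) = (‖x‖ - k * ‖y‖) ^ 2 / k := by
      field_simp
      ring
    have : 0 ≤ (‖x‖ - k * ‖y‖) ^ 2 / k := by positivity
    linarith
  linarith

/-- The change of the model over successive rounds of mining. -/
theorem RoundModel.moments_mining (H : RoundModel D f A b b' K gr L V ηs ηl c)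
    (hp : ∀ t, p t = 0 ∨ p t = 1) (x₀ : Vec d) (s k : ℕ) (hk : ∀ j < k, p (s + j) = 0) :
    (∀ᵐ ω ∂(seedLaw D A b b' K p),
      (run f ηs ηl x₀ ω (s + k)).cache = (run f ηs ηl x₀ ω s).cache) ∧
    ∫ ω, inner ℝ (meanField gr (run f ηs ηl x₀ ω s).model)
        ((run f ηs ηl x₀ ω (s + k)).model - (run f ηs ηl x₀ ω s).model)
        ∂(seedLaw D A b b' K p) ≤
      -(ηs * ηl * K * k * (∫ ω, inner ℝ (meanField gr (run f ηs ηl x₀ ω s).model)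
          (run f ηs ηl x₀ ω s).bullseye ∂(seedLaw D A b b' K p) -
        0.127 * ∫ ω, ‖meanField gr (run f ηs ηl x₀ ω s).model‖ *
          ‖(run f ηs ηl x₀ ω s).bullseye‖ ∂(seedLaw D A b b' K p))) ∧
    ∫ ω, ‖(run f ηs ηl x₀ ω (s + k)).model - (run f ηs ηl x₀ ω s).model‖ ^ 2
        ∂(seedLaw D A b b' K p) ≤
      (ηs * ηl * K * k) ^ 2 * (5 / 4) *
        ∫ ω, ‖(run f ηs ηl x₀ ω s).bullseye‖ ^ 2 ∂(seedLaw D A b b' K p) := by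
  have h0 : ∀ t, 0 ≤ p t := fun t => by rcases hp t with h | h <;> simp [h]
  have h1 : ∀ t, p t ≤ 1 := fun t => by rcases hp t with h | h <;> simp [h]
  have := isProbabilityMeasure_seedLaw (K := K) H.sizes h0 h1
  have hx := fun t => (H.memLp_run hp x₀ t).1
  have hh := H.memLp_meanField (hx s)
  induction k with
  | zero => simp
  | succ k ih =>
    obtain ⟨c1, c2, c3⟩ := ih fun j hj => hk j (by omega)
    have hpk := hk k (by omega)
    have hb := memLp_bullseye (H.memLp_run hp x₀ (s + k)).2
    -- The test vector is the gradient at the start of the stretch, not at the current model, and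
    -- the bullseye has not changed since then; hence all rounds contribute the same bound.
    obtain ⟨d1, d2, d3⟩ := H.miner_step h0 h1 hpk hb
      (W := fun ω => meanField gr (run f ηs ηl x₀ ω s).model)
      (H.continuous_meanField.measurable.comp (measurable_fst.comp (H.measurable_run x₀ s)))
      (fun a ω ω' h => by
        have h2 := dependsOn_run f ηs ηl x₀ a (by omega : s ≤ s + k) h
        simp only at h2
        simp only [h2]) hh
    have hbe : ∀ᵐ ω ∂(seedLaw D A b b' K p), (run f ηs ηl x₀ ω (s + k)).bullseye =
        (run f ηs ηl x₀ ω s).bullseye := by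
      filter_upwards [c1] with ω hω
      simp only [State.bullseye, hω]
    rw [integral_congr_ae (f := fun ω => ‖(run f ηs ηl x₀ ω (s + k)).bullseye‖ ^ 2)
      (g := fun ω => ‖(run f ηs ηl x₀ ω s).bullseye‖ ^ 2)
      (by filter_upwards [hbe] with ω hω; rw [hω])] at d2
    rw [integral_congr_ae (g := fun ω => inner ℝ (meanField gr (run f ηs ηl x₀ ω s).model)
        (run f ηs ηl x₀ ω s).bullseye) (by filter_upwards [hbe] with ω hω; rw [hω]),
      integral_congr_ae (f := fun ω => ‖meanField gr (run f ηs ηl x₀ ω s).model‖ *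
        ‖(run f ηs ηl x₀ ω (s + k)).bullseye‖)
        (g := fun ω => ‖meanField gr (run f ηs ηl x₀ ω s).model‖ *
        ‖(run f ηs ηl x₀ ω s).bullseye‖) (by filter_upwards [hbe] with ω hω; rw [hω])] at d3
    rw [← add_assoc]
    have hD : MemLp (fun ω => (run f ηs ηl x₀ ω (s + k)).model - (run f ηs ηl x₀ ω s).model) 2
      (seedLaw D A b b' K p) := (hx (s + k)).sub (hx s)
    have hD' : MemLp (fun ω => (run f ηs ηl x₀ ω (s + k + 1)).model -
        (run f ηs ηl x₀ ω s).model) 2 (seedLaw D A b b' K p) := (hx (s + k + 1)).sub (hx s)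
    have e : ∀ ω : Seed Ξ M b b' K,
        (run f ηs ηl x₀ ω (s + k + 1)).model - (run f ηs ηl x₀ ω s).model =
        ((run f ηs ηl x₀ ω (s + k)).model - (run f ηs ηl x₀ ω s).model) -
          ((run f ηs ηl x₀ ω (s + k)).model - (run f ηs ηl x₀ ω (s + k + 1)).model) :=
      fun ω => by abel
    refine ⟨?_, ?_, ?_⟩
    · filter_upwards [c1, H.miner_step_cache h0 h1 x₀ hpk] with ω h2 h3
      rw [h3, h2]
    · simp only [e, inner_sub_right (meanField gr _) (_ - _) (_ - _)]
      rw [integral_sub (MemLp.integrable_inner_two hh hD) (MemLp.integrable_inner_two hh d1)]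
      push_cast
      linarith
    · push_cast
      -- Young's inequality with weight `k` loses nothing here, as `(1 + 1 / k) k² + (1 + k) = (k +
      -- 1)²`; the first increment is separate because the weight would be zero.
      rcases Nat.eq_zero_or_pos k with rfl | hk0
      · have h2 : ∀ ω : Seed Ξ M b b' K, ‖(run f ηs ηl x₀ ω (s + 0 + 1)).model -
            (run f ηs ηl x₀ ω s).model‖ ^ 2 = ‖(run f ηs ηl x₀ ω (s + 0)).model -
            (run f ηs ηl x₀ ω (s + 0 + 1)).model‖ ^ 2 := fun ω => by
          rw [norm_sub_rev, add_zero]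
        simp only [h2]
        simpa using d2
      · have hk1 : (0 : ℝ) < k := by exact_mod_cast hk0
        have hpt : ∀ ω : Seed Ξ M b b' K, ‖(run f ηs ηl x₀ ω (s + k + 1)).model -
            (run f ηs ηl x₀ ω s).model‖ ^ 2 ≤ (1 + 1 / k) *
              ‖(run f ηs ηl x₀ ω (s + k)).model - (run f ηs ηl x₀ ω s).model‖ ^ 2 +
            (1 + k) * ‖(run f ηs ηl x₀ ω (s + k)).model -
              (run f ηs ηl x₀ ω (s + k + 1)).model‖ ^ 2 := fun ω => by
          rw [e ω]
          exact sq_norm_sub_le hk1 _ _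
        have i1 := hD.integrable_norm_pow two_ne_zero
        have i2 := d1.integrable_norm_pow two_ne_zero
        have h3 := integral_mono (hD'.integrable_norm_pow two_ne_zero)
          ((i1.const_mul (1 + 1 / (k : ℝ))).add (i2.const_mul (1 + (k : ℝ)))) hpt
        simp only [Pi.add_apply] at h3
        rw [integral_add (i1.const_mul _) (i2.const_mul _), integral_const_mul,
          integral_const_mul] at h3
        refine h3.trans ?_
        have hk2 := hk1.ne'
        calc _ ≤ (1 + 1 / (k : ℝ)) * ((ηs * ηl * K * k) ^ 2 * (5 / 4) *
                ∫ ω, ‖(run f ηs ηl x₀ ω s).bullseye‖ ^ 2 ∂(seedLaw D A b b' K p)) +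
              (1 + (k : ℝ)) * ((ηs * ηl * K) ^ 2 * (5 / 4) *
                ∫ ω, ‖(run f ηs ηl x₀ ω s).bullseye‖ ^ 2 ∂(seedLaw D A b b' K p)) :=
              add_le_add (mul_le_mul_of_nonneg_left c3 (by positivity))
                (mul_le_mul_of_nonneg_left d2 (by positivity))
          _ = _ := by field_simp; ring

/-! ### Expected quantities of a random state -/

section Quantities

variable {Ω : Type*} [MeasurableSpace Ω]

def meanLoss (F : Vec d → ℝ) (μ : Measure Ω) (S : Ω → State d M) : ℝ := ∫ ω, F (S ω).model ∂μ

def gradSq (gr : Fin M → Vec d → Vec d) (μ : Measure Ω) (S : Ω → State d M) : ℝ :=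
  ∫ ω, ‖meanField gr (S ω).model‖ ^ 2 ∂μ

def alignment (gr : Fin M → Vec d → Vec d) (μ : Measure Ω) (S : Ω → State d M) : ℝ :=
  ∫ ω, inner ℝ (meanField gr (S ω).model) (S ω).bullseye ∂μ

def bullseyeSq (μ : Measure Ω) (S : Ω → State d M) : ℝ := ∫ ω, ‖(S ω).bullseye‖ ^ 2 ∂μ

def meanError (gr : Fin M → Vec d → Vec d) (μ : Measure Ω) (S : Ω → State d M) : ℝ :=
  ∫ ω, cacheError gr (S ω).model (S ω).cache ∂μ

end Quantities

theorem RoundModel.norm_meanField_sub_le (H : RoundModel D f A b b' K gr L V ηs ηl c)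
    (x y : Vec d) : ‖meanField gr x - meanField gr y‖ ≤ L * ‖x - y‖ := by
  have hM : (M : ℝ) ≠ 0 := by
    have := H.one_le_M
    positivity
  rw [meanField, meanField, ← smul_sub, ← Finset.sum_sub_distrib, norm_smul, norm_inv,
    RCLike.norm_natCast]
  calc _ ≤ (M : ℝ)⁻¹ * ∑ _i : Fin M, L * ‖x - y‖ := by
        gcongr
        exact norm_sum_le_of_le _ fun i _ => (H.small i).lipschitz x y
    _ = _ := by
        simp only [Finset.sum_const, Finset.card_univ, Fintype.card_fin, nsmul_eq_mul]
        field_simp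

/-- The effect of successive rounds of mining on the quantities of the analysis. -/
theorem RoundModel.mining_quantities (H : RoundModel D f A b b' K gr L V ηs ηl c)
    (hp : ∀ t, p t = 0 ∨ p t = 1) (x₀ : Vec d) {F : Vec d → ℝ} {m : ℝ}
    (hF : SmoothBounded F (meanField gr) L m) (s k : ℕ) (hk : ∀ j < k, p (s + j) = 0)
    {κ : ℝ} (hκ : ηs * ηl * K * k = κ) (hκ0 : 0 < κ) {θ : ℝ} (hθ : 0 < θ)
    {μ : Measure (Seed Ξ M b b' K)} (hμ : μ = seedLaw D A b b' K p)
    {S : ℕ → Seed Ξ M b b' K → State d M} (hS : S = fun t ω => run f ηs ηl x₀ ω t) :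
    meanLoss F μ (S (s + k)) ≤ meanLoss F μ (S s) - κ * alignment gr μ (S s) +
        κ * (0.127 / 2) * (gradSq gr μ (S s) + bullseyeSq μ (S s)) +
        L / 2 * (κ ^ 2 * (5 / 4) * bullseyeSq μ (S s)) ∧
      alignment gr μ (S s) ≤ alignment gr μ (S (s + k)) + 1.119 * L * κ * bullseyeSq μ (S s) ∧
      bullseyeSq μ (S (s + k)) = bullseyeSq μ (S s) ∧
      meanError gr μ (S (s + k)) ≤ (1 + θ) * meanError gr μ (S s) +
        (1 + 1 / θ) * (L ^ 2 * (κ ^ 2 * (5 / 4) * bullseyeSq μ (S s))) := by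
  have h0 : ∀ t, 0 ≤ p t := fun t => by rcases hp t with h | h <;> simp [h]
  have h1 : ∀ t, p t ≤ 1 := fun t => by rcases hp t with h | h <;> simp [h]
  have hμp : IsProbabilityMeasure μ := by
    rw [hμ]; exact isProbabilityMeasure_seedLaw H.sizes h0 h1
  have hx : ∀ t, MemLp (fun ω => (S t ω).model) 2 μ := fun t => by
    rw [hS, hμ]; exact (H.memLp_run hp x₀ t).1
  have hv : ∀ t i, MemLp (fun ω => (S t ω).cache i) 2 μ := fun t => by
    rw [hS, hμ]; exact (H.memLp_run hp x₀ t).2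
  have hm := H.moments_mining hp x₀ s k hk
  have hS' : ∀ t ω, run f ηs ηl x₀ ω t = S t ω := fun t ω => by rw [hS]
  simp only [hS', ← hμ, hκ] at hm
  clear hS hS' hμ
  obtain ⟨c1, c2, c3⟩ := hm
  have hL := hF.pos
  have hh := fun t => H.memLp_meanField (hx t)
  have hg := fun t => memLp_bullseye (hv t)
  have hce := fun t => H.integrable_cacheError (hx t) (hv t)
  have hbe : ∀ᵐ ω ∂μ, (S (s + k) ω).bullseye = (S s ω).bullseye := by
    filter_upwards [c1] with ω hω
    simp only [State.bullseye, hω]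
  have hD : MemLp (fun ω => (S (s + k) ω).model - (S s ω).model) 2 μ := (hx (s + k)).sub (hx s)
  have hD2 := hD.integrable_norm_pow two_ne_zero
  have hg2 := (hg s).integrable_norm_pow two_ne_zero
  have hh2 := (hh s).integrable_norm_pow two_ne_zero
  have hhD := MemLp.integrable_inner_two (hh s) hD
  have hhg := MemLp.integrable_inner_two (hh s) (hg s)
  have hhg' := MemLp.integrable_inner_two (hh (s + k)) (hg (s + k))
  have hnn : Integrable (fun ω => ‖meanField gr (S s ω).model‖ * ‖(S s ω).bullseye‖) μ :=
    (hh s).norm.integrable_mul (hg s).norm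
  have hFi := fun t => hF.integrable (hx t)
  refine ⟨?_, ?_, ?_, ?_⟩
  -- The descent lemma is applied once, from the start to the end of the whole stretch.
  · have i1 : Integrable (fun ω => F (S s ω).model + inner ℝ (meanField gr (S s ω).model)
        ((S (s + k) ω).model - (S s ω).model)) μ := (hFi s).add hhD
    have h2 := integral_mono (hFi (s + k)) (i1.add (hD2.const_mul (L / 2))) fun ω => by
      have := hF.le_add (S s ω).model ((S (s + k) ω).model - (S s ω).model)
      rwa [add_sub_cancel] at this
    simp only [Pi.add_apply] at h2
    rw [integral_add i1 (hD2.const_mul _), integral_add (hFi s) hhD, integral_const_mul] at h2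
    have h3 := integral_mono hnn ((hh2.add hg2).const_mul (1 / 2)) fun ω => by
      simp only [Pi.add_apply]
      nlinarith [sq_nonneg (‖meanField gr (S s ω).model‖ - ‖(S s ω).bullseye‖)]
    rw [integral_const_mul] at h3
    simp only [Pi.add_apply] at h3
    rw [integral_add hh2 hg2] at h3
    have h4 := mul_le_mul_of_nonneg_left h3 (by positivity : 0 ≤ κ * 0.127)
    have h5 := mul_le_mul_of_nonneg_left c3 (by positivity : 0 ≤ L / 2)
    simp only [meanLoss, alignment, gradSq, bullseyeSq]
    linarith
  -- The gradient drifts by at most `L` times the displacement. Young's inequality with weight `1.12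
  -- κ`, close to the best choice `√(5 / 4) κ`, gives `1.25 / 2.24 + 0.56 < 1.119`.
  · have h2 := integral_mono_ae hhg (hhg'.add ((hD2.const_mul (L / (2 * (1.12 * κ)))).add
      (hg2.const_mul (L * (1.12 * κ) / 2)))) (by
        filter_upwards [hbe] with ω hω
        simp only [Pi.add_apply]
        rw [hω, ← sub_le_iff_le_add', ← inner_sub_left]
        refine (real_inner_le_norm _ _).trans ?_
        have h3 := H.norm_meanField_sub_le (S s ω).model (S (s + k) ω).model
        rw [norm_sub_rev (S s ω).model] at h3
        refine (mul_le_mul_of_nonneg_right h3 (norm_nonneg _)).trans ?_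
        set a := ‖(S (s + k) ω).model - (S s ω).model‖
        set e := ‖(S s ω).bullseye‖
        have e1 : L / (2 * (1.12 * κ)) * a ^ 2 + L * (1.12 * κ) / 2 * e ^ 2 - L * a * e =
            L / (2 * (1.12 * κ)) * (a - 1.12 * κ * e) ^ 2 := by
          field_simp
          ring
        have e2 : 0 ≤ L / (2 * (1.12 * κ)) * (a - 1.12 * κ * e) ^ 2 := by positivity
        linarith)
    have i2 : Integrable (fun ω => L / (2 * (1.12 * κ)) *
        ‖(S (s + k) ω).model - (S s ω).model‖ ^ 2 +
        L * (1.12 * κ) / 2 * ‖(S s ω).bullseye‖ ^ 2) μ :=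
      (hD2.const_mul (L / (2 * (1.12 * κ)))).add (hg2.const_mul (L * (1.12 * κ) / 2))
    simp only [Pi.add_apply] at h2
    rw [integral_add hhg' i2, integral_add (hD2.const_mul _) (hg2.const_mul _),
      integral_const_mul, integral_const_mul] at h2
    have h5 := mul_le_mul_of_nonneg_left c3 (by positivity : 0 ≤ L / (2 * (1.12 * κ)))
    have h6 : 0 ≤ ∫ ω, ‖(S s ω).bullseye‖ ^ 2 ∂μ := integral_nonneg fun _ => by positivity
    have h7 : L / (2 * (1.12 * κ)) * (κ ^ 2 * (5 / 4) * ∫ ω, ‖(S s ω).bullseye‖ ^ 2 ∂μ) =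
        1.25 / 2.24 * (L * κ * ∫ ω, ‖(S s ω).bullseye‖ ^ 2 ∂μ) := by
      field_simp
      ring
    have h8 : 0 ≤ L * κ * ∫ ω, ‖(S s ω).bullseye‖ ^ 2 ∂μ := by positivity
    simp only [alignment, bullseyeSq]
    nlinarith
  · refine integral_congr_ae ?_
    filter_upwards [hbe] with ω hω
    rw [hω]
  · have h2 := integral_mono_ae (hce (s + k)) (((hce s).const_mul (1 + θ)).add
      (hD2.const_mul ((1 + 1 / θ) * L ^ 2))) (by
        filter_upwards [c1] with ω hω
        simp only [Pi.add_apply]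
        rw [cacheError, cacheError, hω]
        have hM : (M : ℝ) ≠ 0 := by
          have := H.one_le_M
          positivity
        calc (M : ℝ)⁻¹ * ∑ i, ‖(S s ω).cache i - gr i (S (s + k) ω).model‖ ^ 2
            ≤ (M : ℝ)⁻¹ * ∑ i, ((1 + θ) * ‖(S s ω).cache i - gr i (S s ω).model‖ ^ 2 +
              (1 + 1 / θ) * (L ^ 2 * ‖(S (s + k) ω).model - (S s ω).model‖ ^ 2)) := by
              gcongr with i
              -- Caches are fixed, so their errors change only through the gradients; the weight
              -- `θ⁻¹` puts the factor `1 + θ` on the old error.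
              have h3 := sq_norm_sub_le (inv_pos.2 hθ) ((S s ω).cache i - gr i (S s ω).model)
                (gr i (S (s + k) ω).model - gr i (S s ω).model)
              rw [sub_sub_sub_cancel_right] at h3
              have h4 := pow_le_pow_left₀ (norm_nonneg _)
                ((H.small i).lipschitz (S (s + k) ω).model (S s ω).model) 2
              rw [mul_pow] at h4
              have h5 := mul_le_mul_of_nonneg_left h4 (by positivity : 0 ≤ 1 + 1 / θ)
              simp only [one_div, inv_inv] at h3 h5 ⊢
              linarith
          _ = _ := by
              rw [Finset.sum_add_distrib, Finset.sum_const, ← Finset.mul_sum]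
              simp only [Finset.card_univ, Fintype.card_fin, nsmul_eq_mul]
              field_simp)
    simp only [Pi.add_apply] at h2
    rw [integral_add ((hce s).const_mul _) (hD2.const_mul _), integral_const_mul,
      integral_const_mul] at h2
    have h5 := mul_le_mul_of_nonneg_left c3 (by positivity : 0 ≤ (1 + 1 / θ) * L ^ 2)
    simp only [meanError, bullseyeSq]
    linarith

/-- The effect of a round of anchoring on the quantities of the analysis. -/
theorem RoundModel.anchor_quantities (H : RoundModel D f A b b' K gr L V ηs ηl c)
    (hp : ∀ t, p t = 0 ∨ p t = 1) (x₀ : Vec d) (F : Vec d → ℝ) {s : ℕ} (hs : p s = 1)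
    {μ : Measure (Seed Ξ M b b' K)} (hμ : μ = seedLaw D A b b' K p)
    {S : ℕ → Seed Ξ M b b' K → State d M} (hS : S = fun t ω => run f ηs ηl x₀ ω t) :
    meanLoss F μ (S (s + 1)) = meanLoss F μ (S s) ∧
      gradSq gr μ (S (s + 1)) = gradSq gr μ (S s) ∧
      A / M * gradSq gr μ (S s) + (1 - A / M) * alignment gr μ (S s) ≤
        alignment gr μ (S (s + 1)) ∧
      bullseyeSq μ (S (s + 1)) ≤ bullseyeSq μ (S s) -
        2 * (A / M) * (bullseyeSq μ (S s) - alignment gr μ (S s)) +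
        A * (A - 1) / (M * (M - 1)) *
          (bullseyeSq μ (S s) - 2 * alignment gr μ (S s) + gradSq gr μ (S s)) +
        (A / M - A * (A - 1) / (M * (M - 1))) / M * meanError gr μ (S s) + A / M * (c / M) ∧
      meanError gr μ (S (s + 1)) ≤ A / M * c + (1 - A / M) * meanError gr μ (S s) := by
  have h0 : ∀ t, 0 ≤ p t := fun t => by rcases hp t with h | h <;> simp [h]
  have h1 : ∀ t, p t ≤ 1 := fun t => by rcases hp t with h | h <;> simp [h]
  have hμp : IsProbabilityMeasure μ := by
    rw [hμ]; exact isProbabilityMeasure_seedLaw H.sizes h0 h1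
  have hx : MemLp (fun ω => (S s ω).model) 2 μ := by
    rw [hS, hμ]; exact (H.memLp_run hp x₀ s).1
  have hv : ∀ i, MemLp (fun ω => (S s ω).cache i) 2 μ := by
    rw [hS, hμ]; exact (H.memLp_run hp x₀ s).2
  have ha := (H.anchor_step h0 h1 hs (H.memLp_run hp x₀ s).1 (H.memLp_run hp x₀ s).2).2
  have hmod := H.anchor_step_model h0 h1 x₀ hs
  have hS' : ∀ t ω, run f ηs ηl x₀ ω t = S t ω := fun t ω => by rw [hS]
  simp only [hS', ← hμ] at ha hmod
  clear hS hS' hμ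
  obtain ⟨a1, a2, a3⟩ := ha
  have hh := H.memLp_meanField hx
  have hg := memLp_bullseye hv
  have hce := H.integrable_cacheError hx hv
  have hg2 := hg.integrable_norm_pow two_ne_zero
  have hh2 := hh.integrable_norm_pow two_ne_zero
  have hhg := MemLp.integrable_inner_two hh hg
  refine ⟨integral_congr_ae ?_, integral_congr_ae ?_, a3.trans_eq (integral_congr_ae ?_), ?_,
    (integral_congr_ae ?_).trans_le a1⟩
  · filter_upwards [hmod] with ω hω
    rw [hω]
  · filter_upwards [hmod] with ω hω
    rw [hω]
  · filter_upwards [hmod] with ω hω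
    rw [hω]
  · refine a2.trans_eq ?_
    -- Expanding the squared bias leaves only the second moments, the alignment and the cache error,
    -- all of them tracked quantities.
    have e : ∀ ω, anchorBound A gr c (S s ω).model (S s ω).cache =
        (1 - 2 * (A / M) + A * (A - 1) / (M * (M - 1))) * ‖(S s ω).bullseye‖ ^ 2 +
        (2 * (A / M) - 2 * (A * (A - 1) / (M * (M - 1)))) *
          inner ℝ (meanField gr (S s ω).model) (S s ω).bullseye +
        A * (A - 1) / (M * (M - 1)) * ‖meanField gr (S s ω).model‖ ^ 2 +
        (A / M - A * (A - 1) / (M * (M - 1))) / M * cacheError gr (S s ω).model (S s ω).cache +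
        A / M * (c / M) := fun ω => by
      rw [anchorBound, norm_sub_sq_real, inner_sub_right, real_inner_self_eq_norm_sq,
        real_inner_comm]
      ring
    simp only [e]
    have i1 := (hg2.const_mul (1 - 2 * ((A : ℝ) / M) + A * (A - 1) / (M * (M - 1)))).add
      (hhg.const_mul (2 * ((A : ℝ) / M) - 2 * (A * (A - 1) / (M * (M - 1)))))
    have i2 := i1.add (hh2.const_mul ((A : ℝ) * (A - 1) / (M * (M - 1))))
    have i3 := i2.add (hce.const_mul (((A : ℝ) / M - A * (A - 1) / (M * (M - 1))) / M))
    simp only [Pi.add_def] at i1 i2 i3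
    rw [integral_add i3 (integrable_const _), integral_add i2 (hce.const_mul _),
      integral_add i1 (hh2.const_mul _), integral_add (hg2.const_mul _) (hhg.const_mul _)]
    simp only [integral_const_mul, integral_const, probReal_univ, one_smul]
    simp only [meanError, bullseyeSq, alignment, gradSq]
    ring
  · filter_upwards [hmod] with ω hω
    rw [hω]

end Period

/-! ### The Lyapunov function -/

/-- Weights of the Lyapunov function. -/
theorem exists_weight {r z : ℝ} (hr0 : 0 < r) (hr1 : r ≤ 1) (hz : 0 ≤ z) (h1 : r * z ≤ 1 - r)
    (h2 : (1 - r) * z ≤ r) :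
    ∃ X : ℝ, 1 / 4 ≤ X ∧
      (1 + 2 * (1 + z) * X) * (0.0635 + 5 / 16 * r) + 1.119 / 2 * (1 - r) +
          (1 - r) * z * (1 + 0.43 * (1 - r)) * X * (r + 10 / 3) * (5 / 16) ≤
        (1 + (1 + z) * (1 - r)) * X ∧
      X * (1 + (1 - r) * (1 + z) * (1 + 0.3 * r) * (1 + 0.43 * (1 - r))) ≤
        0.98 * ((1 + 2 * (1 + z) * X) * (r - 0.0635) + (1 - r) - X * (r - (1 - r) * z)) := by
  -- The first condition is linear in `X`: with these abbreviations it reads `num ≤ den X`. The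
  -- witness is the smallest solution `num / den`, and the second condition is then checked for it.
  obtain ⟨num, hnum⟩ : ∃ num, num = 0.0635 + 5 / 16 * r + 1.119 / 2 * (1 - r) := ⟨_, rfl⟩
  obtain ⟨den, hden⟩ : ∃ den, den = 1 + (1 + z) * (1 - r) - 2 * (1 + z) * (0.0635 + 5 / 16 * r) -
    (1 - r) * z * (1 + 0.43 * (1 - r)) * (r + 10 / 3) * (5 / 16) := ⟨_, rfl⟩
  -- An affine function of `z` is nonnegative on the admissible interval once it is so at both ends.
  -- The upper end is `r / (1 - r)` for `r ≤ 1 / 2` and `(1 - r) / r` for `r ≥ 1 / 2`, so only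
  -- polynomial inequalities in `r` remain.
  have hlin : ∀ p q : ℝ, 0 ≤ p → (r ≤ 1 / 2 → 0 ≤ (1 - r) * p + r * q) →
      (1 / 2 ≤ r → 0 ≤ r * p + (1 - r) * q) → 0 ≤ p + z * q := by
    intro p q hp ha hb
    rcases le_or_gt 0 q with hq | hq
    · positivity
    rcases le_total r (1 / 2) with h | h
    · have h3 := ha h
      have h4 : (1 - r) * z * q ≥ r * q := mul_le_mul_of_nonpos_right h2 hq.le
      by_contra! hneg
      have : (1 - r) * (p + z * q) < 0 := mul_neg_of_pos_of_neg (by linarith) hneg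
      linarith
    · have h3 := hb h
      have h4 : r * z * q ≥ (1 - r) * q := mul_le_mul_of_nonpos_right h1 hq.le
      by_contra! hneg
      have : r * (p + z * q) < 0 := mul_neg_of_pos_of_neg hr0 hneg
      linarith
  have hdpos : 0 < den := by
    have h3 := hlin (1 + (1 - r) - 2 * (0.0635 + 5 / 16 * r) - 0.1)
      ((1 - r) - 2 * (0.0635 + 5 / 16 * r) -
        (1 - r) * (1 + 0.43 * (1 - r)) * (r + 10 / 3) * (5 / 16)) (by linarith)
      (fun h => by
        have h4 := mul_nonneg hr0.le (sub_nonneg.2 h)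
        have h5 := mul_nonneg (sq_nonneg r) (sub_nonneg.2 h)
        nlinarith)
      (fun h => by
        have h4 := mul_nonneg (sub_nonneg.2 h) (sub_nonneg.2 hr1)
        have h5 := mul_nonneg h4 hr0.le
        have h6 := mul_nonneg h5 hr0.le
        nlinarith)
    rw [hden]
    linarith
  -- The second condition multiplied by `den`. It is again affine in `z`, because `den` is affine
  -- and `num` is free of `z`, apart from a factor `1 + z` or a similar affine one.
  have hT : 0 ≤ 0.98 * ((1 - 0.0635) * den + num * ((2 * (1 + z)) * (r - 0.0635) -
      (r - (1 - r) * z))) -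
      num * (1 + (1 - r) * (1 + z) * (1 + 0.3 * r) * (1 + 0.43 * (1 - r))) := by
    rw [hden, hnum]
    refine le_trans (hlin
      (0.98 * ((1 - 0.0635) * (1 + (1 - r) - 2 * (0.0635 + 5 / 16 * r)) +
        (0.0635 + 5 / 16 * r + 1.119 / 2 * (1 - r)) * (2 * (r - 0.0635) - r)) -
        (0.0635 + 5 / 16 * r + 1.119 / 2 * (1 - r)) *
          (1 + (1 - r) * (1 + 0.3 * r) * (1 + 0.43 * (1 - r))))
      (0.98 * ((1 - 0.0635) * ((1 - r) - 2 * (0.0635 + 5 / 16 * r) -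
        (1 - r) * (1 + 0.43 * (1 - r)) * (r + 10 / 3) * (5 / 16)) +
        (0.0635 + 5 / 16 * r + 1.119 / 2 * (1 - r)) * (2 * (r - 0.0635) + (1 - r))) -
        (0.0635 + 5 / 16 * r + 1.119 / 2 * (1 - r)) *
          ((1 - r) * (1 + 0.3 * r) * (1 + 0.43 * (1 - r)))) ?_ (fun h => ?_) fun h => ?_)
      (le_of_eq (by ring))
    · have h4 := mul_nonneg hr0.le (sub_nonneg.2 hr1)
      have h5 := mul_nonneg h4 hr0.le
      have h6 := mul_nonneg h5 hr0.le
      nlinarith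
    · have h4 := mul_nonneg hr0.le (sub_nonneg.2 h)
      have h5 := mul_nonneg h4 hr0.le
      have h6 := mul_nonneg h5 hr0.le
      nlinarith
    · have h4 := mul_nonneg (sub_nonneg.2 h) (sub_nonneg.2 hr1)
      have h5 := mul_nonneg h4 hr0.le
      have h6 := mul_nonneg h5 hr0.le
      nlinarith
  have hX : num / den * den = num := div_mul_cancel₀ _ hdpos.ne'
  refine ⟨num / den, ?_, ?_, ?_⟩
  · rw [le_div_iff₀ hdpos]
    have : 0 ≤ (1 - r) * z * (1 + 0.43 * (1 - r)) * (r + 10 / 3) * (5 / 16) := by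
      have : 0 ≤ 1 - r := by linarith
      positivity
    nlinarith
  · generalize num / den = X at hX
    rw [hden, hnum] at hX
    linarith
  · have h3 := div_nonneg hT hdpos.le
    have e : (0.98 * ((1 - 0.0635) * den + num * ((2 * (1 + z)) * (r - 0.0635) -
      (r - (1 - r) * z))) -
      num * (1 + (1 - r) * (1 + z) * (1 + 0.3 * r) * (1 + 0.43 * (1 - r)))) / den =
      0.98 * ((1 - 0.0635) + num / den * ((2 * (1 + z)) * (r - 0.0635) -
      (r - (1 - r) * z))) -
      num / den * (1 + (1 - r) * (1 + z) * (1 + 0.3 * r) * (1 + 0.43 * (1 - r))) := by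
      field_simp
    rw [e] at h3
    linarith

/-- The Lyapunov function, of the expected suboptimality `F`, the expected inner product `a` of
the gradient and the bullseye, the second moment `Γ` of the bullseye and the mean squared error `G`
of the caching gradients. -/
def lyapunov (r z X κ F a Γ G : ℝ) : ℝ :=
  r * (1 + 2 * (1 + z) * X) / κ * F - (1 - r) * a + (1 - r) * (1 - r * (1 + z)) * X * Γ +
    (1 - r) * z * (1 + 0.43 * (1 - r)) * X * G

section Lyapunov

variable {r z X κ ρ : ℝ}

/-- The arguments without a prime belong to the start of a period, those with index `1` to the
moment after anchoring, the primed ones to the end; `Γ'` serves for the last two moments, as mining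
keeps the bullseye. The weights are built so that the descent and drift terms put at most `X` in
front of `Γ'`; inserting the anchor bound for `Γ'` then reproduces the weight of `Γ` exactly,
cancels the alignment `a`, and leaves a negative multiple of `h`. -/
theorem lyapunov_step {ε N F h a Γ G F' a' Γ' G' a₁ G₁ : ℝ} (hr0 : 0 < r) (hr1 : r ≤ 1)
    (hz : 0 ≤ z) (hX : 1 / 4 ≤ X)
    (hb : (1 + 2 * (1 + z) * X) * (0.0635 + 5 / 16 * r) + 1.119 / 2 * (1 - r) +
          (1 - r) * z * (1 + 0.43 * (1 - r)) * X * (r + 10 / 3) * (5 / 16) ≤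
        (1 + (1 + z) * (1 - r)) * X)
    (hN : (1 - r) * (N * z) = (1 - r) * (1 + z)) (hκ : 0 < κ) (hρ0 : 0 ≤ ρ) (hρ : ρ ≤ r / 2)
    (hF : F' ≤ F - κ * a₁ + κ * (0.127 / 2) * (h + Γ') + κ * ρ / 2 * (5 / 4 * Γ'))
    (ha : a₁ ≤ a' + 1.119 * ρ * Γ')
    (hG : G' ≤ (1 + 0.3 * r) * G₁ + (1 + 1 / (0.3 * r)) * (ρ ^ 2 * (5 / 4) * Γ'))
    (ha₁ : r * h + (1 - r) * a ≤ a₁)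
    (hΓ : Γ' ≤ Γ - 2 * r * (Γ - a) + (r ^ 2 - r * (1 - r) * z) * (Γ - 2 * a + h) +
      r * (1 - r) * z * G + r * ε)
    (hG₁ : G₁ ≤ r * (N * ε) + (1 - r) * G) (hΓ0 : 0 ≤ Γ') (hG0 : 0 ≤ G) :
    lyapunov r z X κ F' a' Γ' G' ≤ lyapunov r z X κ F a Γ G -
      r * ((1 + 2 * (1 + z) * X) * (r - 0.0635) + (1 - r) - X * (r - (1 - r) * z)) * h +
      r * (X * (1 + (1 - r) * (1 + z) * (1 + 0.3 * r) * (1 + 0.43 * (1 - r)))) * ε := by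
  have hs : 0 ≤ 1 - r := by linarith
  have hX0 : 0 ≤ X := by linarith
  obtain ⟨α, hα⟩ : ∃ α, α = 1 + 2 * (1 + z) * X := ⟨_, rfl⟩
  obtain ⟨y, hy⟩ : ∃ y, y = 1 + 0.43 * (1 - r) := ⟨_, rfl⟩
  have hα0 : 0 ≤ α := by rw [hα]; positivity
  have hy0 : 0 ≤ y := by rw [hy]; positivity
  obtain ⟨ν, hν⟩ : ∃ ν, ν = (1 - r) * z * y * X := ⟨_, rfl⟩
  have hν0 : 0 ≤ ν := by rw [hν]; positivity
  have g1 : r * α / κ * F' ≤ r * α / κ * F - r * α * a₁ + r * α * (0.127 / 2) * (h + Γ') +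
      r * α * ρ / 2 * (5 / 4 * Γ') := by
    refine (mul_le_mul_of_nonneg_left hF (by positivity : 0 ≤ r * α / κ)).trans_eq ?_
    field_simp
  have g2 := mul_le_mul_of_nonneg_left ha hs
  have g3 := mul_le_mul_of_nonneg_left hG hν0
  -- With `ρ ≤ r / 2`, the Young factor `1 / (0.3 r)` from the cache errors costs one power of `r`,
  -- so the drift of the errors is still of order `r`.
  have hρ2 : (1 + 1 / (0.3 * r)) * ρ ^ 2 ≤ r / 4 * (r + 10 / 3) := by
    have : ρ ^ 2 ≤ (r / 2) ^ 2 := pow_le_pow_left₀ hρ0 hρ 2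
    calc (1 + 1 / (0.3 * r)) * ρ ^ 2 ≤ (1 + 1 / (0.3 * r)) * (r / 2) ^ 2 := by gcongr
      _ = _ := by field_simp; ring
  -- The total coefficient of `Γ'`. Every term carries a factor `r` once `(1 - r) (1 - r (1 + z)) X`
  -- is moved to the right, and dividing by `r` leaves the assumed inequality `hb`.
  have hcoef : r * α * (0.127 / 2) + r * α * ρ / 2 * (5 / 4) + (1 - r) * (1.119 * ρ) +
      ν * ((1 + 1 / (0.3 * r)) * ρ ^ 2) * (5 / 4) + (1 - r) * (1 - r * (1 + z)) * X ≤ X := by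
    have k1 : r * α * ρ ≤ r * α * (r / 2) := mul_le_mul_of_nonneg_left hρ (by positivity)
    have k2 := mul_le_mul_of_nonneg_left hρ hs
    have k3 := mul_le_mul_of_nonneg_left hρ2 hν0
    have k4 := mul_le_mul_of_nonneg_left hb hr0.le
    rw [← hα, ← hy, ← hν] at k4
    linarith
  have g4 := mul_le_mul_of_nonneg_right hcoef hΓ0
  have g5 := mul_le_mul_of_nonneg_left hΓ hX0
  have g6 := mul_le_mul_of_nonneg_left ha₁ (by positivity : 0 ≤ r * α + (1 - r))
  have g7 := mul_le_mul_of_nonneg_left hG₁ (by positivity : 0 ≤ ν * (1 + 0.3 * r))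
  have g8 : X * (r * (1 - r) * z) * G + ν * (1 + 0.3 * r) * (1 - r) * G ≤ ν * G := by
    -- The reason for `0.43`: the error weight absorbs the growth `1 + 0.3 r` and the dispersion
    -- term when `y ≥ 1 / (1 - 0.3 (1 - r))`, and `1 / 0.7 < 1.43`.
    have k1 : 1 ≤ y * (1 - 0.3 * (1 - r)) := by rw [hy]; nlinarith
    have k2 := mul_le_mul_of_nonneg_left k1 (by positivity : 0 ≤ r * ((1 - r) * z * X) * G)
    rw [hν]
    linarith
  have g9 : ν * (1 + 0.3 * r) * (r * (N * ε)) =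
      r * X * ((1 - r) * (1 + z) * (1 + 0.3 * r) * y) * ε := by
    rw [hν]
    linear_combination y * X * (1 + 0.3 * r) * r * ε * hN
  simp only [lyapunov]
  rw [← hα, ← hy, ← hν]
  -- This cancellation of the alignment is what determines `α = 1 + 2 (1 + z) X`.
  have e1 : (r * α + (1 - r)) * ((1 - r) * a) = (1 - r) * a + X * (2 * r * a -
      2 * (r ^ 2 - r * (1 - r) * z) * a) := by rw [hα]; ring
  linarith

/-- Only the alignment term can be negative. The suboptimality controls `h` because `L κ ≤ r / 2`,
and the cache error dominates the squared bias `Γ - 2 a + h`; the rest is a quadratic form in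
bullseye and gradient, nonnegative by completing the square. -/
theorem lyapunov_nonneg {F h a Γ G L : ℝ} (hr0 : 0 < r) (hr1 : r ≤ 1)
    (hz : 0 ≤ z) (hX : 1 / 4 ≤ X) (hκ : 0 < κ) (hL : 0 < L)
    (hρ : L * κ ≤ r / 2) (hF : h / (2 * L) ≤ F) (hh : 0 ≤ h)
    (hc : ∀ w : ℝ, 0 ≤ Γ - 2 * w * a + w ^ 2 * h) (hG : Γ - 2 * a + h ≤ G) :
    0 ≤ lyapunov r z X κ F a Γ G := by
  have hs : 0 ≤ 1 - r := by linarith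
  have hX0 : 0 < X := by linarith
  obtain ⟨α, hα⟩ : ∃ α, α = 1 + 2 * (1 + z) * X := ⟨_, rfl⟩
  have hα0 : 0 ≤ α := by rw [hα]; positivity
  have hE := hc 1
  have g1 : α * h ≤ r * α / κ * F := by
    have k1 : r * α / κ * (h / (2 * L)) ≤ r * α / κ * F :=
      mul_le_mul_of_nonneg_left hF (by positivity)
    have k2 : α * h * (L * κ) ≤ α * h * (r / 2) := mul_le_mul_of_nonneg_left hρ (by positivity)
    refine le_trans ?_ k1
    rw [div_mul_div_comm, le_div_iff₀ (by positivity)]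
    linarith
  have g2 : (1 - r) * z * X * (Γ - 2 * a + h) ≤
      (1 - r) * z * (1 + 0.43 * (1 - r)) * X * G := by
    have k1 : (1 - r) * z * X * (Γ - 2 * a + h) ≤ (1 - r) * z * X * G :=
      mul_le_mul_of_nonneg_left hG (by positivity)
    have k2 : 0 ≤ (1 - r) * z * (0.43 * (1 - r)) * X * G := by
      have : 0 ≤ G := by linarith
      positivity
    linarith
  simp only [lyapunov]
  rw [← hα]
  rcases hs.eq_or_lt with h0 | h0
  · rw [← h0] at g2 ⊢
    have : 0 ≤ α * h := by positivity
    linarith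
  -- The `w` that completes the square in the bullseye. The remaining multiple of `h` is at most
  -- `α`, which uses `X ≥ 1 / 4`; the case `r = 1`, where this quotient degenerates, has no
  -- alignment term.
  · obtain ⟨w, hw⟩ : ∃ w, w = (2 * z * X + 1) / (2 * X * (1 + z) * (1 - r)) := ⟨_, rfl⟩
    have k1 := mul_nonneg (by positivity : 0 ≤ (1 - r) * (X * (1 + z) * (1 - r))) (hc w)
    have k2 : 2 * w * (X * (1 + z) * (1 - r)) = 2 * z * X + 1 := by
      rw [hw]; field_simp
    have k3 : (1 - r) * (X * (1 + z) * (1 - r)) * w ^ 2 =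
        (2 * z * X + 1) ^ 2 / (4 * X * (1 + z)) := by
      rw [hw]; field_simp; ring
    have k4 : (2 * z * X + 1) ^ 2 / (4 * X * (1 + z)) ≤ α := by
      rw [div_le_iff₀ (by positivity), hα]
      have : 0 ≤ z * X := by positivity
      nlinarith [mul_nonneg hX0.le hX0.le]
    have k5 := mul_le_mul_of_nonneg_right k4 hh
    rw [← k3] at k5
    have k6 : 0 ≤ (1 - r) * z * X * h := by positivity
    have e1 : (1 - r) * (X * (1 + z) * (1 - r)) * (Γ - 2 * w * a + w ^ 2 * h) =
        (1 - r) * (X * (1 + z) * (1 - r)) * Γ - (1 - r) * ((2 * z * X + 1) * a) +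
        (1 - r) * (X * (1 + z) * (1 - r)) * w ^ 2 * h := by
      rw [← k2]; ring
    rw [e1] at k1
    linarith

end Lyapunov

section Convergence

variable {Ξ : Type*} [MeasurableSpace Ξ] {d M A b b' K : ℕ} {D : Fin M → LocalData Ξ}
  {f : Fin M → Vec d → Ξ → ℝ} {gr : Fin M → Vec d → Vec d} {L V ηs ηl c : ℝ} {p : ℕ → ℝ}

/-! ### The quantities of the analysis -/

/-- The quantities at the start. -/
theorem RoundModel.initial_quantities (H : RoundModel D f A b b' K gr L V ηs ηl c)
    (hp : ∀ t, p t = 0 ∨ p t = 1) (x₀ : Vec d)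
    {μ : Measure (Seed Ξ M b b' K)} (hμ : μ = seedLaw D A b b' K p) :
    alignment gr μ (fun ω => run f ηs ηl x₀ ω 0) = ‖meanField gr x₀‖ ^ 2 ∧
      bullseyeSq μ (fun ω => run f ηs ηl x₀ ω 0) ≤ ‖meanField gr x₀‖ ^ 2 + c / M ∧
      meanError gr μ (fun ω => run f ηs ηl x₀ ω 0) ≤ c := by
  have h0 : ∀ t, 0 ≤ p t := fun t => by rcases hp t with h | h <;> simp [h]
  have h1 : ∀ t, p t ≤ 1 := fun t => by rcases hp t with h | h <;> simp [h]
  have := fun m => (D m).isProbabilityMeasure_batchLaw (H.sizes.large m)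
  have := fun t => FedAMD.isProbabilityMeasure_roundLaw (K := K) H.sizes (h0 t) (h1 t)
  have hM : (M : ℝ) ≠ 0 := by
    have := H.one_le_M
    positivity
  have hμp : IsProbabilityMeasure μ := by
    rw [hμ]; exact isProbabilityMeasure_seedLaw H.sizes h0 h1
  have hfst : MeasurePreserving (fun ω : Seed Ξ M b b' K => ω.1) μ
      (Measure.pi fun m => (D m).batchLaw b) := by
    rw [hμ]; exact measurePreserving_fst
  obtain ⟨X, hX⟩ : ∃ X : Fin M → (Fin b → Ξ) → Vec d, ∀ i B,
      batchGrad (f i) x₀ B - gr i x₀ = X i B := ⟨_, fun _ _ => rfl⟩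
  have hXm : ∀ i, Measurable (X i) := fun i => by
    have h2 : Measurable fun B : Fin b → Ξ => batchGrad (f i) x₀ B :=
      measurable_comp_pair (f := fun v (B : Fin b → Ξ) => batchGrad (f i) v B)
        (H.large_measurable i) measurable_const measurable_id
    have h3 := h2.sub_const (gr i x₀)
    simp only [hX] at h3
    exact h3
  have hX2 : ∀ i, MemLp (X i) 2 ((D i).batchLaw b) := fun i => by
    have h3 := (H.large_memLp i x₀).sub (memLp_const (gr i x₀))
    simpa only [Pi.sub_def, hX] using h3
  have hX0 : ∀ i, ∫ B, X i B ∂(D i).batchLaw b = 0 := fun i => by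
    simp only [← hX]
    rw [integral_sub ((H.large_memLp i x₀).integrable (by norm_num)) (integrable_const _),
      H.large_mean i x₀]
    simp
  have hXc : ∀ i, ∫ B, ‖X i B‖ ^ 2 ∂(D i).batchLaw b ≤ c := fun i => by
    simp only [← hX]
    exact H.large_noise i x₀
  obtain ⟨s1, s2, s3⟩ := integral_sq_norm_sum_le hXm hX2 hX0 Finset.univ
  obtain ⟨Z, hZ⟩ : ∃ Z : (Fin M → Fin b → Ξ) → Vec d, ∀ a, ∑ i, X i (a i) = Z a :=
    ⟨_, fun _ => rfl⟩
  simp only [hZ] at s1 s2 s3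
  have hbull : ∀ ω : Seed Ξ M b b' K, (run f ηs ηl x₀ ω 0).bullseye =
      meanField gr x₀ + (M : ℝ)⁻¹ • Z ω.1 := fun ω => by
    simp only [run, State.bullseye, meanField, ← hZ, ← hX]
    rw [Finset.sum_sub_distrib, smul_sub, add_sub_cancel]
  have hZ2 : MemLp (fun ω : Seed Ξ M b b' K => Z ω.1) 2 μ := s1.comp_measurePreserving hfst
  have hZi := hZ2.integrable (by norm_num)
  have hZ0 : ∫ ω : Seed Ξ M b b' K, Z ω.1 ∂μ = 0 := by
    rw [integral_comp_measurePreserving hfst s1.1, s2]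
  have hZsq : ∫ ω : Seed Ξ M b b' K, ‖Z ω.1‖ ^ 2 ∂μ ≤ M * c := by
    -- Independence of the clients: the variances add, which gives `M c` for the sum and `c / M` for
    -- the average.
    rw [integral_comp_measurePreserving hfst (φ := fun a => ‖Z a‖ ^ 2)
      (s1.integrable_norm_pow two_ne_zero).1]
    refine s3.trans ((Finset.sum_le_sum fun i _ => hXc i).trans_eq ?_)
    simp
  have hin : ∫ ω : Seed Ξ M b b' K, inner ℝ (meanField gr x₀) (Z ω.1) ∂μ = 0 := by
    rw [integral_inner hZi, hZ0, inner_zero_right]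
  have hini : Integrable (fun ω : Seed Ξ M b b' K => inner ℝ (meanField gr x₀) (Z ω.1)) μ :=
    hZi.const_inner _
  refine ⟨?_, ?_, ?_⟩
  · unfold alignment
    simp only [hbull]
    simp only [run, inner_add_right, inner_smul_right, real_inner_self_eq_norm_sq]
    rw [integral_add (integrable_const _) (hini.const_mul _), integral_const_mul, hin]
    simp
  · unfold bullseyeSq
    simp only [hbull, norm_add_sq_real, inner_smul_right, norm_smul, mul_pow, norm_inv,
      RCLike.norm_natCast]
    have i1 : Integrable (fun ω : Seed Ξ M b b' K => ‖meanField gr x₀‖ ^ 2 +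
        2 * ((M : ℝ)⁻¹ * inner ℝ (meanField gr x₀) (Z ω.1))) μ :=
      (integrable_const _).add ((hini.const_mul _).const_mul _)
    have i2 := hZ2.integrable_norm_pow two_ne_zero
    rw [integral_add i1 (i2.const_mul _), integral_add (integrable_const _)
      ((hini.const_mul _).const_mul _), integral_const_mul, integral_const_mul, integral_const_mul,
      hin]
    simp only [integral_const, probReal_univ, one_smul, mul_zero, add_zero]
    have h2 := mul_le_mul_of_nonneg_left hZsq (by positivity : 0 ≤ ((M : ℝ)⁻¹) ^ 2)
    have e : ((M : ℝ)⁻¹) ^ 2 * (M * c) = c / M := by field_simp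
    linarith
  · unfold meanError cacheError
    have i1 : ∀ i, Integrable (fun ω : Seed Ξ M b b' K => ‖X i (ω.1 i)‖ ^ 2) μ ∧
        ∫ ω : Seed Ξ M b b' K, ‖X i (ω.1 i)‖ ^ 2 ∂μ ≤ c := fun i => by
      have hmp : MeasurePreserving (fun ω : Seed Ξ M b b' K => ω.1 i) μ ((D i).batchLaw b) :=
        (measurePreserving_eval (fun m => (D m).batchLaw b) i).comp hfst
      have i2 := (hX2 i).integrable_norm_pow two_ne_zero
      refine ⟨hmp.integrable_comp_of_integrable i2, ?_⟩
      rw [integral_comp_measurePreserving hmp (φ := fun B => ‖X i B‖ ^ 2) i2.1]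
      exact hXc i
    simp only [run, hX]
    rw [integral_const_mul, integral_finsetSum _ fun i _ => (i1 i).1]
    calc _ ≤ (M : ℝ)⁻¹ * ∑ _i : Fin M, c := by
          gcongr with i
          exact (i1 i).2
      _ = c := by
          simp only [Finset.sum_const, Finset.card_univ, Fintype.card_fin, nsmul_eq_mul]
          field_simp

/-- Relations between the quantities in one round. -/
theorem RoundModel.quantities_relations (H : RoundModel D f A b b' K gr L V ηs ηl c)
    {Ω : Type*} [MeasurableSpace Ω] {μ : Measure Ω} [IsProbabilityMeasure μ] {S : Ω → State d M}
    (hx : MemLp (fun ω => (S ω).model) 2 μ) (hv : ∀ i, MemLp (fun ω => (S ω).cache i) 2 μ)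
    {F : Vec d → ℝ} {m : ℝ} (hF : SmoothBounded F (meanField gr) L m) :
    gradSq gr μ S / (2 * L) ≤ meanLoss F μ S - m ∧ 0 ≤ gradSq gr μ S ∧ 0 ≤ bullseyeSq μ S ∧
      0 ≤ meanError gr μ S ∧
      (∀ w : ℝ, 0 ≤ bullseyeSq μ S - 2 * w * alignment gr μ S + w ^ 2 * gradSq gr μ S) ∧
      bullseyeSq μ S - 2 * alignment gr μ S + gradSq gr μ S ≤ meanError gr μ S ∧
      (M = 1 → meanError gr μ S = bullseyeSq μ S - 2 * alignment gr μ S + gradSq gr μ S) := by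
  have hM : (M : ℝ) ≠ 0 := by
    have := H.one_le_M
    positivity
  have hh := H.memLp_meanField hx
  have hg := memLp_bullseye hv
  have hce := H.integrable_cacheError hx hv
  have hg2 := hg.integrable_norm_pow two_ne_zero
  have hh2 := hh.integrable_norm_pow two_ne_zero
  have hhg := MemLp.integrable_inner_two hh hg
  have hFi := hF.integrable hx
  have hexp : ∀ w : ℝ, ∫ ω, ‖(S ω).bullseye - w • meanField gr (S ω).model‖ ^ 2 ∂μ =
      bullseyeSq μ S - 2 * w * alignment gr μ S + w ^ 2 * gradSq gr μ S := fun w => by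
    have e : ∀ ω, ‖(S ω).bullseye - w • meanField gr (S ω).model‖ ^ 2 = ‖(S ω).bullseye‖ ^ 2 -
        2 * w * inner ℝ (meanField gr (S ω).model) (S ω).bullseye +
        w ^ 2 * ‖meanField gr (S ω).model‖ ^ 2 := fun ω => by
      rw [norm_sub_sq_real, inner_smul_right, real_inner_comm, norm_smul, mul_pow,
        Real.norm_eq_abs, sq_abs]
      ring
    simp only [e]
    have i1 := hg2.sub (hhg.const_mul (2 * w))
    simp only [Pi.sub_def] at i1
    rw [integral_add i1 (hh2.const_mul _), integral_sub hg2 (hhg.const_mul _),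
      integral_const_mul, integral_const_mul]
    rfl
  have he : MemLp (fun ω => (S ω).bullseye - (1 : ℝ) • meanField gr (S ω).model) 2 μ := by
    simp only [one_smul]
    exact hg.sub hh
  have hpt : ∀ ω, (S ω).bullseye - (1 : ℝ) • meanField gr (S ω).model =
      (M : ℝ)⁻¹ • ∑ i, ((S ω).cache i - gr i (S ω).model) := fun ω => by
    rw [one_smul]
    exact bullseye_sub_meanField gr (S ω).model (S ω).cache
  have h1 := hexp 1
  rw [mul_one, one_pow, one_mul] at h1
  refine ⟨?_, integral_nonneg fun _ => by positivity, integral_nonneg fun _ => by positivity,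
    integral_nonneg fun _ => ?_, fun w => ?_, ?_, fun hM1 => ?_⟩
  · have h2 := integral_mono (hh2.div_const (2 * L)) (hFi.sub (integrable_const m)) fun ω =>
      hF.sq_norm_le (S ω).model
    simp only [Pi.sub_apply] at h2
    rw [integral_div, integral_sub hFi (integrable_const m), integral_const, probReal_univ,
      one_smul] at h2
    exact h2
  · unfold cacheError
    positivity
  · rw [← hexp]
    exact integral_nonneg fun _ => by positivity
  · rw [← h1]
    refine integral_mono (he.integrable_norm_pow two_ne_zero) hce fun ω => ?_
    simp only [hpt]
    rw [norm_smul, mul_pow, norm_inv, RCLike.norm_natCast, cacheError]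
    have h2 := (pow_le_pow_left₀ (norm_nonneg _) (norm_sum_le Finset.univ
      fun i => (S ω).cache i - gr i (S ω).model) 2).trans sq_sum_le_card_mul_sum_sq
    rw [Finset.card_univ, Fintype.card_fin] at h2
    calc _ ≤ ((M : ℝ)⁻¹) ^ 2 * (M * ∑ i, ‖(S ω).cache i - gr i (S ω).model‖ ^ 2) := by gcongr
      _ = _ := by field_simp
  · subst hM1
    rw [← h1]
    unfold meanError cacheError
    refine integral_congr_ae (Filter.Eventually.of_forall fun ω => ?_)
    simp only [hpt]
    simp

/-! ### Convergence -/

/-- For `A < M` the witness is `z = 1 / (M - 1)`, the correlation of sampling without replacement: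
the probability of a pair is `r² - r (1 - r) z`. For `A = M` nothing is random and `z = 0`. If `M =
1`, the pair probability has denominator `0` and value `0`, so the identity moves the weight from
`E` to `G` and needs `G = E`. -/
theorem exists_dispersion (hA1 : 1 ≤ A) (hA : A ≤ M) :
    ∃ z : ℝ, 0 ≤ z ∧ z ≤ 1 ∧ (A : ℝ) / M * z ≤ 1 - A / M ∧ (1 - (A : ℝ) / M) * z ≤ A / M ∧
      (1 - (A : ℝ) / M) * (M * z) = (1 - A / M) * (1 + z) ∧
      ∀ E G : ℝ, (M = 1 → G = E) → (A : ℝ) * (A - 1) / (M * (M - 1)) * E +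
          ((A : ℝ) / M - A * (A - 1) / (M * (M - 1))) / M * G =
        (((A : ℝ) / M) ^ 2 - A / M * (1 - A / M) * z) * E + A / M * (1 - A / M) * z * G := by
  have hM0 : (M : ℝ) ≠ 0 := by
    have : 0 < M := by omega
    positivity
  rcases hA.eq_or_lt with rfl | hlt
  · refine ⟨0, le_rfl, zero_le_one, by simp [hM0], by simp [hM0], by simp [hM0], fun E G h => ?_⟩
    rcases Nat.eq_or_lt_of_le hA1 with h1 | h1
    · rw [h h1.symm, ← h1]
      simp
    · have h2 : (A : ℝ) - 1 ≠ 0 := by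
        have : (1 : ℝ) < A := by exact_mod_cast h1
        linarith
      have h3 : (A : ℝ) * (A - 1) ≠ 0 := mul_ne_zero hM0 h2
      rw [div_self h3, div_self hM0]
      simp
  · have hA1' : (1 : ℝ) ≤ A := by exact_mod_cast hA1
    have hlt' : (A : ℝ) + 1 ≤ M := by exact_mod_cast hlt
    have hM1 : 0 < (M : ℝ) - 1 := by linarith
    have hMp : 0 < (M : ℝ) := by linarith
    have hs : 1 - (A : ℝ) / M = (M - A) / M := by field_simp
    refine ⟨1 / (M - 1), by positivity, ?_, ?_, ?_, ?_, fun E G _ => ?_⟩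
    · rw [div_le_one hM1]
      linarith
    · rw [hs, div_mul_div_comm, div_le_div_iff₀ (by positivity) hMp]
      have : (A : ℝ) ≤ (M - A) * (M - 1) := by nlinarith
      nlinarith
    · rw [hs, div_mul_div_comm, div_le_div_iff₀ (by positivity) hMp]
      have : (M : ℝ) - A ≤ A * (M - 1) := by nlinarith
      nlinarith
    · field_simp
      ring
    · field_simp
      ring

/-- The initial caches are unbiased, so the alignment equals `h`, and the bullseye and cache errors
exceed their ideal values only by noise. The condition `ε ≤ 2 L Δ` turns that noise into multiples
of `L Δ`. -/
theorem lyapunov_init {r z X κ ε N F h Γ G L Δ : ℝ} (hr0 : 0 < r) (hr1 : r ≤ 1) (hz0 : 0 ≤ z)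
    (hz1 : z ≤ 1) (h1 : r * z ≤ 1 - r) (h2 : (1 - r) * z ≤ r) (hX : 1 / 4 ≤ X) (hκ : 0 < κ)
    (hN : (1 - r) * (N * z) = (1 - r) * (1 + z)) (hε : 0 < ε) (hΔ0 : 0 ≤ Δ) (hF : F ≤ Δ) (hh : 0 ≤ h)
    (hh' : h ≤ 2 * (L * Δ)) (hΓ0 : 0 ≤ Γ) (hΓ : Γ ≤ h + ε) (hG : G ≤ N * ε)
    (hΔ : ε ≤ 2 * (L * Δ)) :
    lyapunov r z X κ F h Γ G ≤ X * (8 * (r * Δ / κ) + 7 * (L * Δ)) := by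
  have hX0 : 0 < X := by linarith
  have hs : 0 ≤ 1 - r := by linarith
  have hα : 1 + 2 * (1 + z) * X ≤ 8 * X := by
    have := mul_le_mul_of_nonneg_right hz1 hX0.le
    linarith
  unfold lyapunov
  have hLΔ : 0 < L * Δ := by linarith
  have k1 : r * (1 + 2 * (1 + z) * X) / κ * F ≤ 8 * X * (r * Δ / κ) := by
    calc _ ≤ r * (1 + 2 * (1 + z) * X) / κ * Δ := by gcongr
      _ ≤ r * (8 * X) / κ * Δ := by gcongr
      _ = _ := by ring
  have k2 : (1 - r) * (1 - r * (1 + z)) * X * Γ ≤ X * (4 * (L * Δ)) := by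
    have h3 : 0 ≤ 1 - r * (1 + z) := by linarith
    have h4 : (1 - r) * (1 - r * (1 + z)) ≤ 1 :=
      mul_le_one₀ (by linarith) h3 (by linarith [mul_nonneg hr0.le hz0])
    calc _ ≤ 1 * X * Γ := by gcongr
      _ ≤ 1 * X * (4 * (L * Δ)) := by gcongr; linarith
      _ = _ := by ring
  have k3 : (1 - r) * z * (1 + 0.43 * (1 - r)) * X * G ≤ X * (2.86 * (L * Δ)) := by
    have h3 : (1 - r) * (1 + z) ≤ 1 := by linarith
    have h4 : 1 - r ≤ 1 := by linarith
    calc _ ≤ (1 - r) * z * (1 + 0.43 * (1 - r)) * X * (N * ε) := by gcongr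
      _ = ((1 - r) * (N * z)) * (1 + 0.43 * (1 - r)) * X * ε := by ring
      _ = ((1 - r) * (1 + z)) * (1 + 0.43 * (1 - r)) * X * ε := by rw [hN]
      _ ≤ 1 * (1 + 0.43 * 1) * X * (2 * (L * Δ)) := by gcongr
      _ = _ := by ring
  have k4 : 0 ≤ (1 - r) * h := by positivity
  have k5 : 0 < X * (L * Δ) := by positivity
  linarith

/-- By contradiction: if the expected squared gradient exceeded `ε` at all these starts, the
nonnegative Lyapunov function would fall by more than its initial value. -/
theorem RoundModel.exists_gradSq_le {ε Δ : ℝ}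
    (H : RoundModel D f A b b' K gr L V ηs ηl (M * ε)) {τ : ℕ} (hτ : 2 ≤ τ) (x₀ : Vec d)
    {F : Vec d → ℝ} {m : ℝ} (hF : SmoothBounded F (meanField gr) L m) (hε : 0 < ε)
    (hΔ : F x₀ - m ≤ Δ) (hεΔ : ε ≤ 2 * L * Δ)
    (hη : ηs * ηl * K * (L * (1 + 2 * M * τ / A)) = 1) (N : ℕ)
    (hN : 12 * (L * Δ) * ((1 + 2 * M * τ / A) / (τ - 1)) < 0.02 * N * ε) :
    ∃ j < N, gradSq gr (seedLaw D A b b' K (seqProb τ))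
      (fun ω => run f ηs ηl x₀ ω (j * τ)) ≤ ε := by
  have hp : ∀ t, seqProb τ t = 0 ∨ seqProb τ t = 1 := fun t => by
    unfold seqProb
    split_ifs <;> simp
  have hp0 : ∀ t, 0 ≤ seqProb τ t := fun t => by rcases hp t with h | h <;> simp [h]
  have hp1 : ∀ t, seqProb τ t ≤ 1 := fun t => by rcases hp t with h | h <;> simp [h]
  have hpμ := isProbabilityMeasure_seedLaw (K := K) H.sizes hp0 hp1
  obtain ⟨μ, hμ⟩ : ∃ μ, μ = seedLaw D A b b' K (seqProb τ) := ⟨_, rfl⟩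
  obtain ⟨S, hS⟩ : ∃ S : ℕ → Seed Ξ M b b' K → State d M, S = fun t ω => run f ηs ηl x₀ ω t :=
    ⟨_, rfl⟩
  rw [← hμ] at hpμ
  have hA1 := H.sizes.one_le
  have hM1 := H.one_le_M
  have hL := hF.pos
  have hA0 : (0 : ℝ) < A := by positivity
  have hM0 : (0 : ℝ) < M := by positivity
  have hτ' : (2 : ℝ) ≤ τ := by exact_mod_cast hτ
  have hLΔ : 0 < L * Δ := by linarith
  have hΔ1 : 0 ≤ Δ := (pos_of_mul_pos_right hLΔ hL.le).le
  obtain ⟨r, hr⟩ : ∃ r : ℝ, r = A / M := ⟨_, rfl⟩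
  have hr0 : 0 < r := by rw [hr]; positivity
  have hr1 : r ≤ 1 := by
    rw [hr, div_le_one hM0]
    exact_mod_cast H.sizes.le
  have hQ : 1 + 2 * (M : ℝ) * τ / A = 1 + 2 * τ / r := by rw [hr]; field_simp
  rw [hQ] at hη hN
  obtain ⟨κ, hκ⟩ : ∃ κ : ℝ, κ = ηs * ηl * K * (τ - 1) := ⟨_, rfl⟩
  have hLκ : L * κ * (1 + 2 * τ / r) = τ - 1 := by
    rw [hκ]
    linear_combination ((τ : ℝ) - 1) * hη
  have hQ0 : 0 < 1 + 2 * τ / r := by positivity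
  have hκ0 : 0 < κ := by
    have h1 : 0 < L * κ := by
      by_contra! h
      have := mul_nonpos_of_nonpos_of_nonneg h hQ0.le
      linarith
    exact (pos_iff_pos_of_mul_pos h1).1 hL
  have hρ : L * κ ≤ r / 2 := by
    have h1 : L * κ * (r + 2 * τ) = (τ - 1) * r := by
      rw [← hLκ]; field_simp
    by_contra! h
    have h2 : r / 2 * (r + 2 * τ) < L * κ * (r + 2 * τ) :=
      mul_lt_mul_of_pos_right h (by positivity)
    have h3 := mul_pos hr0 hr0
    linarith only [h1, h2, h3, hr0]
  obtain ⟨z, hz0, hz1, hz2, hz3, hz4, hz5⟩ := exists_dispersion hA1 H.sizes.le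
  rw [← hr] at hz2 hz3 hz4 hz5
  obtain ⟨X, hX, hX1, hX2⟩ := exists_weight hr0 hr1 hz0 hz2 hz3
  -- The rate of decrease per unit of squared gradient, up to the factor `r`. The noise coefficient
  -- is at most `0.98 k`, so a margin of `0.02 k` remains when the squared gradient exceeds `ε`.
  obtain ⟨k, hk⟩ : ∃ k, k = (1 + 2 * (1 + z) * X) * (r - 0.0635) + (1 - r) -
    X * (r - (1 - r) * z) := ⟨_, rfl⟩
  have hs : 0 ≤ 1 - r := by linarith
  have hX0 : 0 < X := by linarith
  have hXk : X ≤ 0.98 * k := by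
    rw [hk]
    refine le_trans ?_ hX2
    have : 0 ≤ X * ((1 - r) * (1 + z) * (1 + 0.3 * r) * (1 + 0.43 * (1 - r))) := by positivity
    linarith only [this]
  have hrel := fun t => H.quantities_relations (μ := μ) (S := S t)
    (by rw [hS, hμ]; exact (H.memLp_run hp x₀ t).1) (by rw [hS, hμ]; exact (H.memLp_run hp x₀ t).2)
    hF
  obtain ⟨Φ, hΦ⟩ : ∃ Φ : ℕ → ℝ, Φ = fun j => lyapunov r z X κ (meanLoss F μ (S (j * τ)) - m)
    (alignment gr μ (S (j * τ))) (bullseyeSq μ (S (j * τ))) (meanError gr μ (S (j * τ))) :=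
    ⟨_, rfl⟩
  have hΦ0 : ∀ j, 0 ≤ Φ j := fun j => by
    obtain ⟨q1, q2, q3, q4, q5, q6, q7⟩ := hrel (j * τ)
    rw [hΦ]
    exact lyapunov_nonneg hr0 hr1 hz0 hX hκ0 hL hρ q1 q2 q5 q6
  have hstep : ∀ j, Φ (j + 1) ≤ Φ j - r * k * gradSq gr μ (S (j * τ)) + 0.98 * (r * k) * ε := by
    intro j
    obtain ⟨q1, q2, q3, q4, q5, q6, q7⟩ := hrel (j * τ)
    obtain ⟨u1, u2, u3, u4, u5, u6, u7⟩ := hrel (j * τ + 1)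
    obtain ⟨a1, a2, a3, a4, a5⟩ := H.anchor_quantities hp x₀ F (s := j * τ)
      (by simp [seqProb]) hμ hS
    obtain ⟨b1, b2, b3, b4⟩ := H.mining_quantities hp x₀ hF (j * τ + 1) (τ - 1)
      (fun i hi => by
        have h1 : (j * τ + 1 + i) % τ = 1 + i := by
          rw [add_assoc, add_comm, Nat.add_mul_mod_self_right, Nat.mod_eq_of_lt (by omega)]
        rw [seqProb, h1, if_neg (by omega)])
      (κ := κ) (by rw [hκ]; push_cast [Nat.cast_sub (by omega : 1 ≤ τ)]; ring) hκ0
      -- The Young weight must be proportional to `r`, since the refresh contracts the cache errors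
      -- only by `1 - r`.
      (θ := 0.3 * r) (by positivity) hμ hS
    have e : j * τ + 1 + (τ - 1) = (j + 1) * τ := by
      rw [add_mul, one_mul]
      omega
    rw [e] at b1 b2 b3 b4
    rw [a1, a2] at b1
    rw [← hr] at a3 a4 a5
    have h5 := hz5 _ _ q7
    rw [mul_div_cancel_left₀ ε hM0.ne'] at a4
    have h6 := lyapunov_step (κ := κ) (ρ := L * κ) (X := X) (N := M) (ε := ε)
      (F := meanLoss F μ (S (j * τ)) - m) (h := gradSq gr μ (S (j * τ)))
      (a := alignment gr μ (S (j * τ))) (Γ := bullseyeSq μ (S (j * τ)))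
      (G := meanError gr μ (S (j * τ))) (F' := meanLoss F μ (S ((j + 1) * τ)) - m)
      (a' := alignment gr μ (S ((j + 1) * τ))) (Γ' := bullseyeSq μ (S (j * τ + 1)))
      (G' := meanError gr μ (S ((j + 1) * τ))) (a₁ := alignment gr μ (S (j * τ + 1)))
      (G₁ := meanError gr μ (S (j * τ + 1))) hr0 hr1 hz0 hX hX1 hz4 hκ0 (by positivity) hρ
      (by linarith only [b1]) (by linarith only [b2]) (by linarith only [b4]) a3
      (by linarith only [a4, h5]) (by linarith only [a5]) u3 q4
    rw [← b3] at h6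
    have h7 := mul_le_mul_of_nonneg_left hX2 (by positivity : 0 ≤ r * ε)
    rw [← hk] at h6 h7
    simp only [hΦ]
    linarith only [h6, h7]
  have hinit : Φ 0 ≤ X * (8 * (r * Δ / κ) + 7 * (L * Δ)) := by
    obtain ⟨i1, i2, i3⟩ := H.initial_quantities hp x₀ hμ
    have hS0 : S 0 = fun ω => run f ηs ηl x₀ ω 0 := by rw [hS]
    have hl : meanLoss F μ (S 0) = F x₀ := by
      rw [hS0]
      simp [meanLoss, run]
    rw [← hS0] at i1 i2 i3
    rw [mul_div_cancel_left₀ ε hM0.ne'] at i2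
    have hg := hF.sq_norm_le x₀
    rw [div_le_iff₀ (by positivity)] at hg
    have hg2 := hg.trans (mul_le_mul_of_nonneg_right hΔ (by positivity))
    simp only [hΦ, zero_mul, hl, i1]
    exact lyapunov_init hr0 hr1 hz0 hz1 hz2 hz3 hX hκ0 hz4 hε hΔ1 hΔ (by positivity)
      (by linarith only [hg2]) (hrel 0).2.2.1 i2 i3 (by linarith only [hεΔ])
  -- Since `r (1 + 2 τ / r) / (τ - 1) ≥ 2`, the term `7 L Δ` counts for at most `3.5` units of `r Δ
  -- / κ`, and `8 + 3.5 ≤ 12`.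
  have hbig : 8 * (r * Δ / κ) + 7 * (L * Δ) < 0.02 * N * ε * r := by
    have hτ1 : (0 : ℝ) < τ - 1 := by linarith
    have h1 : r * Δ / κ = r * ((L * Δ) * ((1 + 2 * τ / r) / (τ - 1))) := by
      rw [← hLκ]
      field_simp
    have h2 : 2 ≤ r * ((1 + 2 * τ / r) / (τ - 1)) := by
      have e : r * ((1 + 2 * τ / r) / (τ - 1)) = (r + 2 * τ) / (τ - 1) := by field_simp
      rw [e, le_div_iff₀ hτ1]
      linarith
    have h3 := mul_le_mul_of_nonneg_left h2 hLΔ.le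
    have h4 := mul_lt_mul_of_pos_right hN hr0
    rw [h1]
    linarith only [h3, h4, hLΔ]
  by_contra! hcon
  have hk0 : 0 < k := by linarith
  have hdesc : ∀ j ≤ N, Φ j ≤ Φ 0 - j * (0.02 * (r * k) * ε) := by
    intro j hj
    induction j with
    | zero => simp
    | succ j ih =>
      have h1 := ih (by omega)
      have h2 := hcon j (by omega)
      have h3 := hstep j
      have e : gradSq gr μ (S (j * τ)) =
          gradSq gr (seedLaw D A b b' K (seqProb τ)) (fun ω => run f ηs ηl x₀ ω (j * τ)) := by
        rw [hμ, hS]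
      rw [← e] at h2
      have h4 := mul_lt_mul_of_pos_left h2 (by positivity : 0 < r * k)
      push_cast
      linarith only [h1, h3, h4]
  have h1 := hdesc N le_rfl
  have h2 := hΦ0 N
  have h3 : X * (8 * (r * Δ / κ) + 7 * (L * Δ)) ≤ k * (8 * (r * Δ / κ) + 7 * (L * Δ)) := by
    refine mul_le_mul_of_nonneg_right (by linarith) (by positivity)
  have h4 := mul_lt_mul_of_pos_left hbig hk0
  linarith only [h1, h2, h3, h4, hinit]

end Convergence

section Assumptions

variable {Ξ : Type*} [MeasurableSpace Ξ] {d M A b b' K : ℕ} {D : Fin M → LocalData Ξ}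
  {f : Fin M → Vec d → Ξ → ℝ} {L σ Lσ ηs ηl ε : ℝ}

/-! ### From the assumptions on the losses to the model of a round -/

theorem smallStep_of_le (hK : 1 ≤ K) (hL : 0 < L) (hb' : 1 ≤ b') (hηl : 0 < ηl)
    (h1 : ηl ≤ 1 / (2 * √6 * K * L)) (h2 : ηl * (4 * √3 * Lσ) ≤ √((b' : ℝ) / K))
    (hLσ : 0 ≤ Lσ) : SmallStep L (Lσ ^ 2 / b') ηl K := by
  have hK0 : (0 : ℝ) < K := by positivity
  have hb0 : (0 : ℝ) < b' := by positivity
  refine ⟨hK, hL.le, by positivity, hηl.le, ?_, ?_⟩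
  · rw [le_div_iff₀ (by positivity)] at h1
    -- A lower bound for `√6` sharp enough for `1 / (2 √6) ≤ 0.20413`.
    have h6 : (2.44948 : ℝ) ≤ √6 := Real.le_sqrt_of_sq_le (by norm_num)
    have h3 : 0 ≤ L * ηl * K := by positivity
    have h4 := mul_le_mul_of_nonneg_left h6 h3
    linarith
  · have h3 := pow_le_pow_left₀ (by positivity) h2 2
    rw [Real.sq_sqrt (by positivity), mul_pow, mul_pow, mul_pow, Real.sq_sqrt (by norm_num),
      le_div_iff₀ hK0] at h3
    rw [div_mul_eq_mul_div, mul_div_assoc', div_le_one hb0]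
    linarith

theorem gradOracle_localLoss (hR : Regular D f) (hS : LSmooth D f L) (hB : BoundedNoise D f σ)
    (hA : AvgSmooth D f Lσ) (i : Fin M) (h1 : 1 ≤ b') (hb' : (b' : ℕ∞) ≤ (D i).size) :
    GradOracle (f i) ((D i).batchLaw b') (gradient (localLoss D f i)) L (Lσ ^ 2 / b') := by
  have := (D i).isProbabilityMeasure_batchLaw hb'
  have hm : ∀ v, MemLp (fun B : Fin b' → Ξ => batchGrad (f i) v B) 2 ((D i).batchLaw b') :=
    fun v => memLp_batchGrad (hR.differentiable i) (hR.measurable i) hb' (by positivity)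
      (hB i b' h1 hb' v)
  refine ⟨measurable_batchGrad (hR.differentiable i) (hR.measurable i), hm, fun v => ?_,
    (hS i).2, fun v w => ?_⟩
  · exact integral_batchGrad (hR.differentiable i) (hR.measurable i) v
      (fun β k1 k2 => hB i β k1 k2 v) h1 hb'
  · exact (integral_sq_norm_le_of_lintegral
      (((hm v).1.sub (hm w).1).sub aestronglyMeasurable_const) (by positivity)
      (hA i b' h1 hb' v w)).2

/-- Either `b` is the ceiling and `σ² / b ≤ M ε`, or `b = n` exhausts the data and there is no
noise. -/
theorem lintegral_large_noise {n : ℕ∞} (hM : 1 ≤ M) (hε : 0 < ε)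
    (hn : ∀ m, (D m).size = n) (hR : Regular D f) (hB : BoundedNoise D f σ)
    (hb : (b : ℕ∞) = min (⌈σ ^ 2 / ((M : ℝ) * ε)⌉₊ : ℕ∞) n) (h1 : 1 ≤ b) (i : Fin M) (v : Vec d) :
    ∫⁻ B : Fin b → Ξ, ‖batchGrad (f i) v B - gradient (localLoss D f i) v‖ₑ ^ 2
      ∂(D i).batchLaw b ≤ ENNReal.ofReal (M * ε) := by
  have hM0 : (0 : ℝ) < M := by positivity
  rcases le_total (⌈σ ^ 2 / ((M : ℝ) * ε)⌉₊ : ℕ∞) n with h | h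
  · rw [min_eq_left h, Nat.cast_inj] at hb
    refine (hB i b h1 (by rw [hn, hb]; exact h) v).trans (ENNReal.ofReal_le_ofReal ?_)
    have h2 := Nat.le_ceil (σ ^ 2 / ((M : ℝ) * ε))
    rw [← hb, div_le_iff₀ (by positivity)] at h2
    rw [div_le_iff₀ (by positivity)]
    linarith
  · rw [min_eq_right h, ← hn i] at hb
    exact (batchGrad_full (hR.differentiable i) (hR.measurable i) hb v).trans_le zero_le

theorem roundModel_of_assumptions {n : ℕ∞} (hA1 : 1 ≤ A) (hAM : A ≤ M) (hK : 1 ≤ K) (hL : 0 < L)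
    (hLσ : 0 ≤ Lσ) (hε : 0 < ε) (hn : ∀ m, (D m).size = n) (hR : Regular D f)
    (hS : LSmooth D f L) (hB : BoundedNoise D f σ) (hA : AvgSmooth D f Lσ)
    (hb : (b : ℕ∞) = min (⌈σ ^ 2 / ((M : ℝ) * ε)⌉₊ : ℕ∞) n) (hb'1 : 1 ≤ b') (hb' : b' < b)
    (hηs : 0 < ηs) (hηl : 0 < ηl) (h1 : ηl ≤ 1 / (2 * √6 * K * L))
    (h2 : ηl * (4 * √3 * Lσ) ≤ √((b' : ℝ) / K)) :
    RoundModel D f A b b' K (fun i => gradient (localLoss D f i)) L (Lσ ^ 2 / b') ηs ηl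
      (M * ε) := by
  have hbn : ∀ m, (b : ℕ∞) ≤ (D m).size := fun m => by
    rw [hn, hb]; exact min_le_right _ _
  have hbn' : ∀ m, (b' : ℕ∞) ≤ (D m).size := fun m =>
    le_trans (by exact_mod_cast hb'.le) (hbn m)
  have hnoise := lintegral_large_noise (b := b) (hA1.trans hAM) hε hn hR hB hb (by omega)
  have hml : ∀ i v, MemLp (fun B : Fin b → Ξ => batchGrad (f i) v B) 2 ((D i).batchLaw b) :=
    fun i v => memLp_batchGrad (hR.differentiable i) (hR.measurable i) (hbn i) (by positivity)
      (hnoise i v)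
  refine ⟨⟨hA1, hAM, hbn, hbn'⟩, smallStep_of_le hK hL hb'1 hηl h1 h2 hLσ, hηs.le,
    fun i => gradOracle_localLoss hR hS hB hA i hb'1 (hbn' i),
    fun i => measurable_batchGrad (hR.differentiable i) (hR.measurable i), hml, fun i v => ?_,
    fun i v => ?_⟩
  · exact integral_batchGrad (hR.differentiable i) (hR.measurable i) v
      (fun β k1 k2 => hB i β k1 k2 v) (by omega) (hbn i)
  · have := (D i).isProbabilityMeasure_batchLaw (hbn i)
    exact (integral_sq_norm_le_of_lintegral ((hml i v).1.sub aestronglyMeasurable_const)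
      (by positivity) (hnoise i v)).2

theorem gradient_globalLoss (hS : LSmooth D f L) (x : Vec d) :
    HasGradientAt (globalLoss D f) (meanField (fun i => gradient (localLoss D f i)) x) x := by
  have h1 : DifferentiableAt ℝ (globalLoss D f) x := by
    unfold globalLoss
    exact (DifferentiableAt.fun_sum fun i _ => (hS i).1 x).const_mul _
  have h2 := h1.hasGradientAt
  have h3 : gradient (globalLoss D f) x = meanField (fun i => gradient (localLoss D f i)) x :=
    gradient_const_mul_sum (fun i => (hS i).1) _ x
  rwa [h3] at h2

end Assumptions

end FedAMD

end

/-! ### The convergence theorem -/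

theorem theorem2 (L Δ : ℝ) (hL : 0 < L) :
    ∃ C : ℝ, 0 < C ∧
      ∀ (Ξ : Type*) [MeasurableSpace Ξ] (d M A K τ b b' : ℕ) (n : ℕ∞)
        (σ Lσ ε ηs ηl : ℝ) (x₀ : FedAMD.Vec d)
        (D : Fin M → FedAMD.LocalData Ξ) (f : Fin M → FedAMD.Vec d → Ξ → ℝ),
        1 ≤ A → A ≤ M → 1 ≤ K → 2 ≤ τ → 0 ≤ σ → 0 ≤ Lσ → 0 < ε →
        (∀ m, (D m).size = n) →
        FedAMD.Regular D f →
        FedAMD.LSmooth D f L →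
        FedAMD.BoundedNoise D f σ →
        FedAMD.AvgSmooth D f Lσ →
        BddBelow (Set.range (FedAMD.globalLoss D f)) →
        FedAMD.globalLoss D f x₀ - ⨅ x, FedAMD.globalLoss D f x ≤ Δ →
        (b : ℕ∞) = min (⌈σ ^ 2 / ((M : ℝ) * ε)⌉₊ : ℕ∞) n →
        1 ≤ b' → b' < b →
        0 < ηs → 0 < ηl →
        ηs * ηl = 1 / (K * L) * (1 + 2 * (M : ℝ) * τ / A)⁻¹ →
        ηl ≤ 1 / (2 * √6 * K * L) →
        ηl * (4 * √3 * Lσ) ≤ √((b' : ℝ) / K) →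
        ∀ T : ℕ, C * ((1 + 2 * (M : ℝ) * τ / A) * ((τ : ℝ) / (τ - 1)) * (1 / ε)) ≤ T →
          ∃ t < T,
            MeasureTheory.Integrable
              (fun ω : FedAMD.Seed Ξ M b b' K =>
                ‖gradient (FedAMD.globalLoss D f) (FedAMD.run f ηs ηl x₀ ω t).model‖ ^ 2)
              (FedAMD.seedLaw D A b b' K (FedAMD.seqProb τ)) ∧
            ∫ ω : FedAMD.Seed Ξ M b b' K,
                ‖gradient (FedAMD.globalLoss D f) (FedAMD.run f ηs ηl x₀ ω t).model‖ ^ 2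
              ∂(FedAMD.seedLaw D A b b' K (FedAMD.seqProb τ)) ≤ ε := by
  -- `1200 = 2 · 12 / 0.02`, where the `2` pays for rounding `T / τ` down. The summand `1` keeps the
  -- constant positive and makes the required inequality strict.
  refine ⟨1200 * (L * |Δ|) + 1, by positivity, ?_⟩
  intro Ξ _ d M A K τ b b' n σ Lσ ε ηs ηl x₀ D f hA1 hAM hK hτ _ hLσ hε hn hR hS hB hA hbdd hΔ hb
    hb'1 hb' hηs hηl hη h1 h2 T hT
  have H := FedAMD.roundModel_of_assumptions hA1 hAM hK hL hLσ hε hn hR hS hB hA hb hb'1 hb'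
    hηs hηl h1 h2
  have hM1 : 1 ≤ M := hA1.trans hAM
  have hA0 : (0 : ℝ) < A := by positivity
  have hM0 : (0 : ℝ) < M := by positivity
  have hK0 : (0 : ℝ) < K := by positivity
  have hτ' : (2 : ℝ) ≤ τ := by exact_mod_cast hτ
  have hτ1 : (0 : ℝ) < τ - 1 := by linarith
  have hF : FedAMD.SmoothBounded (FedAMD.globalLoss D f)
      (FedAMD.meanField fun i => gradient (FedAMD.localLoss D f i)) L
      (⨅ x, FedAMD.globalLoss D f x) :=
    ⟨hL, FedAMD.gradient_globalLoss hS, H.norm_meanField_sub_le, ciInf_le hbdd⟩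
  have hgrad : ∀ x, gradient (FedAMD.globalLoss D f) x =
      FedAMD.meanField (fun i => gradient (FedAMD.localLoss D f i)) x := fun x =>
    (FedAMD.gradient_globalLoss hS x).gradient
  have hp : ∀ t, FedAMD.seqProb τ t = 0 ∨ FedAMD.seqProb τ t = 1 := fun t => by
    unfold FedAMD.seqProb
    split_ifs <;> simp
  have hp0 : ∀ t, 0 ≤ FedAMD.seqProb τ t := fun t => by rcases hp t with h | h <;> simp [h]
  have hp1 : ∀ t, FedAMD.seqProb τ t ≤ 1 := fun t => by rcases hp t with h | h <;> simp [h]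
  have hprob := FedAMD.isProbabilityMeasure_seedLaw (K := K) H.sizes hp0 hp1
  simp only [hgrad]
  suffices h : ∃ t < T, FedAMD.gradSq (fun i => gradient (FedAMD.localLoss D f i))
      (FedAMD.seedLaw D A b b' K (FedAMD.seqProb τ))
      (fun ω => FedAMD.run f ηs ηl x₀ ω t) ≤ ε by
    obtain ⟨t, ht, hle⟩ := h
    exact ⟨t, ht, (H.memLp_meanField (H.memLp_run hp x₀ t).1).integrable_norm_pow two_ne_zero, hle⟩
  obtain ⟨Q, hQ⟩ : ∃ Q : ℝ, Q = 1 + 2 * (M : ℝ) * τ / A := ⟨_, rfl⟩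
  rw [← hQ] at hη hT
  have hQ0 : 0 < Q := by rw [hQ]; positivity
  have hT0 : 0 < (T : ℝ) := lt_of_lt_of_le (by positivity) hT
  -- If `ε > 2 L Δ`, the starting point already has squared gradient at most `2 L Δ < ε` and `t = 0`
  -- works.
  rcases le_or_gt ε (2 * L * Δ) with hεΔ | hεΔ
  · have hLΔ : 0 < L * Δ := by linarith
    have hΔ0 : 0 < Δ := pos_of_mul_pos_right hLΔ hL.le
    rw [abs_of_pos hΔ0] at hT
    have hT' : (1200 * (L * Δ) + 1) * (Q / (τ - 1)) * τ ≤ T * ε := by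
      have h3 := mul_le_mul_of_nonneg_right hT hε.le
      refine le_trans (le_of_eq ?_) h3
      field_simp
    have hQτ : 1 ≤ Q / (τ - 1) := by
      rw [le_div_iff₀ hτ1, hQ]
      have h3 : (1 : ℝ) ≤ M / A := by
        rw [le_div_iff₀ hA0, one_mul]
        exact_mod_cast hAM
      have e : 2 * (M : ℝ) * τ / A = 2 * τ * (M / A) := by ring
      rw [e]
      have h4 := mul_le_mul_of_nonneg_left h3 (by positivity : (0 : ℝ) ≤ 2 * τ)
      linarith
    have hTτ : (τ : ℝ) ≤ T := by
      have h3 : (2 * L * Δ) * τ ≤ (1200 * (L * Δ) + 1) * (Q / (τ - 1)) * τ := by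
        have h4 := mul_le_mul_of_nonneg_left hQτ (by positivity : 0 ≤ 1200 * (L * Δ) + 1)
        exact mul_le_mul_of_nonneg_right (by linarith) (by linarith)
      have h5 := mul_le_mul_of_nonneg_left hεΔ hT0.le
      have h6 : (2 * L * Δ) * τ ≤ (2 * L * Δ) * T := by linarith
      exact le_of_mul_le_mul_left h6 (by linarith)
    -- At least one full period fits into `T` rounds, so the number of full periods is at least half
    -- of `T / τ`.
    have hN : (T : ℝ) ≤ 2 * τ * (T / τ : ℕ) := by
      have h3 : T < τ * (T / τ + 1) := Nat.lt_mul_div_succ T (by omega)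
      have h4 : 1 ≤ T / τ := (Nat.one_le_div_iff (by omega)).2 (by exact_mod_cast hTτ)
      have h5 : τ * (T / τ + 1) ≤ τ * (2 * (T / τ)) := Nat.mul_le_mul_left τ (by omega)
      have h6 : T ≤ τ * (2 * (T / τ)) := (h3.trans_le h5).le
      calc (T : ℝ) ≤ ((τ * (2 * (T / τ)) : ℕ) : ℝ) := by exact_mod_cast h6
        _ = _ := by push_cast; ring
    have hη' : ηs * ηl * K * (L * (1 + 2 * M * τ / A)) = 1 := by
      rw [← hQ, hη]
      field_simp
    obtain ⟨j, hj, hle⟩ := H.exists_gradSq_le hτ x₀ hF hε hΔ hεΔ hη' (T / τ) (by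
      rw [← hQ]
      have h3 := mul_le_mul_of_nonneg_right hN hε.le
      have h4 : (1200 * (L * Δ) + 1) * (Q / (τ - 1)) * τ ≤ 2 * (T / τ : ℕ) * ε * τ := by linarith
      have h5 := le_of_mul_le_mul_right h4 (by linarith)
      linarith)
    refine ⟨j * τ, ?_, hle⟩
    calc j * τ < T / τ * τ := Nat.mul_lt_mul_of_pos_right hj (by omega)
      _ ≤ T := Nat.div_mul_le_self T τ
  · refine ⟨0, by exact_mod_cast hT0, ?_⟩
    have h3 := hF.sq_norm_le x₀
    rw [div_le_iff₀ (by positivity)] at h3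
    have h4 := mul_le_mul_of_nonneg_right hΔ (by positivity : 0 ≤ 2 * L)
    simp only [FedAMD.gradSq, FedAMD.run, MeasureTheory.integral_const,
      MeasureTheory.probReal_univ, one_smul]
    linarith
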